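/- Let $k$ be an algebraically closed field of characteristic zero, $P=\mathbb P^2(k)$ with homogeneous coordinates $X,Y,Z$, and let $R_d$ be the space of forms of degree $d$ in $X,Y,Z$. A net of conics $\pi$ is a plane in $\mathbb P(R_2)$, i.e. a three-dimensional subspace of $R_2$; $\Gamma_\pi$ is the intersection of $\pi$ with the cubic hypersurface of singular conics. For a cubic form $\phi$, $J_\phi$ is the span of its partial derivatives, and its Hessian $H$ is the curve whose equation is the determinant of the matrix of second partial derivatives of $\phi$. Points $x,y\in P$ are conjugate with respect to the conic $q=0$ if $B_q(x,y)=0$, where $B_q$ is the symmetric bilinear form of $q$; $y$ is a common conjugate of $x$ for $\pi$ if $x,y$ are conjugate with respect to every conic of $\pi$. Curves are identified with their equations up to a nonzero scalar. A double point of an involution is a fixed point. (a) Let $\pi$ be a net of conics such that $\Gamma_\pi$ is a smooth cubic. There is a unique cubic $\phi$ with $\pi=J_\phi$, and $\phi$ is smooth. Let $H$ be its Hessian; it is a smooth cubic. A point of $P$ has a common conjugate for $\pi$ if and only if it lies on $H$. The common conjugate is then unique, distinct from the point, and lies on $H$. The map $i:H\to H$ sending a point to its common conjugate is a regular involution without fixed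 point, and $$\pi=\{\gamma \text{ a conic} : \forall x\in H,\ x \text{ and } i(x) \text{ are conjugate with respect to } \gamma\}.$$ (b) Conversely, let $H$ be a smooth plane cubic with a regular involution $i:H\to H$ without fixed point. Then $$\pi_{H,i}=\{\gamma \text{ a conic} : \forall x\in H,\ x \text{ and } i(x) \text{ are conjugate with respect to } \gamma\}$$ is a net of conics with $\Gamma_{\pi_{H,i}}$ smooth. If $\phi$ is the cubic with $\pi_{H,i}=J_\phi$, then $H$ is the Hessian of $\phi$, and $i(x)$ is the common conjugate of $x$ for $\pi_{H,i}$, for every $x\in H$. (c) Hence the classification of the pairs $(H,i)$ as in (b) is equivalent to that of the nets $\pi$ with $\Gamma_\pi$ smooth: every such $\pi$ is of the form $\pi_{H,i}$, and for two pairs $(H,i)$, $(H',i')$ a projective transformation $g$ of $P$ carries $(H,i)$ to $(H',i')$ if and only if it carries $\pi_{H,i}$ to $\pi_{H',i'}$. (d) A smooth plane cubic $H$ has exactly three regular involutions without fixed point. For each point $O\in H$ there is exactly one algebraic group structure on $H$ with origin $O$; for every algebraic group structure on $H$, there are exactly three points of order two, and the regular involutions without fixed point are exactly the translations by these points. -/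

import Mathlib

open scoped LinearAlgebra.Projectivization

namespace NetsOfConics

open MvPolynomial

variable {k : Type*} [Field k]

/-- The projective plane over `k`. -/
abbrev Plane (k : Type*) [Field k] : Type _ := ℙ k (Fin 3 → k)

/-- The points of the plane curve with equation `F = 0` (used for homogeneous `F`). -/
def curvePoints (F : MvPolynomial (Fin 3) k) : Set (Plane k) :=
  {p | eval p.rep F = 0}

/-- `F` is a ternary cubic form whose curve is smooth: the partial derivatives have no common
zero on the curve. (The zero form does not satisfy this.) -/
def IsSmoothCubic (F : MvPolynomial (Fin 3) k) : Prop :=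
  F.IsHomogeneous 3 ∧ ∀ v : Fin 3 → k, v ≠ 0 → eval v F = 0 → ∃ j, eval v (pderiv j F) ≠ 0

/-- The Hessian form: the determinant of the matrix of second partial derivatives. -/
noncomputable def hessian (F : MvPolynomial (Fin 3) k) : MvPolynomial (Fin 3) k :=
  (Matrix.of fun i j => pderiv i (pderiv j F)).det

/-- The space spanned by the first partial derivatives. -/
noncomputable def jacobianNet (F : MvPolynomial (Fin 3) k) :
    Submodule k (MvPolynomial (Fin 3) k) :=
  Submodule.span k (Set.range fun j => pderiv j F)

/-- A net of conics: a projective plane in the projective space of conics, that is, a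
three-dimensional space of quadratic forms. -/
def IsNet (V : Submodule k (MvPolynomial (Fin 3) k)) : Prop :=
  V ≤ homogeneousSubmodule (Fin 3) k 2 ∧ Module.finrank k V = 3

/-- For quadratic forms `v 0, v 1, v 2`, the determinant of the (constant) matrix of second
partial derivatives of `a₀ v₀ + a₁ v₁ + a₂ v₂`, as a form in `a₀, a₁, a₂`. When the `v l` form a
basis of a net, it is the equation, in the coordinates `a₀, a₁, a₂` of the net, of the
intersection of the net with the hypersurface of singular conics. -/
noncomputable def discriminant (v : Fin 3 → MvPolynomial (Fin 3) k) : MvPolynomial (Fin 3) k :=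
  (Matrix.of fun i j => ∑ l, C (coeff 0 (pderiv i (pderiv j (v l)))) * X l).det

/-- `V` is a net of conics whose curve of singular members is a smooth cubic. (A change of
basis of `V` changes the discriminant by an invertible linear substitution, so the choice of
basis does not matter.) -/
def IsNetWithSmoothDiscriminant (V : Submodule k (MvPolynomial (Fin 3) k)) : Prop :=
  IsNet V ∧ ∃ b : Module.Basis (Fin 3) k V,
    IsSmoothCubic (discriminant fun l => (b l : MvPolynomial (Fin 3) k))

/-- `x` and `y` are conjugate with respect to the conic `q = 0`: the value
`∑ j, yⱼ (∂q/∂xⱼ)(x)` at `(x, y)` of the symmetric bilinear form attached to `q` vanishes. -/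
def Conjugate (q : MvPolynomial (Fin 3) k) (x y : Plane k) : Prop :=
  ∑ j, y.rep j * eval x.rep (pderiv j q) = 0

/-- `y` is conjugate to `x` with respect to all the conics of `V`. -/
def CommonConjugate (V : Submodule k (MvPolynomial (Fin 3) k)) (x y : Plane k) : Prop :=
  ∀ q ∈ V, Conjugate q x y

/-- The conics with respect to which `x` and `i x` are conjugate, for all `x` in `S`. -/
def conicsConjugate {S : Set (Plane k)} (i : S → S) : Submodule k (MvPolynomial (Fin 3) k) where
  carrier := {q | q.IsHomogeneous 2 ∧ ∀ x : S, Conjugate q x (i x)}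
  zero_mem' := ⟨isHomogeneous_zero _ _ _, fun x => by simp [Conjugate]⟩
  add_mem' := by
    rintro a b ⟨ha, ha'⟩ ⟨hb, hb'⟩
    refine ⟨ha.add hb, fun x => ?_⟩
    have h1 := ha' x
    have h2 := hb' x
    simp only [Conjugate] at h1 h2 ⊢
    simp only [map_add, mul_add, Finset.sum_add_distrib, h1, h2, add_zero]
  smul_mem' := by
    rintro c a ⟨ha, ha'⟩
    refine ⟨(homogeneousSubmodule (Fin 3) k 2).smul_mem c ha, fun x => ?_⟩
    have h1 := ha' x
    simp only [Conjugate] at h1 ⊢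
    simp only [Derivation.map_smul, smul_eval, mul_left_comm _ c, ← Finset.mul_sum, h1, mul_zero]

/-- Regular maps between projective plane curves (over an algebraically closed field): maps
given, near each point, by three forms of the same degree without common zero there. -/
def IsRegularMap {S T : Set (Plane k)} (f : S → T) : Prop :=
  ∀ x : S, ∃ (d : ℕ) (g : Fin 3 → MvPolynomial (Fin 3) k),
    (∀ j, (g j).IsHomogeneous d) ∧
    (fun j => eval (x : Plane k).rep (g j)) ≠ 0 ∧
    ∀ (y : S) (hy : (fun j => eval (y : Plane k).rep (g j)) ≠ 0),
      (f y : Plane k) = Projectivization.mk k _ hy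

/-- Regular maps from a product of two plane curves to a plane curve: maps given, near each
point, by three bihomogeneous forms of the same bidegree without common zero there. -/
def IsRegularMap₂ {S T U : Set (Plane k)} (f : S → T → U) : Prop :=
  ∀ (x : S) (y : T), ∃ (d e : ℕ) (g : Fin 3 → MvPolynomial (Fin 3 ⊕ Fin 3) k),
    (∀ j, IsWeightedHomogeneous (Sum.elim (fun _ => 1) (fun _ => 0) : Fin 3 ⊕ Fin 3 → ℕ) (g j) d ∧
      IsWeightedHomogeneous (Sum.elim (fun _ => 0) (fun _ => 1) : Fin 3 ⊕ Fin 3 → ℕ) (g j) e) ∧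
    (fun j => eval (Sum.elim (x : Plane k).rep (y : Plane k).rep) (g j)) ≠ 0 ∧
    ∀ (x' : S) (y' : T)
      (h : (fun j => eval (Sum.elim (x' : Plane k).rep (y' : Plane k).rep) (g j)) ≠ 0),
      (f x' y' : Plane k) = Projectivization.mk k _ h

/-- A regular involution without fixed point. -/
structure IsFreeRegularInvolution {S : Set (Plane k)} (i : S → S) : Prop where
  regular : IsRegularMap i
  involutive : Function.Involutive i
  ne_self : ∀ x, i x ≠ x

/-- A group structure on the points of a curve is algebraic if its addition and its opposite
are regular maps. -/
structure IsAlgebraicGroup (S : Set (Plane k)) [AddGroup S] : Prop where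
  regular_add : IsRegularMap₂ (fun x y : S => x + y)
  regular_neg : IsRegularMap (fun x : S => -x)

/-- The form `F ∘ g`, for a linear automorphism `g` of `k³`. -/
noncomputable def pullback (g : (Fin 3 → k) ≃ₗ[k] (Fin 3 → k)) (F : MvPolynomial (Fin 3) k) :
    MvPolynomial (Fin 3) k :=
  aeval (fun i => ∑ j, C (g (Pi.single j 1) i) * X j) F

/-- The projective transformation induced by `g` carries the space of forms `V` to `V'`. -/
def CarriesNet (g : (Fin 3 → k) ≃ₗ[k] (Fin 3 → k))
    (V V' : Submodule k (MvPolynomial (Fin 3) k)) : Prop :=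
  ∀ q, q ∈ V' ↔ pullback g q ∈ V

/-- The projective transformation induced by `g` carries the curve `G = 0` to the curve `G' = 0`,
and the self-map `i` of the first to the self-map `i'` of the second. -/
def CarriesCurve (g : (Fin 3 → k) ≃ₗ[k] (Fin 3 → k))
    (G : MvPolynomial (Fin 3) k) (i : curvePoints G → curvePoints G)
    (G' : MvPolynomial (Fin 3) k) (i' : curvePoints G' → curvePoints G') : Prop :=
  (∃ c : k, c ≠ 0 ∧ pullback g G' = c • G) ∧
    ∀ (x : curvePoints G) (x' : curvePoints G'),
      (x' : Plane k) = g • (x : Plane k) → (i' x' : Plane k) = g • (i x : Plane k)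

end NetsOfConics

open NetsOfConics

namespace NetsOfConics

open MvPolynomial

open scoped Matrix

section Homogeneity

variable {k : Type*} [Field k] {σ : Type*}

theorem eval_weighted_scaling (w : σ → ℕ) (p : MvPolynomial σ k) (t : k) (v : σ → k) :
    eval (fun i => t ^ w i * v i) p =
      ∑ s ∈ p.support, t ^ (Finsupp.weight w s) * (coeff s p * s.prod fun i n => v i ^ n) := by
  rw [eval_eq]
  refine Finset.sum_congr rfl fun s _ => ?_
  have : (Finsupp.weight w s) = ∑ i ∈ s.support, w i * s i := by
    rw [Finsupp.weight_apply, Finsupp.sum]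
    exact Finset.sum_congr rfl fun i _ => by simp [mul_comm]
  rw [this, ← Finset.prod_pow_eq_pow_sum, Finsupp.prod, mul_left_comm, ← Finset.prod_mul_distrib]
  congr 1
  exact Finset.prod_congr rfl fun i _ => by rw [mul_pow, ← pow_mul]

theorem eval_scaling_of_isWeightedHomogeneous {w : σ → ℕ} {p : MvPolynomial σ k} {d : ℕ}
    (hp : IsWeightedHomogeneous w p d) (t : k) (v : σ → k) :
    eval (fun i => t ^ w i * v i) p = t ^ d * eval v p := by
  rw [eval_weighted_scaling, eval_eq, Finset.mul_sum]
  exact Finset.sum_congr rfl fun s hs => by rw [hp (mem_support_iff.mp hs)]; rfl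

theorem isHomogeneous_eval_smul {p : MvPolynomial σ k} {d : ℕ}
    (hp : p.IsHomogeneous d) (t : k) (v : σ → k) : eval (t • v) p = t ^ d * eval v p := by
  have := eval_scaling_of_isWeightedHomogeneous (w := 1) hp t v
  simpa [Pi.smul_def] using this

theorem eval_weightedHomogeneousComponent [Infinite k] (w : σ → ℕ) (p : MvPolynomial σ k)
    (d : ℕ) (v : σ → k) (c : k) (h : ∀ t, t ≠ 0 → eval (fun i => t ^ w i * v i) p = t ^ d * c) (n : ℕ) :
    eval v (weightedHomogeneousComponent w n p) = if n = d then c else 0 := by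
  classical
  have key : ∑ s ∈ p.support, Polynomial.monomial (Finsupp.weight w s)
      (coeff s p * s.prod fun i n => v i ^ n) = Polynomial.monomial d c := by
    refine mul_left_cancel₀ Polynomial.X_ne_zero (Polynomial.funext fun t => ?_)
    rcases eq_or_ne t 0 with rfl | ht
    · simp
    rw [Polynomial.eval_mul, Polynomial.eval_mul]
    congr 1
    rw [Polynomial.eval_finsetSum, Polynomial.eval_monomial, mul_comm, ← h t ht,
      eval_weighted_scaling]
    exact Finset.sum_congr rfl fun s _ => by rw [Polynomial.eval_monomial, mul_comm]
  have h2 := congrArg (fun q => Polynomial.coeff q n) key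
  simp only [Polynomial.finsetSum_coeff, Polynomial.coeff_monomial] at h2
  rw [weightedHomogeneousComponent_apply, map_sum, Finset.sum_filter]
  simp only [eval_monomial]
  rw [h2]
  simp [eq_comm]

theorem isWeightedHomogeneous_of_eval [Infinite k] {w : σ → ℕ} {p : MvPolynomial σ k} {d : ℕ}
    (h : ∀ (t : k) v, eval (fun i => t ^ w i * v i) p = t ^ d * eval v p) :
    IsWeightedHomogeneous w p d := by
  have : p = weightedHomogeneousComponent w d p := by
    refine MvPolynomial.funext fun v => ?_
    rw [eval_weightedHomogeneousComponent w p d v _ (fun t _ => h t v) d, if_pos rfl]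
  rw [this]
  exact weightedHomogeneousComponent_isWeightedHomogeneous d p

theorem isHomogeneous_of_eval [Infinite k] {p : MvPolynomial σ k} {d : ℕ}
    (h : ∀ (t : k) v, eval (t • v) p = t ^ d * eval v p) : p.IsHomogeneous d := by
  refine isWeightedHomogeneous_of_eval fun t v => ?_
  simpa [Pi.smul_def] using h t v

theorem isHomogeneous_zero_eq_C {p : MvPolynomial σ k} (h : p.IsHomogeneous 0) :
    p = C (coeff 0 p) := by
  rw [← homogeneousComponent_zero, homogeneousComponent_eq_self h]

theorem eval_zero_of_isHomogeneous {p : MvPolynomial σ k} {d : ℕ} (h : p.IsHomogeneous d)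
    (hd : d ≠ 0) : eval 0 p = 0 := by
  have := isHomogeneous_eval_smul h 0 0
  simpa [hd] using this

/-- A factor of a nonzero form is a form. -/
theorem isHomogeneous_of_mul {A B : MvPolynomial σ k} {d : ℕ} [Infinite k]
    (h : (A * B).IsHomogeneous d) (h0 : A * B ≠ 0) :
    ∃ a b, A.IsHomogeneous a ∧ B.IsHomogeneous b ∧ a + b = d := by
  classical
  let Φ : MvPolynomial σ k →ₐ[k] Polynomial (MvPolynomial σ k) :=
    aeval fun i => Polynomial.X * Polynomial.C (X i)
  have hcoe : ∀ (p : MvPolynomial σ k) (v : σ → k) (t : k),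
      ((Φ p).map (eval v)).eval t = eval (t • v) p := by
    intro p v t
    induction p using MvPolynomial.induction_on with
    | C a =>
      simp [Φ, Polynomial.algebraMap_apply, MvPolynomial.algebraMap_eq]
    | add p q hp hq => simp only [map_add, Polynomial.map_add, Polynomial.eval_add, hp, hq]
    | mul_X p i hp =>
      simp only [map_mul, Polynomial.map_mul, Polynomial.eval_mul, hp]
      simp only [Φ, aeval_X, Polynomial.map_mul, Polynomial.map_X, Polynomial.map_C, eval_X,
        Polynomial.eval_mul, Polynomial.eval_X, Polynomial.eval_C, Pi.smul_apply, smul_eq_mul]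
  have hinj : ∀ p, Φ p = 0 → p = 0 := by
    intro p hp
    refine MvPolynomial.funext fun v => ?_
    have := hcoe p v 1
    rw [hp] at this
    simpa using this.symm
  have hmono : ∀ (p : MvPolynomial σ k) (n : ℕ) (q : MvPolynomial σ k),
      Φ p = Polynomial.monomial n q → p.IsHomogeneous n := by
    intro p n q hpq
    refine isHomogeneous_of_eval fun t v => ?_
    have h1 := hcoe p v 1
    rw [← hcoe p v t, hpq]
    rw [hpq] at h1
    simp only [Polynomial.map_monomial, Polynomial.eval_monomial, one_pow, mul_one, one_smul] at h1 ⊢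
    rw [h1, mul_comm]
  have hAB : Φ A * Φ B = Polynomial.monomial d (A * B) := by
    rw [← map_mul]
    refine Polynomial.ext fun n => MvPolynomial.funext fun v => ?_
    have : (Φ (A * B)).map (eval v) = Polynomial.monomial d (eval v (A * B)) := by
      refine Polynomial.funext fun t => ?_
      rw [hcoe, isHomogeneous_eval_smul h, Polynomial.eval_monomial, mul_comm]
    have h2 := congrArg (fun q => Polynomial.coeff q n) this
    simp only [Polynomial.coeff_map, Polynomial.coeff_monomial] at h2 ⊢
    rw [h2]
    split_ifs <;> simp
  have hA : Φ A ≠ 0 := fun hA => h0 (by rw [hinj A hA, zero_mul])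
  have hB : Φ B ≠ 0 := fun hB => h0 (by rw [hinj B hB, mul_zero])
  have e1 : (Φ A).natDegree + (Φ B).natDegree = d := by
    rw [← Polynomial.natDegree_mul hA hB, hAB, Polynomial.natDegree_monomial_eq _ h0]
  have e2 : (Φ A).natTrailingDegree + (Φ B).natTrailingDegree = d := by
    rw [← Polynomial.natTrailingDegree_mul hA hB, hAB, Polynomial.natTrailingDegree_monomial h0]
  have l1 := Polynomial.natTrailingDegree_le_natDegree (Φ A)
  have l2 := Polynomial.natTrailingDegree_le_natDegree (Φ B)
  have fin : ∀ p : Polynomial (MvPolynomial σ k), p.natTrailingDegree = p.natDegree →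
      p = Polynomial.monomial p.natDegree (p.coeff p.natDegree) := by
    intro p hp
    ext1 n
    rw [Polynomial.coeff_monomial]
    split_ifs with hn
    · rw [hn]
    · rcases lt_or_gt_of_ne hn with hn | hn
      · exact Polynomial.coeff_eq_zero_of_natDegree_lt hn
      · exact Polynomial.coeff_eq_zero_of_lt_natTrailingDegree (hp ▸ hn)
  exact ⟨_, _, hmono A _ _ (fin _ (by omega)), hmono B _ _ (fin _ (by omega)), e1⟩

end Homogeneity

section Bezout

variable {k : Type*} [Field k]

/-- The prime ideal of the coordinate subspace where the coordinates in `s` vanish. -/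
noncomputable def coordinateIdeal (k : Type*) [Field k] (s : Finset (Fin 3)) :
    Ideal (MvPolynomial (Fin 3) k) :=
  RingHom.ker (aeval fun i => if i ∈ s then 0 else X i :
    MvPolynomial (Fin 3) k →ₐ[k] MvPolynomial (Fin 3) k)

instance (s : Finset (Fin 3)) : (coordinateIdeal k s).IsPrime := RingHom.ker_isPrime _

theorem coordinateIdeal_lt {s t : Finset (Fin 3)} (h : s ⊂ t) :
    coordinateIdeal k s < coordinateIdeal k t := by
  have hle : coordinateIdeal k s ≤ coordinateIdeal k t := by
    intro p hp
    rw [coordinateIdeal, RingHom.mem_ker] at hp ⊢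
    have : (aeval fun i => if i ∈ t then 0 else X i :
        MvPolynomial (Fin 3) k →ₐ[k] MvPolynomial (Fin 3) k) =
        (aeval fun i => if i ∈ t then 0 else X i).comp (aeval fun i => if i ∈ s then 0 else X i) := by
      ext1 i
      by_cases hs : i ∈ s
      · simp [hs, h.1 hs]
      · simp [hs]
    rw [this, AlgHom.comp_apply]
    erw [hp]
    simp
  refine lt_of_le_of_ne hle fun heq => ?_
  obtain ⟨i, hi, his⟩ := Finset.exists_of_ssubset h
  have h1 : (X i : MvPolynomial (Fin 3) k) ∈ coordinateIdeal k t := by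
    simp [coordinateIdeal, RingHom.mem_ker, hi]
  rw [← heq] at h1
  simp [coordinateIdeal, RingHom.mem_ker, his] at h1

theorem three_le_height : 3 ≤ (coordinateIdeal k Finset.univ).height := by
  have h1 := Ideal.height_add_one_le_of_lt_of_isPrime
    (coordinateIdeal_lt (k := k) (s := ∅) (t := {0}) (by decide))
  have h2 := Ideal.height_add_one_le_of_lt_of_isPrime
    (coordinateIdeal_lt (k := k) (s := {0}) (t := {0, 1}) (by decide))
  have h3 := Ideal.height_add_one_le_of_lt_of_isPrime
    (coordinateIdeal_lt (k := k) (s := {0, 1}) (t := Finset.univ) (by decide))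
  calc (3 : ℕ∞) = 0 + 1 + 1 + 1 := by norm_num
    _ ≤ (coordinateIdeal k ∅).height + 1 + 1 + 1 := by gcongr; exact zero_le
    _ ≤ _ := by
      refine le_trans ?_ h3
      gcongr
      refine le_trans ?_ h2
      gcongr

theorem mem_coordinateIdeal_univ (p : MvPolynomial (Fin 3) k) :
    p ∈ coordinateIdeal k Finset.univ ↔ eval 0 p = 0 := by
  have : (aeval fun i => if i ∈ Finset.univ then 0 else X i :
      MvPolynomial (Fin 3) k →ₐ[k] MvPolynomial (Fin 3) k) p = C (eval 0 p) := by
    induction p using MvPolynomial.induction_on with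
    | C a => simp [MvPolynomial.algebraMap_eq]
    | add p q hp hq => simp only [map_add, hp, hq]
    | mul_X p i hp => simp
  rw [coordinateIdeal, RingHom.mem_ker]
  erw [this]
  simp

/-- Two plane curves meet. -/
theorem exists_common_zero [IsAlgClosed k] (A B : MvPolynomial (Fin 3) k) (hA : eval 0 A = 0)
    (hB : eval 0 B = 0) : ∃ v : Fin 3 → k, v ≠ 0 ∧ eval v A = 0 ∧ eval v B = 0 := by
  by_contra! hcon
  set I : Ideal (MvPolynomial (Fin 3) k) := Ideal.span {A, B}
  have hrad : I.radical = coordinateIdeal k Finset.univ := by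
    rw [← vanishingIdeal_zeroLocus_eq_radical (K := k) I]
    ext p
    rw [mem_vanishingIdeal_iff, mem_coordinateIdeal_univ]
    have hz : zeroLocus k I = {0} := by
      ext v
      rw [zeroLocus_span]
      simp only [Set.mem_insert_iff, Set.mem_singleton_iff, forall_eq_or_imp, forall_eq,
        Set.mem_ofPred_eq, aeval_eq_eval]
      refine ⟨fun h => ?_, fun h => by subst h; exact ⟨hA, hB⟩⟩
      by_contra hv
      exact hcon v hv h.1 h.2
    rw [hz]
    simp [aeval_eq_eval]
  have hmin : coordinateIdeal k Finset.univ ∈ I.minimalPrimes := by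
    rw [← Ideal.radical_minimalPrimes, hrad, Ideal.minimalPrimes_eq_subsingleton_self]
    rfl
  have h1 := Ideal.height_le_spanRank_toENat_of_mem_minimalPrimes I _ hmin
  have h2 : I.spanRank.toENat ≤ 2 := by
    have := Submodule.spanRank_span_le_card (R := MvPolynomial (Fin 3) k) ({A, B} : Set (MvPolynomial (Fin 3) k))
    have h3 : Cardinal.mk ({A, B} : Set (MvPolynomial (Fin 3) k)) ≤ 2 := by
      refine (Cardinal.mk_insert_le).trans ?_
      rw [Cardinal.mk_singleton]; norm_num
    have h4 := Cardinal.toENat.monotone' (this.trans h3)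
    simpa using h4
  have := (three_le_height (k := k)).trans (h1.trans h2)
  exact absurd this (by decide)

end Bezout

section Calculus

variable {k : Type*} [Field k]

theorem eval_pullback (g : (Fin 3 → k) ≃ₗ[k] (Fin 3 → k)) (F : MvPolynomial (Fin 3) k)
    (v : Fin 3 → k) : eval v (pullback g F) = eval (g v) F := by
  rw [pullback, ← MvPolynomial.coe_aeval_eq_eval, RingHom.coe_coe, ← AlgHom.comp_apply,
    MvPolynomial.comp_aeval, ← MvPolynomial.coe_aeval_eq_eval, RingHom.coe_coe]
  congr 2
  ext i
  have h : v = ∑ j, v j • (Pi.single j 1 : Fin 3 → k) := by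
    ext j
    simp [Finset.sum_apply, Pi.single_apply]
  conv_rhs => rw [h, map_sum, Finset.sum_apply]
  simp [mul_comm]

theorem IsHomogeneous.pullback [Infinite k] (g : (Fin 3 → k) ≃ₗ[k] (Fin 3 → k))
    {F : MvPolynomial (Fin 3) k} {d : ℕ} (h : F.IsHomogeneous d) :
    (pullback g F).IsHomogeneous d :=
  isHomogeneous_of_eval fun t v => by
    rw [eval_pullback, eval_pullback, map_smul, isHomogeneous_eval_smul h]

theorem pullback_symm_pullback [Infinite k] (g : (Fin 3 → k) ≃ₗ[k] (Fin 3 → k))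
    (F : MvPolynomial (Fin 3) k) : pullback g.symm (pullback g F) = F :=
  MvPolynomial.funext fun v => by simp [eval_pullback]

theorem pullback_pullback_symm [Infinite k] (g : (Fin 3 → k) ≃ₗ[k] (Fin 3 → k))
    (F : MvPolynomial (Fin 3) k) : pullback g (pullback g.symm F) = F :=
  MvPolynomial.funext fun v => by simp [eval_pullback]

theorem pderiv_pullback (g : (Fin 3 → k) ≃ₗ[k] (Fin 3 → k)) (F : MvPolynomial (Fin 3) k)
    (j : Fin 3) :
    pderiv j (pullback g F) = ∑ i, C (g (Pi.single j 1) i) * pullback g (pderiv i F) := by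
  induction F using MvPolynomial.induction_on with
  | C a => simp [pullback, MvPolynomial.algebraMap_eq]
  | add p q hp hq =>
    simp only [pullback, map_add, mul_add, Finset.sum_add_distrib] at hp hq ⊢
    rw [hp, hq]
  | mul_X p i hp =>
    have e : pullback g (p * X i) = pullback g p * ∑ l, C (g (Pi.single l 1) i) * X l := by
      simp [pullback]
    rw [e, Derivation.leibniz, hp]
    have e2 : ∀ i', pullback g (pderiv i' (p * X i)) =
        pullback g (pderiv i' p) * pullback g (X i) + pullback g p * (if i' = i then 1 else 0) := by
      intro i'
      rw [Derivation.leibniz, pderiv_X]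
      simp only [pullback, smul_eq_mul, map_add, map_mul, Pi.single_apply]
      split_ifs with h1 h2 h2
      · simp only [map_one]; ring
      · exact absurd h1.symm h2
      · exact absurd h2.symm h1
      · simp only [map_zero]; ring
    have e3 : pderiv j (∑ l, C (g (Pi.single l 1) i) * X l : MvPolynomial (Fin 3) k) =
        C (g (Pi.single j 1) i) := by
      simp [map_sum, Derivation.leibniz, pderiv_X, Pi.single_apply]
    have e4 : pullback g (X i) = ∑ l, C (g (Pi.single l 1) i) * X l := by simp [pullback]
    simp only [e2, e3, e4, mul_add, Finset.sum_add_distrib, smul_eq_mul, mul_ite, mul_one, mul_zero,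
      Finset.sum_ite_eq', Finset.mem_univ, if_true]
    generalize pullback g p = P
    generalize (∑ l, C (g (Pi.single l 1) i) * X l : MvPolynomial (Fin 3) k) = S
    rw [Finset.mul_sum, add_comm]
    refine congrArg₂ _ (Finset.sum_congr rfl fun l _ => ?_) (mul_comm _ _)
    generalize pullback g (pderiv l p) = Q
    ring

theorem eval_pderiv_pullback (g : (Fin 3 → k) ≃ₗ[k] (Fin 3 → k)) (F : MvPolynomial (Fin 3) k)
    (j : Fin 3) (v : Fin 3 → k) : eval v (pderiv j (pullback g F)) =
      ∑ i, g (Pi.single j 1) i * eval (g v) (pderiv i F) := by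
  simp [pderiv_pullback, eval_pullback]

theorem IsSmoothCubic.pullback [Infinite k] {F : MvPolynomial (Fin 3) k} (h : IsSmoothCubic F)
    (g : (Fin 3 → k) ≃ₗ[k] (Fin 3 → k)) : IsSmoothCubic (pullback g F) := by
  refine ⟨IsHomogeneous.pullback g h.1, fun v hv hF => ?_⟩
  rw [eval_pullback] at hF
  obtain ⟨i, hi⟩ := h.2 (g v) (by simpa using hv) hF
  by_contra! hcon
  refine hi ?_
  simp only [eval_pderiv_pullback] at hcon
  let φ : (Fin 3 → k) →ₗ[k] k := ∑ i, (eval (g v) (pderiv i F)) • LinearMap.proj i ∘ₗ g.toLinearMap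
  have hφ : φ = 0 := by
    refine (Pi.basisFun k (Fin 3)).ext fun j => ?_
    rw [Pi.basisFun_apply, LinearMap.zero_apply, ← hcon j]
    simp [φ, mul_comm]
  have := LinearMap.congr_fun hφ (g.symm (Pi.single i 1))
  simpa [φ, Pi.single_apply] using this

/-- The matrix of second partial derivatives at a point. -/
noncomputable def hessMatrix (F : MvPolynomial (Fin 3) k) (x : Fin 3 → k) :
    Matrix (Fin 3) (Fin 3) k :=
  Matrix.of fun i j => eval x (pderiv i (pderiv j F))

theorem eval_hessian (F : MvPolynomial (Fin 3) k) (x : Fin 3 → k) :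
    eval x (hessian F) = (hessMatrix F x).det := by
  rw [hessian, RingHom.map_det]
  rfl

theorem hessMatrix_pullback (g : (Fin 3 → k) ≃ₗ[k] (Fin 3 → k)) (F : MvPolynomial (Fin 3) k)
    (x : Fin 3 → k) : hessMatrix (pullback g F) x =
      (LinearMap.toMatrix' g.toLinearMap).transpose * hessMatrix F (g x) *
        LinearMap.toMatrix' g.toLinearMap := by
  ext i j
  simp only [hessMatrix, Matrix.of_apply, pderiv_pullback, map_sum, Derivation.leibniz, pderiv_C,
    Matrix.mul_apply, Matrix.transpose_apply, LinearMap.toMatrix'_apply]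
  simp only [mul_zero, add_zero, smul_eq_mul, map_mul, eval_C, map_sum, eval_pullback]
  refine Finset.sum_congr rfl fun l _ => ?_
  rw [mul_comm]
  rfl

theorem toMatrix'_det_ne_zero (g : (Fin 3 → k) ≃ₗ[k] (Fin 3 → k)) :
    (LinearMap.toMatrix' g.toLinearMap).det ≠ 0 := by
  rw [LinearMap.det_toMatrix']
  exact g.isUnit_det'.ne_zero

theorem hessian_pullback [Infinite k] (g : (Fin 3 → k) ≃ₗ[k] (Fin 3 → k))
    (F : MvPolynomial (Fin 3) k) : hessian (pullback g F) =
      ((LinearMap.toMatrix' g.toLinearMap).det ^ 2) • pullback g (hessian F) := by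
  refine MvPolynomial.funext fun v => ?_
  rw [smul_eval, eval_pullback, eval_hessian, eval_hessian, hessMatrix_pullback, Matrix.det_mul,
    Matrix.det_mul, Matrix.det_transpose]
  ring

theorem hessian_smul (c : k) (F : MvPolynomial (Fin 3) k) :
    hessian (c • F) = c ^ 3 • hessian F := by
  have : (Matrix.of fun i j => pderiv i (pderiv j (c • F))) =
      (C c : MvPolynomial (Fin 3) k) • (Matrix.of fun i j => pderiv i (pderiv j F)) := by
    ext i j : 2
    simp [smul_eq_C_mul]
  rw [hessian, this, Matrix.det_smul, hessian, Fintype.card_fin, ← map_pow, smul_eq_C_mul]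

theorem pderiv_comm (i j : Fin 3) (F : MvPolynomial (Fin 3) k) :
    pderiv i (pderiv j F) = pderiv j (pderiv i F) := by
  induction F using MvPolynomial.induction_on with
  | C a => simp
  | add p q hp hq => simp only [map_add, hp, hq]
  | mul_X p l hp =>
    simp only [Derivation.leibniz, map_add, hp, pderiv_X, Pi.single_apply, smul_eq_mul]
    split_ifs <;> simp <;> ring

/-- The constant matrix of second partial derivatives of a quadratic form. -/
noncomputable def quadricMatrix (q : MvPolynomial (Fin 3) k) : Matrix (Fin 3) (Fin 3) k :=
  Matrix.of fun i j => coeff 0 (pderiv i (pderiv j q))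

theorem quadricMatrix_isSymm (q : MvPolynomial (Fin 3) k) : (quadricMatrix q).IsSymm := by
  ext i j
  simp only [quadricMatrix, Matrix.transpose_apply, Matrix.of_apply, pderiv_comm i j]

theorem hessMatrix_isSymm (q : MvPolynomial (Fin 3) k) (x : Fin 3 → k) :
    (hessMatrix q x).IsSymm := by
  ext i j
  simp only [hessMatrix, Matrix.transpose_apply, Matrix.of_apply, pderiv_comm i j]

/-- `quadricMatrix` as a linear map. -/
noncomputable def quadricMatrixₗ (k : Type*) [Field k] :
    MvPolynomial (Fin 3) k →ₗ[k] Matrix (Fin 3) (Fin 3) k where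
  toFun := quadricMatrix
  map_add' p q := by ext i j; simp [quadricMatrix]
  map_smul' c p := by ext i j; simp [quadricMatrix, Derivation.map_smul]

theorem eval_linear_form {L : MvPolynomial (Fin 3) k} (h : L.IsHomogeneous 1) (x : Fin 3 → k) :
    eval x L = ∑ l, x l * coeff 0 (pderiv l L) := by
  have := congrArg (eval x) h.sum_X_mul_pderiv
  rw [one_smul] at this
  rw [← this, map_sum]
  refine Finset.sum_congr rfl fun l _ => ?_
  have h0 := isHomogeneous_zero_eq_C (h.pderiv (i := l))
  rw [map_mul, eval_X]
  conv_lhs => rw [h0, eval_C]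

theorem eval_pderiv_quadric {q : MvPolynomial (Fin 3) k} (h : q.IsHomogeneous 2) (x : Fin 3 → k)
    (j : Fin 3) : eval x (pderiv j q) = (quadricMatrix q *ᵥ x) j := by
  have h1 : (pderiv j q).IsHomogeneous 1 := h.pderiv
  rw [eval_linear_form h1, Matrix.mulVec, dotProduct]
  refine Finset.sum_congr rfl fun l _ => ?_
  rw [quadricMatrix, Matrix.of_apply, pderiv_comm, mul_comm]

theorem two_mul_eval_quadric {q : MvPolynomial (Fin 3) k} (h : q.IsHomogeneous 2)
    (x : Fin 3 → k) : 2 * eval x q = x ⬝ᵥ quadricMatrix q *ᵥ x := by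
  have := congrArg (eval x) h.sum_X_mul_pderiv
  simp only [map_sum, map_mul, eval_X, eval_pderiv_quadric h, nsmul_eq_mul, Nat.cast_ofNat,
    map_ofNat] at this
  exact this.symm

theorem quadric_eq_of_quadricMatrix_eq [CharZero k] {q r : MvPolynomial (Fin 3) k}
    (hq : q.IsHomogeneous 2) (hr : r.IsHomogeneous 2) (h : quadricMatrix q = quadricMatrix r) :
    q = r := by
  refine MvPolynomial.funext fun v => ?_
  have h1 := two_mul_eval_quadric hq v
  rw [h, ← two_mul_eval_quadric hr v] at h1
  exact mul_left_cancel₀ two_ne_zero h1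

theorem Conjugate_iff {q : MvPolynomial (Fin 3) k} (h : q.IsHomogeneous 2) (x y : Plane k) :
    Conjugate q x y ↔ y.rep ⬝ᵥ quadricMatrix q *ᵥ x.rep = 0 := by
  simp only [Conjugate, eval_pderiv_quadric h, dotProduct]

/-- The derivative of `F` in the direction `u`. -/
noncomputable def polar (F : MvPolynomial (Fin 3) k) :
    (Fin 3 → k) →ₗ[k] MvPolynomial (Fin 3) k :=
  Fintype.linearCombination k fun j => pderiv j F

theorem polar_apply (F : MvPolynomial (Fin 3) k) (u : Fin 3 → k) :
    polar F u = ∑ j, u j • pderiv j F := rfl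

theorem range_polar (F : MvPolynomial (Fin 3) k) : (polar F).range = jacobianNet F :=
  Fintype.range_linearCombination k _

theorem isHomogeneous_polar {F : MvPolynomial (Fin 3) k} (h : F.IsHomogeneous 3) (u : Fin 3 → k) :
    (polar F u).IsHomogeneous 2 :=
  IsHomogeneous.sum _ _ _ fun _ _ => (homogeneousSubmodule (Fin 3) k 2).smul_mem _ h.pderiv

theorem jacobianNet_le {F : MvPolynomial (Fin 3) k} (h : F.IsHomogeneous 3) :
    jacobianNet F ≤ homogeneousSubmodule (Fin 3) k 2 := by
  rw [← range_polar]
  rintro _ ⟨u, rfl⟩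
  exact isHomogeneous_polar h u

theorem quadricMatrix_polar {F : MvPolynomial (Fin 3) k} (h : F.IsHomogeneous 3)
    (u : Fin 3 → k) : quadricMatrix (polar F u) = hessMatrix F u := by
  ext i j
  have h1 : (pderiv i (pderiv j F)).IsHomogeneous 1 := (h.pderiv).pderiv
  rw [hessMatrix, Matrix.of_apply, eval_linear_form h1, quadricMatrix, Matrix.of_apply, polar_apply]
  simp only [map_sum, Derivation.map_smul, coeff_sum, coeff_smul, smul_eq_mul]
  refine Finset.sum_congr rfl fun l _ => ?_
  rw [pderiv_comm j l, pderiv_comm i l]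

theorem hessMatrix_eq_sum {F : MvPolynomial (Fin 3) k} (h : F.IsHomogeneous 3) (x : Fin 3 → k)
    (i j : Fin 3) :
    hessMatrix F x i j = ∑ l, x l * coeff 0 (pderiv i (pderiv j (pderiv l F))) := by
  have h1 : (pderiv i (pderiv j F)).IsHomogeneous 1 := (h.pderiv).pderiv
  rw [hessMatrix, Matrix.of_apply, eval_linear_form h1]
  refine Finset.sum_congr rfl fun l _ => ?_
  rw [pderiv_comm l i, pderiv_comm l j]

theorem hessMatrix_mulVec_comm {F : MvPolynomial (Fin 3) k} (h : F.IsHomogeneous 3)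
    (x y : Fin 3 → k) : hessMatrix F x *ᵥ y = hessMatrix F y *ᵥ x := by
  ext i
  simp only [Matrix.mulVec, dotProduct, hessMatrix_eq_sum h, Finset.sum_mul]
  rw [Finset.sum_comm]
  refine Finset.sum_congr rfl fun l _ => Finset.sum_congr rfl fun m _ => ?_
  rw [pderiv_comm l m]
  ring

/-- `hessMatrix F` as a linear map, for a cubic form `F`. -/
theorem hessMatrix_add {F : MvPolynomial (Fin 3) k} (h : F.IsHomogeneous 3) (x y : Fin 3 → k) :
    hessMatrix F (x + y) = hessMatrix F x + hessMatrix F y := by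
  ext i j
  simp only [Matrix.add_apply, hessMatrix_eq_sum h, Pi.add_apply, add_mul, Finset.sum_add_distrib]

theorem hessMatrix_smul {F : MvPolynomial (Fin 3) k} (h : F.IsHomogeneous 3) (t : k)
    (x : Fin 3 → k) : hessMatrix F (t • x) = t • hessMatrix F x := by
  ext i j
  simp only [Matrix.smul_apply, hessMatrix_eq_sum h, Pi.smul_apply, smul_eq_mul, mul_assoc,
    Finset.mul_sum]

theorem two_mul_eval_pderiv {F : MvPolynomial (Fin 3) k} (h : F.IsHomogeneous 3) (x : Fin 3 → k)
    (j : Fin 3) : 2 * eval x (pderiv j F) = (hessMatrix F x *ᵥ x) j := by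
  have h1 : (pderiv j F).IsHomogeneous 2 := h.pderiv
  have := congrArg (eval x) h1.sum_X_mul_pderiv
  simp only [map_sum, map_mul, eval_X, nsmul_eq_mul, Nat.cast_ofNat, map_ofNat] at this
  rw [← this, Matrix.mulVec, dotProduct]
  refine Finset.sum_congr rfl fun l _ => ?_
  rw [hessMatrix, Matrix.of_apply, pderiv_comm, mul_comm]

theorem three_mul_eval_cubic {F : MvPolynomial (Fin 3) k} (h : F.IsHomogeneous 3)
    (x : Fin 3 → k) : 3 * eval x F = ∑ j, x j * eval x (pderiv j F) := by
  have := congrArg (eval x) h.sum_X_mul_pderiv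
  simp only [map_sum, map_mul, eval_X, nsmul_eq_mul, Nat.cast_ofNat, map_ofNat] at this
  exact this.symm

theorem cubic_eq_zero [CharZero k] {F : MvPolynomial (Fin 3) k} (h : F.IsHomogeneous 3)
    (h0 : ∀ u, polar F u = 0) : F = 0 := by
  refine MvPolynomial.funext fun v => ?_
  have h1 : ∀ j, pderiv j F = 0 := fun j => by
    have := h0 (Pi.single j 1)
    simpa [polar_apply, Pi.single_apply] using this
  have h3 := three_mul_eval_cubic h v
  simp only [h1, map_zero, mul_zero, Finset.sum_const_zero] at h3
  simpa using h3

theorem isHomogeneous_hessian [Infinite k] {F : MvPolynomial (Fin 3) k} (h : F.IsHomogeneous 3) :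
    (hessian F).IsHomogeneous 3 :=
  isHomogeneous_of_eval fun t v => by
    rw [eval_hessian, eval_hessian, hessMatrix_smul h, Matrix.det_smul, Fintype.card_fin]

theorem mem_curvePoints_iff {F : MvPolynomial (Fin 3) k} (p : Plane k) :
    p ∈ curvePoints F ↔ eval p.rep F = 0 := Iff.rfl

theorem mk_mem_curvePoints {F : MvPolynomial (Fin 3) k} {d : ℕ} (h : F.IsHomogeneous d)
    (v : Fin 3 → k) (hv : v ≠ 0) :
    Projectivization.mk k v hv ∈ curvePoints F ↔ eval v F = 0 := by
  obtain ⟨a, ha⟩ := Projectivization.exists_smul_eq_mk_rep k v hv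
  rw [mem_curvePoints_iff, ← ha, Units.smul_def, isHomogeneous_eval_smul h]
  simp

end Calculus

section Vanishing

variable {k : Type*} [Field k]

theorem IsSmoothCubic.ne_zero {G : MvPolynomial (Fin 3) k} (h : IsSmoothCubic G) : G ≠ 0 := by
  rintro rfl
  obtain ⟨j, hj⟩ := h.2 1 one_ne_zero (map_zero _)
  simp at hj

theorem IsSmoothCubic.smul {G : MvPolynomial (Fin 3) k} (h : IsSmoothCubic G) {c : k}
    (hc : c ≠ 0) : IsSmoothCubic (c • G) := by
  refine ⟨(homogeneousSubmodule (Fin 3) k 3).smul_mem _ h.1, fun v hv hG => ?_⟩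
  rw [smul_eval] at hG
  obtain ⟨j, hj⟩ := h.2 v hv (by simpa [hc] using hG)
  exact ⟨j, by simpa [Derivation.map_smul, smul_eval, hc] using hj⟩

variable [IsAlgClosed k]

/-- The equation of a smooth plane cubic is prime. -/
theorem IsSmoothCubic.prime {G : MvPolynomial (Fin 3) k} (h : IsSmoothCubic G) : Prime G := by
  have : Infinite k := IsAlgClosed.instInfinite
  refine Irreducible.prime ⟨fun hu => ?_, fun A B hAB => ?_⟩
  · have := hu.map (eval (0 : Fin 3 → k))
    rw [eval_zero_of_isHomogeneous h.1 (by norm_num)] at this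
    exact not_isUnit_zero this
  · have h0 : A * B ≠ 0 := hAB ▸ h.ne_zero
    have key : ∀ {P : MvPolynomial (Fin 3) k}, P.IsHomogeneous 0 → P ≠ 0 → IsUnit P := by
      intro P hP hP0
      rw [isHomogeneous_zero_eq_C hP] at hP0 ⊢
      exact (isUnit_iff_ne_zero.mpr fun hc => hP0 (by rw [hc, C_0])).map C
    obtain ⟨a, b, ha, hb, hab⟩ := isHomogeneous_of_mul (hAB ▸ h.1) h0
    rcases Nat.eq_zero_or_pos a with rfl | ha'
    · exact Or.inl (key ha (left_ne_zero_of_mul h0))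
    rcases Nat.eq_zero_or_pos b with rfl | hb'
    · exact Or.inr (key hb (right_ne_zero_of_mul h0))
    obtain ⟨v, hv, hvA, hvB⟩ := exists_common_zero A B
      (eval_zero_of_isHomogeneous ha ha'.ne') (eval_zero_of_isHomogeneous hb hb'.ne')
    obtain ⟨j, hj⟩ := h.2 v hv (by rw [hAB, map_mul, hvA, zero_mul])
    exact absurd (by simp [hAB, Derivation.leibniz, hvA, hvB]) hj

theorem IsSmoothCubic.dvd_of_vanishing {G : MvPolynomial (Fin 3) k} (h : IsSmoothCubic G)
    {p : MvPolynomial (Fin 3) k} (hp : ∀ v, eval v G = 0 → eval v p = 0) : G ∣ p := by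
  rw [← Ideal.mem_span_singleton]
  have : (Ideal.span {G}).IsPrime := (Ideal.span_singleton_prime h.ne_zero).mpr h.prime
  rw [← IsPrime.vanishingIdeal_zeroLocus (K := k) (Ideal.span {G}), mem_vanishingIdeal_iff]
  intro v hv
  rw [zeroLocus_span] at hv
  simpa [aeval_eq_eval] using hp v (by simpa [aeval_eq_eval] using hv)

theorem IsSmoothCubic.vanishing_iff_dvd {G : MvPolynomial (Fin 3) k} (h : IsSmoothCubic G)
    {p : MvPolynomial (Fin 3) k} : (∀ v, eval v G = 0 → eval v p = 0) ↔ G ∣ p :=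
  ⟨h.dvd_of_vanishing, fun ⟨q, hq⟩ v hv => by rw [hq, map_mul, hv, zero_mul]⟩

/-- A cubic form which vanishes on a smooth cubic is a multiple of its equation. -/
theorem IsSmoothCubic.eq_smul_of_vanishing {G : MvPolynomial (Fin 3) k} (h : IsSmoothCubic G)
    {p : MvPolynomial (Fin 3) k} (hp : p.IsHomogeneous 3)
    (hv : ∀ v, v ≠ 0 → eval v G = 0 → eval v p = 0) : ∃ c : k, p = c • G := by
  have : Infinite k := IsAlgClosed.instInfinite
  obtain ⟨q, hq⟩ : G ∣ p := h.dvd_of_vanishing fun v hG => by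
    rcases eq_or_ne v 0 with rfl | hv0
    · exact eval_zero_of_isHomogeneous hp (by norm_num)
    · exact hv v hv0 hG
  by_cases h0 : p = 0
  · exact ⟨0, by rw [h0, zero_smul]⟩
  obtain ⟨a, b, ha, hb, hab⟩ := isHomogeneous_of_mul (hq ▸ hp) (hq ▸ h0)
  have := h.1.inj_right ha h.ne_zero
  obtain rfl : b = 0 := by omega
  refine ⟨coeff 0 q, ?_⟩
  rw [hq, smul_eq_C_mul, ← isHomogeneous_zero_eq_C hb, mul_comm]

end Vanishing

section LinearAlgebra

variable {k : Type*} [Field k]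

theorem adjugate_apply_mul_comm {Q : Matrix (Fin 3) (Fin 3) k} {w : Fin 3 → k} (hw : w ≠ 0)
    (h : Q *ᵥ w = 0) (i m j : Fin 3) :
    Q.adjugate i j * w m = Q.adjugate m j * w i := by
  have key : ∀ u : Fin 3 → k, u ⬝ᵥ w = 0 → (Q.updateRow j u).det = 0 := by
    intro u hu
    refine Matrix.exists_mulVec_eq_zero_iff.mp ⟨w, hw, ?_⟩
    ext l
    rcases eq_or_ne l j with rfl | hl
    · simpa [Matrix.mulVec] using hu
    · simpa [Matrix.mulVec, Matrix.updateRow_ne hl] using congrFun h l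
  have := key (w m • Pi.single i 1 + (-w i) • Pi.single m 1) (by simp; ring)
  rw [Matrix.det_updateRow_add, Matrix.det_updateRow_smul, Matrix.det_updateRow_smul,
    ← Matrix.adjugate_apply, ← Matrix.adjugate_apply] at this
  linear_combination this

/-- If `Q w = 0` with `w ≠ 0`, the columns of the adjugate of `Q` are multiples of `w`. -/
theorem exists_adjugate_eq {Q : Matrix (Fin 3) (Fin 3) k} {w : Fin 3 → k} (hw : w ≠ 0)
    (h : Q *ᵥ w = 0) : ∃ μ : Fin 3 → k, Q.adjugate = Matrix.vecMulVec w μ := by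
  obtain ⟨m, hm⟩ := Function.ne_iff.mp hw
  refine ⟨fun j => Q.adjugate m j / w m, ?_⟩
  ext i j
  have hm' : w m ≠ 0 := hm
  rw [Matrix.vecMulVec_apply]
  field_simp
  rw [adjugate_apply_mul_comm hw h i m j]
  ring

theorem exists_adjugate_eq_symm {Q : Matrix (Fin 3) (Fin 3) k} (hQ : Q.IsSymm) {w : Fin 3 → k}
    (hw : w ≠ 0) (h : Q *ᵥ w = 0) : ∃ c : k, Q.adjugate = c • Matrix.vecMulVec w w := by
  obtain ⟨μ, hμ⟩ := exists_adjugate_eq hw h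
  have hs : Q.adjugateᵀ = Q.adjugate := by rw [Matrix.adjugate_transpose, hQ]
  obtain ⟨m, hm⟩ := Function.ne_iff.mp hw
  have hm' : w m ≠ 0 := hm
  refine ⟨μ m / w m, ?_⟩
  have h1 : ∀ j, w j * μ m = w m * μ j := fun j => by
    have := congrFun (congrFun hs m) j
    rw [hμ] at this
    simpa [Matrix.vecMulVec_apply] using this
  rw [hμ]
  ext i j
  simp only [Matrix.vecMulVec_apply, Matrix.smul_apply, smul_eq_mul]
  field_simp
  linear_combination (-w i) * h1 j

theorem trace_adjugate_mul {Q R : Matrix (Fin 3) (Fin 3) k} {w : Fin 3 → k} {c : k}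
    (h : Q.adjugate = c • Matrix.vecMulVec w w) :
    (Q.adjugate * R).trace = c * (w ⬝ᵥ R *ᵥ w) := by
  rw [h, Matrix.smul_mul, Matrix.trace_smul, Matrix.trace_mul_comm, Matrix.mul_vecMulVec,
    Matrix.trace_vecMulVec, smul_eq_mul, dotProduct_comm]

/-- Two vectors killed by a matrix of rank at least two are proportional. -/
theorem exists_smul_eq_of_mulVec_eq_zero {Q : Matrix (Fin 3) (Fin 3) k} (hQ : Q.adjugate ≠ 0)
    {w y : Fin 3 → k} (hw : w ≠ 0) (hy : y ≠ 0) (h : Q *ᵥ w = 0) (h' : Q *ᵥ y = 0) :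
    ∃ c : k, c ≠ 0 ∧ y = c • w := by
  obtain ⟨μ, hμ⟩ := exists_adjugate_eq hw h
  obtain ⟨ν, hν⟩ := exists_adjugate_eq hy h'
  obtain ⟨m, hm⟩ := Function.ne_iff.mp hy
  have hm' : y m ≠ 0 := hm
  have hν0 : ν ≠ 0 := by
    rintro rfl
    exact hQ (by rw [hν, Matrix.vecMulVec_zero])
  obtain ⟨j, hj⟩ := Function.ne_iff.mp hν0
  have hj' : ν j ≠ 0 := hj
  have hij : ∀ i, y i = μ j / ν j * w i := fun i => by
    have := congrFun (congrFun (hν.symm.trans hμ) i) j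
    simp only [Matrix.vecMulVec_apply] at this
    field_simp
    linear_combination this
  refine ⟨μ j / ν j, fun h0 => hm' ?_, funext hij⟩
  rw [hij m, h0, zero_mul]

theorem Derivation.apply_det_fin_three {R : Type*} [CommRing R] [Algebra k R]
    (D : Derivation k R R) (M : Matrix (Fin 3) (Fin 3) R) :
    D M.det = (M.adjugate * M.map D).trace := by
  rw [Matrix.det_fin_three, Matrix.adjugate_fin_three, Matrix.trace_fin_three]
  simp only [Matrix.mul_apply, Fin.sum_univ_three, Matrix.map_apply, map_sub, map_add,
    Derivation.leibniz, smul_eq_mul, Matrix.of_apply, Matrix.cons_val_zero, Matrix.cons_val_one,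
    Matrix.cons_val]
  ring

end LinearAlgebra

section Discriminant

variable {k : Type*} [Field k]

/-- Every singular member `q` of `V` has rank two, and its singular point is not a base point. -/
def IsRegularNet (V : Submodule k (MvPolynomial (Fin 3) k)) : Prop :=
  ∀ q ∈ V, q ≠ 0 → ∀ w : Fin 3 → k, w ≠ 0 → quadricMatrix q *ᵥ w = 0 →
    (quadricMatrix q).adjugate ≠ 0 ∧ ∃ q' ∈ V, w ⬝ᵥ quadricMatrix q' *ᵥ w ≠ 0

theorem quadricMatrix_sum (v : Fin 3 → MvPolynomial (Fin 3) k) (a : Fin 3 → k) (i j : Fin 3) :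
    quadricMatrix (∑ l, a l • v l) i j = ∑ l, a l * quadricMatrix (v l) i j := by
  simp [quadricMatrix, map_sum, Derivation.map_smul, coeff_sum]

theorem eval_discriminant (v : Fin 3 → MvPolynomial (Fin 3) k) (a : Fin 3 → k) :
    eval a (discriminant v) = (quadricMatrix (∑ l, a l • v l)).det := by
  rw [discriminant, RingHom.map_det]
  congr 1
  ext i j
  rw [quadricMatrix_sum]
  simp [quadricMatrix, mul_comm]

theorem eval_pderiv_discriminant (v : Fin 3 → MvPolynomial (Fin 3) k) (a : Fin 3 → k)
    (m : Fin 3) : eval a (pderiv m (discriminant v)) =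
      ((quadricMatrix (∑ l, a l • v l)).adjugate * quadricMatrix (v m)).trace := by
  rw [discriminant, Derivation.apply_det_fin_three]
  have h1 : ∀ N : Matrix (Fin 3) (Fin 3) (MvPolynomial (Fin 3) k),
      eval a N.trace = (N.map (eval a)).trace := fun N => by simp [Matrix.trace]
  rw [h1, Matrix.map_mul]
  congr 2
  · have := RingHom.map_adjugate (eval a)
      (Matrix.of fun i j => ∑ l, C (coeff 0 (pderiv i (pderiv j (v l)))) * X l :
        Matrix (Fin 3) (Fin 3) (MvPolynomial (Fin 3) k))
    rw [RingHom.mapMatrix_apply] at this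
    rw [this]
    congr 1
    ext i j
    rw [quadricMatrix_sum]
    simp [quadricMatrix, mul_comm]
  · ext i j
    simp [quadricMatrix, map_sum, Derivation.leibniz, pderiv_X, Pi.single_apply]

theorem isRegularNet_of_discriminant {V : Submodule k (MvPolynomial (Fin 3) k)}
    (b : Module.Basis (Fin 3) k V)
    (h : IsSmoothCubic (discriminant fun l => (b l : MvPolynomial (Fin 3) k))) :
    IsRegularNet V := by
  intro q hq hq0 w hw hqw
  set a := b.equivFun ⟨q, hq⟩
  have hqa : ∑ l, a l • (b l : MvPolynomial (Fin 3) k) = q := by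
    have := congrArg (Submodule.subtype V) (b.sum_equivFun ⟨q, hq⟩)
    simpa only [map_sum, map_smul, Submodule.subtype_apply] using this
  have ha : a ≠ 0 := by
    intro ha
    apply hq0
    rw [← hqa, ha]
    simp
  have hdet : eval a (discriminant fun l => (b l : MvPolynomial (Fin 3) k)) = 0 := by
    rw [eval_discriminant, hqa]
    exact Matrix.exists_mulVec_eq_zero_iff.mp ⟨w, hw, hqw⟩
  obtain ⟨m, hm⟩ := h.2 a ha hdet
  rw [eval_pderiv_discriminant, hqa] at hm
  refine ⟨fun h0 => hm (by rw [h0, zero_mul, Matrix.trace_zero]), b m, (b m).2, fun h0 => hm ?_⟩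
  obtain ⟨c, hc⟩ := exists_adjugate_eq_symm (quadricMatrix_isSymm q) hw hqw
  rw [trace_adjugate_mul hc, h0, mul_zero]

theorem IsNetWithSmoothDiscriminant.isRegularNet {V : Submodule k (MvPolynomial (Fin 3) k)}
    (h : IsNetWithSmoothDiscriminant V) : IsRegularNet V := by
  obtain ⟨b, hb⟩ := h.2
  exact isRegularNet_of_discriminant b hb

theorem isSmoothCubic_discriminant_of_basis [Infinite k]
    {V : Submodule k (MvPolynomial (Fin 3) k)} (b b' : Module.Basis (Fin 3) k V)
    (h : IsSmoothCubic (discriminant fun l => (b l : MvPolynomial (Fin 3) k))) :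
    IsSmoothCubic (discriminant fun l => (b' l : MvPolynomial (Fin 3) k)) := by
  have : (discriminant fun l => (b' l : MvPolynomial (Fin 3) k)) =
      pullback (b'.equivFun.symm ≪≫ₗ b.equivFun)
        (discriminant fun l => (b l : MvPolynomial (Fin 3) k)) := by
    refine MvPolynomial.funext fun a => ?_
    rw [eval_pullback, eval_discriminant, eval_discriminant]
    congr 2
    have h1 := b.sum_equivFun (b'.equivFun.symm a)
    rw [Module.Basis.equivFun_symm_apply] at h1
    have := congrArg (Submodule.subtype V) h1
    simp only [map_sum, map_smul, Submodule.subtype_apply] at this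
    rw [← this]
    simp [Module.Basis.equivFun_symm_apply]
  rw [this]
  exact h.pullback _

theorem discriminant_pderiv [Infinite k] {F : MvPolynomial (Fin 3) k} (h : F.IsHomogeneous 3) :
    discriminant (fun j => pderiv j F) = hessian F :=
  MvPolynomial.funext fun a => by
    rw [eval_discriminant, eval_hessian, ← polar_apply, quadricMatrix_polar h]

/-- If the partial derivatives of a cubic form span a net with a smooth discriminant curve, then
the Hessian is smooth. -/
theorem isSmoothCubic_hessian [Infinite k] {F : MvPolynomial (Fin 3) k} (h : F.IsHomogeneous 3)
    (hV : IsNetWithSmoothDiscriminant (jacobianNet F)) : IsSmoothCubic (hessian F) := by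
  obtain ⟨⟨-, hr⟩, b, hb⟩ := hV
  have hli : LinearIndependent k fun j => pderiv j F :=
    linearIndependent_iff_card_eq_finrank_span.mpr (by rw [Fintype.card_fin]; exact hr.symm)
  have := isSmoothCubic_discriminant_of_basis b (Module.Basis.span hli) hb
  have e : (fun l => (Module.Basis.span hli l : MvPolynomial (Fin 3) k)) = fun j => pderiv j F :=
    _root_.funext fun l => congrArg Subtype.val (Module.Basis.span_apply hli l)
  rwa [← discriminant_pderiv h, ← e]

end Discriminant

section SmoothHessian

variable {k : Type*} [Field k]

theorem CommonConjugate_jacobianNet_iff {F : MvPolynomial (Fin 3) k} (hF : F.IsHomogeneous 3)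
    (x y : Plane k) :
    CommonConjugate (jacobianNet F) x y ↔ hessMatrix F x.rep *ᵥ y.rep = 0 := by
  have key : ∀ u : Fin 3 → k, Conjugate (polar F u) x y ↔ hessMatrix F x.rep *ᵥ y.rep ⬝ᵥ u = 0 := by
    intro u
    rw [Conjugate_iff (isHomogeneous_polar hF u), quadricMatrix_polar hF, hessMatrix_mulVec_comm hF,
      Matrix.dotProduct_mulVec, ← Matrix.mulVec_transpose, hessMatrix_isSymm]
  constructor
  · intro h
    refine dotProduct_eq_zero _ fun u => ?_
    exact (key u).mp (h _ (by rw [← range_polar]; exact ⟨u, rfl⟩))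
  · intro h q hq
    rw [← range_polar] at hq
    obtain ⟨u, rfl⟩ := hq
    rw [key, h, zero_dotProduct]

variable {F : MvPolynomial (Fin 3) k}

theorem pderiv_hessian_eq_trace [Infinite k] (hF : F.IsHomogeneous 3) (x : Fin 3 → k) (m : Fin 3) :
    eval x (pderiv m (hessian F)) =
      ((hessMatrix F x).adjugate * quadricMatrix (pderiv m F)).trace := by
  rw [← discriminant_pderiv hF, eval_pderiv_discriminant, ← polar_apply, quadricMatrix_polar hF]

theorem polar_ne_zero [Infinite k] (hF : F.IsHomogeneous 3) (hH : IsSmoothCubic (hessian F))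
    {u : Fin 3 → k} (hu : u ≠ 0) : polar F u ≠ 0 := by
  intro h
  have hA : hessMatrix F u = 0 := by
    rw [← quadricMatrix_polar hF, h]
    exact map_zero (quadricMatrixₗ k)
  obtain ⟨m, hm⟩ := hH.2 u hu (by rw [eval_hessian, hA, Matrix.det_zero])
  rw [pderiv_hessian_eq_trace hF, hA, Matrix.adjugate_zero, zero_mul, Matrix.trace_zero] at hm
  exact hm rfl

theorem polar_injective [Infinite k] (hF : F.IsHomogeneous 3) (hH : IsSmoothCubic (hessian F)) :
    Function.Injective (polar F) := by
  rw [injective_iff_map_eq_zero]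
  intro u hu
  by_contra h
  exact polar_ne_zero hF hH h hu

theorem isNetWithSmoothDiscriminant_jacobianNet [Infinite k] (hF : F.IsHomogeneous 3)
    (hH : IsSmoothCubic (hessian F)) : IsNetWithSmoothDiscriminant (jacobianNet F) := by
  have hli : LinearIndependent k fun j => pderiv j F := by
    rw [Fintype.linearIndependent_iff]
    intro g hg
    have : g = 0 := polar_injective hF hH (by rw [polar_apply, hg, map_zero])
    simp [this]
  refine ⟨⟨jacobianNet_le hF, by rw [jacobianNet, finrank_span_eq_card hli, Fintype.card_fin]⟩,
    Module.Basis.span hli, ?_⟩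
  have e : (fun l => (Module.Basis.span hli l : MvPolynomial (Fin 3) k)) = fun j => pderiv j F :=
    _root_.funext fun l => congrArg Subtype.val (Module.Basis.span_apply hli l)
  have h : IsSmoothCubic (discriminant fun l =>
      (Module.Basis.span hli l : MvPolynomial (Fin 3) k)) := by
    rw [e, discriminant_pderiv hF]
    exact hH
  exact h

theorem adjugate_hessMatrix_ne_zero [Infinite k] (hF : F.IsHomogeneous 3)
    (hH : IsSmoothCubic (hessian F)) {x : Fin 3 → k} (hx : x ≠ 0)
    (h : eval x (hessian F) = 0) : (hessMatrix F x).adjugate ≠ 0 := by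
  intro h0
  obtain ⟨m, hm⟩ := hH.2 x hx h
  rw [pderiv_hessian_eq_trace hF, h0, zero_mul, Matrix.trace_zero] at hm
  exact hm rfl

theorem eval_hessian_eq_zero_of_mulVec {x y : Fin 3 → k} (hy : y ≠ 0)
    (h : hessMatrix F x *ᵥ y = 0) : eval x (hessian F) = 0 := by
  rw [eval_hessian]
  exact Matrix.exists_mulVec_eq_zero_iff.mp ⟨y, hy, h⟩

theorem hessMatrix_mulVec_self_ne_zero [CharZero k] (hF : F.IsHomogeneous 3)
    (hH : IsSmoothCubic (hessian F)) {x : Fin 3 → k} (hx : x ≠ 0) : hessMatrix F x *ᵥ x ≠ 0 := by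
  intro h
  have hn := (isNetWithSmoothDiscriminant_jacobianNet hF hH).isRegularNet
  obtain ⟨-, q, hq, hq'⟩ := hn (polar F x) (by rw [← range_polar]; exact ⟨x, rfl⟩)
    (polar_ne_zero hF hH hx) x hx (by rw [quadricMatrix_polar hF, h])
  rw [← range_polar] at hq
  obtain ⟨u, rfl⟩ := hq
  apply hq'
  rw [quadricMatrix_polar hF, hessMatrix_mulVec_comm hF,
      Matrix.dotProduct_mulVec, ← Matrix.mulVec_transpose, hessMatrix_isSymm, h, zero_dotProduct]

theorem exists_commonConjugate_iff (hF : F.IsHomogeneous 3) (x : Plane k) :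
    (∃ y, CommonConjugate (jacobianNet F) x y) ↔ x ∈ curvePoints (hessian F) := by
  rw [mem_curvePoints_iff]
  constructor
  · rintro ⟨y, hy⟩
    exact eval_hessian_eq_zero_of_mulVec y.rep_nonzero
      ((CommonConjugate_jacobianNet_iff hF x y).mp hy)
  · intro h
    rw [eval_hessian] at h
    obtain ⟨y, hy, hxy⟩ := Matrix.exists_mulVec_eq_zero_iff.mpr h
    refine ⟨Projectivization.mk k y hy, ?_⟩
    rw [CommonConjugate_jacobianNet_iff hF]
    obtain ⟨a, ha⟩ := Projectivization.exists_smul_eq_mk_rep k y hy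
    rw [← ha, Units.smul_def, Matrix.mulVec_smul, hxy, smul_zero]

theorem CommonConjugate.symm_jacobianNet (hF : F.IsHomogeneous 3) {x y : Plane k}
    (h : CommonConjugate (jacobianNet F) x y) : CommonConjugate (jacobianNet F) y x := by
  rw [CommonConjugate_jacobianNet_iff hF] at h ⊢
  rw [hessMatrix_mulVec_comm hF, h]

theorem CommonConjugate.unique [Infinite k] (hF : F.IsHomogeneous 3)
    (hH : IsSmoothCubic (hessian F)) {x y y' : Plane k}
    (h : CommonConjugate (jacobianNet F) x y) (h' : CommonConjugate (jacobianNet F) x y') :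
    y' = y := by
  rw [CommonConjugate_jacobianNet_iff hF] at h h'
  have h0 := adjugate_hessMatrix_ne_zero hF hH x.rep_nonzero
    (eval_hessian_eq_zero_of_mulVec y.rep_nonzero h)
  obtain ⟨c, hc, hyc⟩ := exists_smul_eq_of_mulVec_eq_zero h0 y.rep_nonzero y'.rep_nonzero h h'
  rw [← y.mk_rep, ← y'.mk_rep, Projectivization.mk_eq_mk_iff']
  exact ⟨c, hyc.symm⟩

theorem CommonConjugate.ne [CharZero k] (hF : F.IsHomogeneous 3)
    (hH : IsSmoothCubic (hessian F)) {x y : Plane k}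
    (h : CommonConjugate (jacobianNet F) x y) : y ≠ x := by
  rintro rfl
  rw [CommonConjugate_jacobianNet_iff hF] at h
  exact hessMatrix_mulVec_self_ne_zero hF hH y.rep_nonzero h

theorem CommonConjugate.mem_curvePoints (hF : F.IsHomogeneous 3) {x y : Plane k}
    (h : CommonConjugate (jacobianNet F) x y) : y ∈ curvePoints (hessian F) :=
  (exists_commonConjugate_iff hF y).mp ⟨x, h.symm_jacobianNet hF⟩

/-- The polynomial matrix of second partial derivatives. -/
noncomputable def hessPolyMatrix (F : MvPolynomial (Fin 3) k) :
    Matrix (Fin 3) (Fin 3) (MvPolynomial (Fin 3) k) :=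
  Matrix.of fun i j => pderiv i (pderiv j F)

theorem eval_adjugate_hessPolyMatrix (x : Fin 3 → k) (i j : Fin 3) :
    eval x ((hessPolyMatrix F).adjugate i j) = (hessMatrix F x).adjugate i j := by
  have := RingHom.map_adjugate (eval x) (hessPolyMatrix F)
  exact congrFun (congrFun this i) j

theorem isHomogeneous_adjugate_hessPolyMatrix [Infinite k] (hF : F.IsHomogeneous 3) (i j : Fin 3) :
    ((hessPolyMatrix F).adjugate i j).IsHomogeneous 2 :=
  isHomogeneous_of_eval fun t x => by
    rw [eval_adjugate_hessPolyMatrix, eval_adjugate_hessPolyMatrix, hessMatrix_smul hF,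
      Matrix.adjugate_smul, Fintype.card_fin]
    rfl

theorem hessMatrix_mulVec_adjugate (x : Fin 3 → k) (h : eval x (hessian F) = 0) (j : Fin 3) :
    hessMatrix F x *ᵥ (fun i => (hessMatrix F x).adjugate i j) = 0 := by
  have := Matrix.mul_adjugate (hessMatrix F x)
  rw [← eval_hessian, h, zero_smul] at this
  ext i
  exact congrFun (congrFun this i) j

/-- A map sending each point to its common conjugate is regular. -/
theorem isRegularMap_of_commonConjugate [Infinite k] (hF : F.IsHomogeneous 3)
    (hH : IsSmoothCubic (hessian F)) (i : curvePoints (hessian F) → curvePoints (hessian F))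
    (hi : ∀ x : curvePoints (hessian F), CommonConjugate (jacobianNet F) x (i x)) :
    IsRegularMap i := by
  intro x
  have h0 := adjugate_hessMatrix_ne_zero hF hH x.1.rep_nonzero x.2
  obtain ⟨j, hj⟩ : ∃ j, (fun i => (hessMatrix F x.1.rep).adjugate i j) ≠ 0 := by
    by_contra! hcon
    exact h0 (by ext i j; exact congrFun (hcon j) i)
  refine ⟨2, fun i => (hessPolyMatrix F).adjugate i j,
    fun i => isHomogeneous_adjugate_hessPolyMatrix hF i j, ?_, fun y hy => ?_⟩
  · simpa only [eval_adjugate_hessPolyMatrix] using hj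
  · refine CommonConjugate.unique hF hH (x := y.1) ?_ (hi y)
    rw [CommonConjugate_jacobianNet_iff hF]
    obtain ⟨a, ha⟩ := Projectivization.exists_smul_eq_mk_rep k _ hy
    rw [← ha, Units.smul_def, Matrix.mulVec_smul]
    simp only [eval_adjugate_hessPolyMatrix]
    rw [hessMatrix_mulVec_adjugate _ y.2, smul_zero]

/-- The involution of the Hessian curve sending each point to its common conjugate. -/
theorem exists_conjugateInvolution [CharZero k] (hF : F.IsHomogeneous 3)
    (hH : IsSmoothCubic (hessian F)) :
    ∃ i : curvePoints (hessian F) → curvePoints (hessian F),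
      (∀ x : curvePoints (hessian F), CommonConjugate (jacobianNet F) x (i x)) ∧
        IsFreeRegularInvolution i := by
  choose! f hf using fun x : curvePoints (hessian F) => (exists_commonConjugate_iff hF x.1).mpr x.2
  refine ⟨fun x => ⟨f x, (hf x).mem_curvePoints hF⟩, hf, ?_, fun x => ?_, fun x hx => ?_⟩
  · exact isRegularMap_of_commonConjugate hF hH _ hf
  · exact Subtype.ext (CommonConjugate.unique hF hH ((hf x).symm_jacobianNet hF) (hf ⟨f x, _⟩))
  · exact (hf x).ne hF hH (congrArg Subtype.val hx)

/-- The net of polars of `F` consists of all the conics for which the pairs of common conjugates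
are conjugate. -/
theorem conicsConjugate_eq_jacobianNet [CharZero k] [IsAlgClosed k] (hF : F.IsHomogeneous 3)
    (hH : IsSmoothCubic (hessian F)) (i : curvePoints (hessian F) → curvePoints (hessian F))
    (hi : ∀ x : curvePoints (hessian F), CommonConjugate (jacobianNet F) x (i x)) :
    conicsConjugate i = jacobianNet F := by
  refine le_antisymm ?_ fun q hq => ⟨jacobianNet_le hF hq, fun x => hi x q hq⟩
  rintro γ ⟨hγ, hγ'⟩
  set Q := quadricMatrix γ
  let p : Fin 3 → MvPolynomial (Fin 3) k := fun j =>
    ∑ l, (∑ m, X m * C (Q m l)) * (hessPolyMatrix F).adjugate l j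
  have hp_eval : ∀ j x, eval x (p j) = ((x ᵥ* Q) ᵥ* (hessMatrix F x).adjugate) j := by
    intro j x
    simp [p, Matrix.vecMul, dotProduct, eval_adjugate_hessPolyMatrix]
  have hp_hom : ∀ j, (p j).IsHomogeneous 3 := fun j => isHomogeneous_of_eval fun t x => by
    rw [hp_eval, hp_eval, hessMatrix_smul hF, Matrix.adjugate_smul, Fintype.card_fin,
      Matrix.smul_vecMul, Matrix.smul_vecMul, Matrix.vecMul_smul, Pi.smul_apply, Pi.smul_apply,
      smul_eq_mul, smul_eq_mul]
    ring
  have hp_zero : ∀ j x, x ≠ 0 → eval x (hessian F) = 0 → eval x (p j) = 0 := by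
    intro j v hv hx
    have hv' := (mk_mem_curvePoints hH.1 v hv).mpr hx
    set x : curvePoints (hessian F) := ⟨Projectivization.mk k v hv, hv'⟩
    have h1 := hγ' x
    rw [Conjugate_iff hγ, Matrix.dotProduct_mulVec] at h1
    have h2 := (CommonConjugate_jacobianNet_iff hF _ _).mp (hi x)
    obtain ⟨a, ha⟩ := Projectivization.exists_smul_eq_mk_rep k v hv
    have ha' : (a : k) • v = x.1.rep := ha
    have h3 : hessMatrix F v *ᵥ (i x).1.rep = 0 := by
      rw [← ha', hessMatrix_smul hF, Matrix.smul_mulVec] at h2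
      exact (smul_eq_zero.mp h2).resolve_left a.ne_zero
    obtain ⟨μ, hμ⟩ := exists_adjugate_eq (i x).1.rep_nonzero h3
    rw [hp_eval, hμ, Matrix.vecMul_vecMulVec, ← Matrix.dotProduct_mulVec]
    have h4 : v ⬝ᵥ Q *ᵥ (i x).1.rep = 0 := by
      rw [← ha', dotProduct_smul] at h1
      rw [Matrix.dotProduct_mulVec, ← Matrix.mulVec_transpose, quadricMatrix_isSymm γ,
        dotProduct_comm, Matrix.dotProduct_mulVec]
      exact (smul_eq_zero.mp h1).resolve_left a.ne_zero
    rw [h4, zero_smul]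
    rfl
  choose c hc using fun j => hH.eq_smul_of_vanishing (hp_hom j) (hp_zero j)
  have key : ∀ x, eval x (hessian F) • (x ᵥ* Q) = eval x (hessian F) • (c ᵥ* hessMatrix F x) := by
    intro x
    have h1 : (x ᵥ* Q) ᵥ* (hessMatrix F x).adjugate = eval x (hessian F) • c := by
      ext j
      rw [← hp_eval, hc j, smul_eval, Pi.smul_apply, smul_eq_mul, mul_comm]
    have h2 := congrArg (· ᵥ* hessMatrix F x) h1
    simpa only [Matrix.vecMul_vecMul, Matrix.mul_assoc, Matrix.adjugate_mul, Matrix.mul_smul,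
      Matrix.mul_one, ← eval_hessian, Matrix.vecMul_smul,
      Matrix.vecMul_one, Matrix.smul_vecMul] using h2
  have hQ : Q = hessMatrix F c := by
    have hpoly : ∀ j, (∑ m, X m * C ((Q - hessMatrix F c) m j) : MvPolynomial (Fin 3) k) = 0 := by
      intro j
      refine (mul_eq_zero.mp ?_).resolve_left hH.ne_zero
      refine MvPolynomial.funext fun x => ?_
      have h1 := congrFun (key x) j
      have h2 : c ᵥ* hessMatrix F x = x ᵥ* hessMatrix F c := by
        rw [← Matrix.mulVec_transpose, ← Matrix.mulVec_transpose, hessMatrix_isSymm,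
          hessMatrix_isSymm, hessMatrix_mulVec_comm hF]
      rw [h2] at h1
      simp only [Pi.smul_apply, smul_eq_mul, Matrix.vecMul, dotProduct] at h1
      simp only [map_mul, map_sum, eval_X, eval_C, Matrix.sub_apply, mul_sub,
        Finset.sum_sub_distrib, h1, sub_self, map_zero]
    ext m j
    have := congrArg (eval (Pi.single m 1)) (hpoly j)
    simpa [Pi.single_apply, sub_eq_zero] using this
  have : γ = polar F c := quadric_eq_of_quadricMatrix_eq hγ (isHomogeneous_polar hF c)
    (by rw [quadricMatrix_polar hF]; exact hQ)
  rw [this, ← range_polar]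
  exact ⟨c, rfl⟩

end SmoothHessian

section Polarity

variable {k : Type*} [Field k]

instance finite_homogeneousSubmodule (n : ℕ) :
    Module.Finite k (homogeneousSubmodule (Fin 3) k n) :=
  Module.Finite.iff_fg.mpr (homogeneousSubmodule_fg (Fin 3) k n)

theorem finrank_homogeneousSubmodule (n : ℕ) :
    Module.finrank k (homogeneousSubmodule (Fin 3) k n) = (n + 2).choose n := by
  have e := LinearEquiv.ofEq _ _ (homogeneousSubmodule_eq_finsupp_supported (Fin 3) k n) ≪≫ₗ
    AddMonoidAlgebra.supportedEquivFinsupp {d : Fin 3 →₀ ℕ | d.degree = n}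
  have hs : {d : Fin 3 →₀ ℕ | d.degree = n} = ↑(Finset.finsuppAntidiag (Finset.univ : Finset (Fin 3)) n) := by
    ext d
    simp [Finset.mem_finsuppAntidiag, Finsupp.degree_eq_sum]
  have hf : Finite {d : Fin 3 →₀ ℕ | d.degree = n} := by
    rw [hs]; infer_instance
  have : Fintype {d : Fin 3 →₀ ℕ | d.degree = n} := Fintype.ofFinite _
  rw [e.finrank_eq, Module.finrank_finsupp_self, ← Nat.card_eq_fintype_card, Nat.card_coe_set_eq,
    hs, Set.ncard_coe_finset, Finset.card_finsuppAntidiag_nat_eq_choose, Finset.card_univ,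
    Fintype.card_fin]
  congr 1
  omega

/-- A net of conics contains all the polars of some nonzero cubic form. -/
theorem exists_cubic_jacobianNet_le {V : Submodule k (MvPolynomial (Fin 3) k)} (hV : IsNet V) :
    ∃ F : MvPolynomial (Fin 3) k, F ≠ 0 ∧ F.IsHomogeneous 3 ∧ jacobianNet F ≤ V := by
  let V' : Submodule k (homogeneousSubmodule (Fin 3) k 2) := V.comap (homogeneousSubmodule (Fin 3) k 2).subtype
  have hV' : Module.finrank k V' = 3 := by
    exact (Submodule.comapSubtypeEquivOfLe hV.1).finrank_eq.trans hV.2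
  have hq : Module.finrank k (homogeneousSubmodule (Fin 3) k 2 ⧸ V') = 3 := by
    have h1 := V'.finrank_quotient_add_finrank
    rw [hV', finrank_homogeneousSubmodule] at h1
    have : Nat.choose (2 + 2) 2 = 6 := by decide
    omega
  let D : Fin 3 → homogeneousSubmodule (Fin 3) k 3 →ₗ[k] homogeneousSubmodule (Fin 3) k 2 := fun j =>
    (((pderiv j : Derivation k (MvPolynomial (Fin 3) k) (MvPolynomial (Fin 3) k)) :
      MvPolynomial (Fin 3) k →ₗ[k] MvPolynomial (Fin 3) k) ∘ₗ (homogeneousSubmodule (Fin 3) k 3).subtype).codRestrict (homogeneousSubmodule (Fin 3) k 2)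
      fun F => IsHomogeneous.pderiv F.2
  let Φ : homogeneousSubmodule (Fin 3) k 3 →ₗ[k] (Fin 3 → homogeneousSubmodule (Fin 3) k 2 ⧸ V') := LinearMap.pi fun j => V'.mkQ ∘ₗ D j
  have hlt : Module.finrank k (Fin 3 → homogeneousSubmodule (Fin 3) k 2 ⧸ V') < Module.finrank k (homogeneousSubmodule (Fin 3) k 3) := by
    have : Module.Free k (homogeneousSubmodule (Fin 3) k 2 ⧸ V') := Module.Free.of_divisionRing k _
    rw [Module.finrank_pi_fintype, finrank_homogeneousSubmodule]
    simp only [hq, Finset.sum_const, Finset.card_univ, Fintype.card_fin]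
    decide
  obtain ⟨F, hF, hF0⟩ := (Submodule.ne_bot_iff _).mp (LinearMap.ker_ne_bot_of_finrank_lt hlt (f := Φ))
  refine ⟨F, fun h => hF0 (Subtype.ext h), F.2, ?_⟩
  rw [jacobianNet, Submodule.span_le]
  rintro _ ⟨j, rfl⟩
  have h1 := congrFun (LinearMap.mem_ker.mp hF) j
  have h2 : D j F ∈ V' := by
    rw [← Submodule.Quotient.mk_eq_zero]
    exact h1
  exact h2

theorem adjugate_add_smul_apply_self (M N : Matrix (Fin 3) (Fin 3) k) (m : Fin 3) :
    ∃ b : k, ∀ s : k, (M + s • N).adjugate m m =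
      N.adjugate m m * s ^ 2 + b * s + M.adjugate m m := by
  refine ⟨(M + N).adjugate m m - M.adjugate m m - N.adjugate m m, fun s => ?_⟩
  fin_cases m <;> simp [Matrix.adjugate_fin_three] <;> ring

theorem exists_quadratic_root [IsAlgClosed k] {a : k} (ha : a ≠ 0) (b c : k) :
    ∃ s : k, a * s ^ 2 + b * s + c = 0 := by
  obtain ⟨s, hs⟩ := IsAlgClosed.exists_root
    (Polynomial.C a * Polynomial.X ^ 2 + Polynomial.C b * Polynomial.X + Polynomial.C c)
    (by rw [Polynomial.degree_quadratic ha]; decide)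
  exact ⟨s, by simpa using hs⟩

/-- No nonzero cubic cone has all its polars in a regular net. -/
theorem cubic_eq_zero_of_isRegularNet [IsAlgClosed k] [CharZero k]
    {V : Submodule k (MvPolynomial (Fin 3) k)} (hV : IsRegularNet V)
    {F : MvPolynomial (Fin 3) k} (hF : F.IsHomogeneous 3) (hFV : jacobianNet F ≤ V)
    {w : Fin 3 → k} (hw : w ≠ 0) (h : polar F w = 0) : F = 0 := by
  by_contra hF0
  have hpV : ∀ u, polar F u ∈ V := fun u => hFV (by rw [← range_polar]; exact ⟨u, rfl⟩)
  have hA : ∀ {w}, polar F w = 0 → hessMatrix F w = 0 := fun {w} h => by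
    rw [← quadricMatrix_polar hF, h]
    exact map_zero (quadricMatrixₗ k)
  have hker : ∀ {w}, polar F w = 0 → ∀ u, hessMatrix F u *ᵥ w = 0 := fun {w} h u => by
    rw [hessMatrix_mulVec_comm hF, hA h, Matrix.zero_mulVec]
  have hadj : ∀ u, polar F u ≠ 0 → (hessMatrix F u).adjugate ≠ 0 := fun u hu => by
    have := (hV _ (hpV u) hu w hw (by rw [quadricMatrix_polar hF, hker h])).1
    rwa [quadricMatrix_polar hF] at this
  obtain ⟨u₁, hu₁⟩ : ∃ u, polar F u ≠ 0 := by
    by_contra! hcon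
    exact hF0 (cubic_eq_zero hF hcon)
  have hspan : ∀ u, polar F u = 0 → ∃ c : k, u = c • w := by
    intro u hu
    rcases eq_or_ne u 0 with rfl | hu0
    · exact ⟨0, by rw [zero_smul]⟩
    obtain ⟨c, -, hc⟩ := exists_smul_eq_of_mulVec_eq_zero (hadj u₁ hu₁) hw hu0 (hker h u₁)
      (hker hu u₁)
    exact ⟨c, hc⟩
  obtain ⟨u₂, hu₂⟩ : ∃ u, u ∉ Submodule.span k {w, u₁} := by
    by_contra! hcon
    have h1 : Submodule.span k {w, u₁} = ⊤ := (Submodule.eq_top_iff').mpr hcon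
    have h2 : Module.finrank k (Submodule.span k ({w, u₁} : Set (Fin 3 → k))) ≤ 2 := by
      classical
      have := finrank_span_finset_le_card (R := k) ({w, u₁} : Finset (Fin 3 → k))
      rw [Finset.coe_pair] at this
      exact this.trans Finset.card_le_two
    rw [h1, finrank_top, Module.finrank_fin_fun] at h2
    omega
  obtain ⟨m, hm⟩ := Function.ne_iff.mp hw
  have hm' : w m ≠ 0 := hm
  have hmm : ∀ u, polar F u ≠ 0 → (hessMatrix F u).adjugate m m ≠ 0 := by
    intro u hu h0
    obtain ⟨c, hc⟩ := exists_adjugate_eq_symm (hessMatrix_isSymm F u) hw (hker h u)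
    rw [hc, Matrix.smul_apply, Matrix.vecMulVec_apply, smul_eq_mul] at h0
    have : c = 0 := by simpa [hm'] using h0
    exact hadj u hu (by rw [hc, this, zero_smul])
  obtain ⟨b, hb⟩ := adjugate_add_smul_apply_self (hessMatrix F u₂) (hessMatrix F u₁) m
  obtain ⟨s, hs⟩ := exists_quadratic_root (hmm u₁ hu₁) b ((hessMatrix F u₂).adjugate m m)
  refine hmm (u₂ + s • u₁) (fun h0 => ?_) ?_
  · obtain ⟨c, hc⟩ := hspan _ h0
    apply hu₂
    rw [Submodule.mem_span_pair]
    exact ⟨c, -s, by rw [← hc]; module⟩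
  · rw [hessMatrix_add hF, hessMatrix_smul hF, hb, hs]

theorem eq_smul_of_jacobianNet_eq [IsAlgClosed k] [CharZero k]
    {V : Submodule k (MvPolynomial (Fin 3) k)} (hV : IsRegularNet V)
    {F F' : MvPolynomial (Fin 3) k} (hF : F.IsHomogeneous 3) (hF' : F'.IsHomogeneous 3)
    (hFV : jacobianNet F = V) (hFV' : jacobianNet F' = V) (h0 : F ≠ 0) (h0' : F' ≠ 0) :
    ∃ c : k, c ≠ 0 ∧ F' = c • F := by
  have hinj : Function.Injective (polar F) := by
    rw [injective_iff_map_eq_zero]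
    intro u hu
    by_contra h
    exact h0 (cubic_eq_zero_of_isRegularNet hV hF hFV.le h hu)
  let e := LinearEquiv.ofInjective (polar F) hinj
  let M : (Fin 3 → k) →ₗ[k] (Fin 3 → k) := e.symm.toLinearMap ∘ₗ
    (polar F').codRestrict (polar F).range fun u => by
      rw [range_polar, hFV, ← hFV', ← range_polar]
      exact ⟨u, rfl⟩
  have hM : ∀ u, polar F (M u) = polar F' u := fun u => by
    have := e.apply_symm_apply (⟨polar F' u, by
      rw [range_polar, hFV, ← hFV', ← range_polar]
      exact ⟨u, rfl⟩⟩ : (polar F).range)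
    exact congrArg Subtype.val this
  obtain ⟨c, hc⟩ := Module.End.exists_eigenvalue M
  obtain ⟨w, hw⟩ := hc.exists_hasEigenvector
  have hpol : ∀ u, polar (F' - c • F) u = polar F' u - c • polar F u := fun u => by
    simp only [polar_apply, map_sub, Derivation.map_smul, smul_sub, Finset.sum_sub_distrib,
      Finset.smul_sum, smul_comm c]
  have h1 : F' - c • F = 0 := by
    refine cubic_eq_zero_of_isRegularNet hV
      (hF'.sub ((homogeneousSubmodule (Fin 3) k 3).smul_mem _ hF)) ?_ hw.2 ?_
    · rw [← range_polar]
      rintro _ ⟨u, rfl⟩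
      rw [hpol]
      refine V.sub_mem ?_ (V.smul_mem _ ?_)
      · rw [← hFV', ← range_polar]; exact ⟨u, rfl⟩
      · rw [← hFV, ← range_polar]; exact ⟨u, rfl⟩
    · rw [hpol, ← hM, Module.End.mem_eigenspace_iff.mp hw.1, map_smul, sub_self]
  have h2 := sub_eq_zero.mp h1
  refine ⟨c, fun hc0 => h0' (by rw [h2, hc0, zero_smul]), h2⟩

theorem ne_zero_of_jacobianNet_eq {V : Submodule k (MvPolynomial (Fin 3) k)} (hV : IsNet V)
    {F : MvPolynomial (Fin 3) k} (hFV : jacobianNet F = V) : F ≠ 0 := by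
  rintro rfl
  have : V = ⊥ := by
    rw [← hFV, jacobianNet]
    simp
  have h := hV.2
  rw [this, finrank_bot] at h
  exact absurd h (by decide)

/-- A net with smooth discriminant is the net of polars of a smooth cubic, unique up to a
scalar. -/
theorem exists_unique_cubic [IsAlgClosed k] [CharZero k]
    {V : Submodule k (MvPolynomial (Fin 3) k)} (hV : IsNetWithSmoothDiscriminant V) :
    ∃ F : MvPolynomial (Fin 3) k, IsSmoothCubic F ∧ jacobianNet F = V ∧
      ∀ F' : MvPolynomial (Fin 3) k, F'.IsHomogeneous 3 → jacobianNet F' = V →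
        ∃ c : k, c ≠ 0 ∧ F' = c • F := by
  obtain ⟨F, hF0, hF, hFV⟩ := exists_cubic_jacobianNet_le hV.1
  have hinj : Function.Injective (polar F) := by
    rw [injective_iff_map_eq_zero]
    intro u hu
    by_contra h
    exact hF0 (cubic_eq_zero_of_isRegularNet hV.isRegularNet hF hFV h hu)
  have hJ : jacobianNet F = V := by
    have : Module.Finite k V := Module.finite_of_finrank_pos (by rw [hV.1.2]; decide)
    refine Submodule.eq_of_le_of_finrank_eq hFV ?_
    rw [← range_polar, LinearMap.finrank_range_of_inj hinj, Module.finrank_fin_fun, hV.1.2]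
  refine ⟨F, ⟨hF, fun v hv _ => ?_⟩, hJ, fun F' hF' hJ' =>
    eq_smul_of_jacobianNet_eq hV.isRegularNet hF hF' hJ hJ' hF0
      (ne_zero_of_jacobianNet_eq hV.1 hJ')⟩
  have hH : IsSmoothCubic (hessian F) := isSmoothCubic_hessian hF (hJ ▸ hV)
  by_contra! hcon
  refine hessMatrix_mulVec_self_ne_zero hF hH hv ?_
  ext j
  rw [← two_mul_eval_pderiv hF, hcon j, mul_zero]
  rfl

end Polarity

section RegularMaps

variable {k : Type*} [Field k]

theorem mk_eq_mk_of_smul {u v : Fin 3 → k} {c : k} (h : u = c • v) (hu : u ≠ 0) (hv : v ≠ 0) :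
    Projectivization.mk k u hu = Projectivization.mk k v hv :=
  (Projectivization.mk_eq_mk_iff' k u v hu hv).mpr ⟨c, h.symm⟩

theorem exists_rep_eq_smul {P : Plane k} {u : Fin 3 → k} (hu : u ≠ 0)
    (h : P = Projectivization.mk k u hu) : ∃ c : k, c ≠ 0 ∧ P.rep = c • u := by
  obtain ⟨a, ha⟩ := Projectivization.exists_smul_eq_mk_rep k u hu
  exact ⟨a, a.ne_zero, by rw [h, ← ha, Units.smul_def]⟩

theorem exists_scaling {Φ : (Fin 3 → k) → Fin 3 → k} {e : ℕ}
    (hΦ : ∀ (t : k) v, Φ (t • v) = t ^ e • Φ v) {P : Plane k} {u : Fin 3 → k}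
    (hu : ∀ h : u ≠ 0, P = Projectivization.mk k u h) (hne : Φ u ≠ 0) :
    ∃ c : k, c ≠ 0 ∧ Φ P.rep = c • Φ u := by
  rcases eq_or_ne u 0 with rfl | h
  · have h1 := hΦ 0 P.rep
    rw [zero_smul] at h1
    rcases eq_or_ne e 0 with rfl | he
    · exact ⟨1, one_ne_zero, by rw [h1, pow_zero, one_smul, one_smul]⟩
    · rw [h1, zero_pow he, zero_smul] at hne
      exact absurd rfl hne
  · obtain ⟨c, hc, hP⟩ := exists_rep_eq_smul h (hu h)
    exact ⟨c ^ e, pow_ne_zero _ hc, by rw [hP, hΦ]⟩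

/-- Regularity at `x` of a map to a plane curve from a set `X` with (multi)homogeneous coordinates
`c`, homogeneous for the weights `w`. -/
def RegularAlong {X ι σ : Type*} {T : Set (Plane k)} (c : X → σ → k) (w : ι → σ → ℕ)
    (f : X → T) (x : X) : Prop :=
  ∃ (d : ι → ℕ) (g : Fin 3 → MvPolynomial σ k),
    (∀ j i, IsWeightedHomogeneous (w i) (g j) (d i)) ∧
    (fun j => eval (c x) (g j)) ≠ 0 ∧
    ∀ (y : X) (hy : (fun j => eval (c y) (g j)) ≠ 0),
      (f y : Plane k) = Projectivization.mk k _ hy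

/-- Homogeneous coordinates of a point of a plane curve. -/
noncomputable def coord (S : Set (Plane k)) (x : S) : Fin 3 → k := x.1.rep

/-- Bihomogeneous coordinates of a point of a product of two plane curves. -/
noncomputable def coord₂ (S T : Set (Plane k)) (x : S × T) : Fin 3 ⊕ Fin 3 → k :=
  Sum.elim x.1.1.rep x.2.1.rep

/-- The weight of the homogeneous coordinates. -/
def weight₁ (_ : Unit) : Fin 3 → ℕ := 1

/-- The two weights of the bihomogeneous coordinates. -/
def weight₂ (b : Bool) : Fin 3 ⊕ Fin 3 → ℕ :=
  if b then Sum.elim (fun _ => 1) (fun _ => 0) else Sum.elim (fun _ => 0) (fun _ => 1)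

/-- Regularity at a point of a map between plane curves. -/
def RegularAt {S T : Set (Plane k)} (f : S → T) (x : S) : Prop :=
  RegularAlong (coord S) weight₁ f x

/-- Regularity at a point of a map from a product of plane curves to a plane curve. -/
def RegularAt₂ {S T U : Set (Plane k)} (f : S × T → U) (x : S × T) : Prop :=
  RegularAlong (coord₂ S T) weight₂ f x

theorem isRegularMap_iff {S T : Set (Plane k)} {f : S → T} :
    IsRegularMap f ↔ ∀ x, RegularAt f x := by
  refine forall_congr' fun x => ⟨?_, ?_⟩
  · rintro ⟨d, g, hg, h⟩
    exact ⟨fun _ => d, g, fun j _ => hg j, h⟩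
  · rintro ⟨d, g, hg, h⟩
    exact ⟨d (), g, fun j => hg j (), h⟩

theorem isRegularMap₂_iff {S T U : Set (Plane k)} {f : S → T → U} :
    IsRegularMap₂ f ↔ ∀ x, RegularAt₂ (fun p : S × T => f p.1 p.2) x := by
  rw [Prod.forall]
  refine forall_congr' fun x => forall_congr' fun y => ⟨?_, ?_⟩
  · rintro ⟨d, e, g, hg, h, h'⟩
    refine ⟨fun b => if b then d else e, g, fun j b => ?_, h, fun p hp => h' p.1 p.2 hp⟩
    cases b
    · exact (hg j).2
    · exact (hg j).1
  · rintro ⟨d, g, hg, h, h'⟩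
    exact ⟨d true, d false, g, fun j => ⟨hg j true, hg j false⟩, h, fun x y hxy => h' (x, y) hxy⟩

theorem eval_sumElim_smul {p : MvPolynomial (Fin 3 ⊕ Fin 3) k} {d : Bool → ℕ}
    (hp : ∀ b, IsWeightedHomogeneous (weight₂ b) p (d b)) (s t : k) (u v : Fin 3 → k) :
    eval (Sum.elim (s • u) (t • v)) p = s ^ d true * t ^ d false * eval (Sum.elim u v) p := by
  have h1 : Sum.elim (s • u) (t • v) =
      fun i => s ^ weight₂ true i * (fun i => t ^ weight₂ false i * Sum.elim u v i) i := by
    ext i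
    rcases i with i | i <;> simp [weight₂]
  rw [h1, eval_scaling_of_isWeightedHomogeneous (hp true),
    eval_scaling_of_isWeightedHomogeneous (hp false), mul_assoc]

variable {X ι σ : Type*} {c : X → σ → k} {w : ι → σ → ℕ} {S T U : Set (Plane k)}

theorem RegularAlong.comp [Infinite k] {h : S → T} {f : X → S} {x : X}
    (hf : RegularAlong c w f x) (hh : RegularAt h (f x)) : RegularAlong c w (h ∘ f) x := by
  obtain ⟨d, g, hg, hx, hfg⟩ := hf
  obtain ⟨e, q, hq, hx', hhq⟩ := hh
  have hev : ∀ v j, eval v (bind₁ g (q j)) = eval (fun l => eval v (g l)) (q j) := by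
    intro v j
    rw [MvPolynomial.eval, eval₂Hom_bind₁]
    rfl
  have hq' : ∀ j, (q j).IsHomogeneous (e ()) := fun j => hq j ()
  let Φ : (Fin 3 → k) → Fin 3 → k := fun v j => eval v (q j)
  have hΦ : ∀ (t : k) v, Φ (t • v) = t ^ e () • Φ v := fun t v => by
    ext j
    exact isHomogeneous_eval_smul (hq' j) t v
  have e1 : ∀ y, (fun j => eval (c y) (bind₁ g (q j))) = Φ fun l => eval (c y) (g l) :=
    fun y => _root_.funext fun j => hev _ j
  refine ⟨fun i => d i * e (), fun j => bind₁ g (q j), fun j i => ?_, ?_, fun y hy => ?_⟩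
  · refine isWeightedHomogeneous_of_eval fun t v => ?_
    rw [hev, hev]
    have : (fun l => eval (fun i' => t ^ w i i' * v i') (g l)) = t ^ d i • fun l => eval v (g l) := by
      ext l
      exact eval_scaling_of_isWeightedHomogeneous (hg l i) t v
    rw [this, isHomogeneous_eval_smul (hq' j), pow_mul]
  · rw [e1]
    obtain ⟨a, -, ha'⟩ := exists_rep_eq_smul hx (hfg x hx)
    intro h0
    apply hx'
    change Φ (f x).1.rep = 0
    rw [ha', hΦ, h0, smul_zero]
  · have hy' := hy
    rw [e1] at hy'
    obtain ⟨a, ha, ha'⟩ := exists_scaling hΦ (fun h => hfg y h) hy'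
    have h1 : Φ (f y).1.rep ≠ 0 := by rw [ha']; exact smul_ne_zero ha hy'
    rw [Function.comp_apply, hhq (f y) h1]
    refine mk_eq_mk_of_smul (c := a) ?_ _ _
    rw [e1]
    exact ha'

theorem RegularAlong.comp₂ [Infinite k] {h : S × T → U} {f₁ : X → S} {f₂ : X → T} {x : X}
    (hf₁ : RegularAlong c w f₁ x) (hf₂ : RegularAlong c w f₂ x)
    (hh : RegularAt₂ h (f₁ x, f₂ x)) : RegularAlong c w (fun y => h (f₁ y, f₂ y)) x := by
  obtain ⟨d₁, g₁, hg₁, hx₁, hfg₁⟩ := hf₁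
  obtain ⟨d₂, g₂, hg₂, hx₂, hfg₂⟩ := hf₂
  obtain ⟨e, q, hq, hx', hhq⟩ := hh
  have hev : ∀ v j, eval v (bind₁ (Sum.elim g₁ g₂) (q j)) =
      eval (Sum.elim (fun l => eval v (g₁ l)) (fun l => eval v (g₂ l))) (q j) := by
    intro v j
    rw [MvPolynomial.eval, eval₂Hom_bind₁]
    have : (fun i => (eval₂Hom (RingHom.id k) v) (Sum.elim g₁ g₂ i)) =
        Sum.elim (fun l => eval v (g₁ l)) (fun l => eval v (g₂ l)) := by
      ext i
      rcases i with i | i <;> rfl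
    rw [this]
    rfl
  let Φ : (Fin 3 → k) → (Fin 3 → k) → Fin 3 → k := fun u v j => eval (Sum.elim u v) (q j)
  have hΦ₁ : ∀ (t : k) u v, Φ (t • u) v = t ^ e true • Φ u v := fun t u v => by
    ext j
    have := eval_sumElim_smul (hq j) t 1 u v
    rwa [one_smul, one_pow, mul_one] at this
  have hΦ₂ : ∀ (t : k) u v, Φ u (t • v) = t ^ e false • Φ u v := fun t u v => by
    ext j
    have := eval_sumElim_smul (hq j) 1 t u v
    rwa [one_smul, one_pow, one_mul] at this
  have e1 : ∀ y, (fun j => eval (c y) (bind₁ (Sum.elim g₁ g₂) (q j))) =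
      Φ (fun l => eval (c y) (g₁ l)) (fun l => eval (c y) (g₂ l)) :=
    fun y => _root_.funext fun j => hev _ j
  refine ⟨fun i => d₁ i * e true + d₂ i * e false, fun j => bind₁ (Sum.elim g₁ g₂) (q j),
    fun j i => ?_, ?_, fun y hy => ?_⟩
  · refine isWeightedHomogeneous_of_eval fun t v => ?_
    rw [hev, hev]
    have h1 : (fun l => eval (fun i' => t ^ w i i' * v i') (g₁ l)) =
        t ^ d₁ i • fun l => eval v (g₁ l) := by
      ext l
      exact eval_scaling_of_isWeightedHomogeneous (hg₁ l i) t v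
    have h2 : (fun l => eval (fun i' => t ^ w i i' * v i') (g₂ l)) =
        t ^ d₂ i • fun l => eval v (g₂ l) := by
      ext l
      exact eval_scaling_of_isWeightedHomogeneous (hg₂ l i) t v
    rw [h1, h2, eval_sumElim_smul (hq j), pow_add, pow_mul, pow_mul]
  · rw [e1]
    obtain ⟨a, -, ha'⟩ := exists_rep_eq_smul hx₁ (hfg₁ x hx₁)
    obtain ⟨b, -, hb'⟩ := exists_rep_eq_smul hx₂ (hfg₂ x hx₂)
    intro h0
    apply hx'
    change Φ (f₁ x).1.rep (f₂ x).1.rep = 0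
    rw [ha', hb', hΦ₁, hΦ₂, h0, smul_zero, smul_zero]
  · have hy' := hy
    rw [e1] at hy'
    obtain ⟨a, ha, ha'⟩ := exists_scaling (Φ := fun u => Φ u fun l => eval (c y) (g₂ l))
      (fun t u => hΦ₁ t u _) (fun h => hfg₁ y h) hy'
    have h1 : Φ (f₁ y).1.rep (fun l => eval (c y) (g₂ l)) ≠ 0 := by
      rw [ha']; exact smul_ne_zero ha hy'
    obtain ⟨b, hb, hb'⟩ := exists_scaling (Φ := fun v => Φ (f₁ y).1.rep v)
      (fun t u => hΦ₂ t _ u) (fun h => hfg₂ y h) h1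
    have h2 : Φ (f₁ y).1.rep (f₂ y).1.rep ≠ 0 := by rw [hb']; exact smul_ne_zero hb h1
    rw [hhq (f₁ y, f₂ y) h2]
    refine mk_eq_mk_of_smul (c := b * a) ?_ _ _
    rw [e1]
    change Φ (f₁ y).1.rep (f₂ y).1.rep = _
    rw [hb', ha', smul_smul]

theorem regularAt_id [Infinite k] (x : S) : RegularAt (fun y : S => y) x := by
  refine ⟨fun _ => 1, X, fun j _ => isHomogeneous_X k j, ?_, fun y hy => ?_⟩
  · simp only [eval_X]
    exact x.1.rep_nonzero
  · rw [← y.1.mk_rep]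
    congr 1
    ext j
    simp [coord]

theorem regularAlong_const (p : T) (x : X) : RegularAlong c w (fun _ => p) x := by
  refine ⟨fun _ => 0, fun j => C (p.1.rep j), fun j i => isWeightedHomogeneous_C _ _, ?_,
    fun y hy => ?_⟩
  · simp only [eval_C]
    exact p.1.rep_nonzero
  · refine p.1.mk_rep.symm.trans (mk_eq_mk_of_smul (c := 1) ?_ _ _)
    ext j
    simp

theorem regularAt₂_fst (x : S × T) : RegularAt₂ (fun p : S × T => p.1) x := by
  refine ⟨fun b => if b then 1 else 0, fun j => X (Sum.inl j), fun j b => ?_, ?_, fun y hy => ?_⟩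
  · have := isWeightedHomogeneous_X k (weight₂ b) (Sum.inl j)
    convert this using 1
    cases b <;> simp [weight₂]
  · simp only [eval_X]
    exact x.1.1.rep_nonzero
  · rw [← y.1.1.mk_rep]
    congr 1
    ext j
    simp [coord₂]

theorem regularAt₂_snd (x : S × T) : RegularAt₂ (fun p : S × T => p.2) x := by
  refine ⟨fun b => if b then 0 else 1, fun j => X (Sum.inr j), fun j b => ?_, ?_, fun y hy => ?_⟩
  · have := isWeightedHomogeneous_X k (weight₂ b) (Sum.inr j)
    convert this using 1
    cases b <;> simp [weight₂]
  · simp only [eval_X]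
    exact x.2.1.rep_nonzero
  · rw [← y.2.1.mk_rep]
    congr 1
    ext j
    simp [coord₂]

end RegularMaps

section Constant

variable {k : Type*} [Field k] [IsAlgClosed k]

/-- A regular function on a smooth cubic, given on the cone over the curve, is constant. -/
theorem regularFunction_const {G : MvPolynomial (Fin 3) k} (hG : IsSmoothCubic G)
    (u : (Fin 3 → k) → k) (hu : ∀ (t : k) v, t ≠ 0 → v ≠ 0 → eval v G = 0 → u (t • v) = u v)
    (hloc : ∀ v, v ≠ 0 → eval v G = 0 → ∃ a b : MvPolynomial (Fin 3) k, eval v b ≠ 0 ∧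
      ∀ y, y ≠ 0 → eval y G = 0 → u y * eval y b = eval y a) :
    ∃ c : k, ∀ v, v ≠ 0 → eval v G = 0 → u v = c := by
  have : Infinite k := IsAlgClosed.instInfinite
  by_cases hne : ∃ v, v ≠ 0 ∧ eval v G = 0
  swap
  · push Not at hne
    exact ⟨0, fun v hv h => absurd h (hne v hv)⟩
  let I : Ideal (MvPolynomial (Fin 3) k) :=
    { carrier := {p | ∃ a : MvPolynomial (Fin 3) k,
        ∀ y, y ≠ 0 → eval y G = 0 → u y * eval y p = eval y a}
      zero_mem' := ⟨0, by simp⟩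
      add_mem' := by
        rintro p q ⟨a, ha⟩ ⟨b, hb⟩
        exact ⟨a + b, fun y hy h => by rw [map_add, map_add, mul_add, ha y hy h, hb y hy h]⟩
      smul_mem' := by
        rintro r p ⟨a, ha⟩
        exact ⟨r * a, fun y hy h => by
          rw [smul_eq_mul, map_mul, map_mul, mul_left_comm, ha y hy h]⟩ }
  have hrad : idealOfVars (Fin 3) k ≤ I.radical := by
    rw [← vanishingIdeal_zeroLocus_eq_radical (K := k) I, idealOfVars, Ideal.span_le]
    rintro _ ⟨j, rfl⟩
    rw [SetLike.mem_coe, mem_vanishingIdeal_iff]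
    intro v hv
    rw [mem_zeroLocus_iff] at hv
    have hv0 : v = 0 := by
      by_contra hv0
      have hGI : G ∈ I := ⟨0, fun y _ h => by rw [h, mul_zero, map_zero]⟩
      have hGv : eval v G = 0 := by simpa [aeval_eq_eval] using hv G hGI
      obtain ⟨a, b, hb, hab⟩ := hloc v hv0 hGv
      exact hb (by simpa [aeval_eq_eval] using hv b ⟨a, hab⟩)
    simp [hv0]
  obtain ⟨n, hn⟩ := Ideal.exists_pow_le_of_le_radical_of_fg hrad
    (Submodule.fg_span (Set.finite_range _))
  set N := n + 1
  have hRI : ∀ p : MvPolynomial (Fin 3) k, p.IsHomogeneous N → p ∈ I := fun p hp => by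
    refine hn (Ideal.pow_le_pow_right (Nat.le_succ n) ?_)
    rw [mem_pow_idealOfVars_iff]
    intro s hs
    exact (hp.degree_eq_sum_deg_support hs).le
  let Cone := {v : Fin 3 → k // v ≠ 0 ∧ eval v G = 0}
  let ρ : MvPolynomial (Fin 3) k →ₗ[k] (Cone → k) :=
    { toFun := fun p v => eval v.1 p
      map_add' := fun p q => by ext v; simp
      map_smul' := fun c p => by ext v; simp }
  let W := (homogeneousSubmodule (Fin 3) k N).map ρ
  let m : (Cone → k) →ₗ[k] (Cone → k) := LinearMap.mulLeft k fun v => u v.1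
  have hmW : ∀ φ ∈ W, m φ ∈ W := by
    rintro _ ⟨p, hp, rfl⟩
    obtain ⟨a, ha⟩ := hRI p hp
    refine ⟨weightedHomogeneousComponent 1 N a,
      weightedHomogeneousComponent_isWeightedHomogeneous N a, ?_⟩
    ext ⟨v, hv, hGv⟩
    change eval v (weightedHomogeneousComponent 1 N a) = u v * eval v p
    rw [eval_weightedHomogeneousComponent 1 a N v (u v * eval v p), if_pos rfl]
    intro t ht
    have h1 : (fun i => t ^ (1 : Fin 3 → ℕ) i * v i) = t • v := by ext i; simp
    rw [h1, ← ha (t • v) (smul_ne_zero ht hv)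
      (by rw [isHomogeneous_eval_smul hG.1, hGv, mul_zero]), hu t v ht hv hGv,
      isHomogeneous_eval_smul hp]
    ring
  obtain ⟨v₀, hv₀, hGv₀⟩ := hne
  have : Nontrivial W := by
    obtain ⟨j, hj⟩ := Function.ne_iff.mp hv₀
    refine ⟨⟨⟨ρ (X j ^ N), ⟨X j ^ N, isHomogeneous_X_pow j N, rfl⟩⟩, 0, fun h => ?_⟩⟩
    have h1 := congrFun (congrArg Subtype.val h) ⟨v₀, hv₀, hGv₀⟩
    have h2 : v₀ j ^ N = 0 := by simpa [ρ] using h1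
    exact hj (pow_eq_zero_iff (Nat.succ_ne_zero n) |>.mp h2)
  obtain ⟨c, hc⟩ := Module.End.exists_eigenvalue (m.restrict hmW)
  obtain ⟨⟨_, b, hb, rfl⟩, hφ⟩ := hc.exists_hasEigenvector
  have hb0 : ¬ G ∣ b := by
    intro hdvd
    apply hφ.2
    ext ⟨v, hv, hGv⟩
    exact hG.vanishing_iff_dvd.mpr hdvd v hGv
  have hub : ∀ v, v ≠ 0 → eval v G = 0 → u v * eval v b = c * eval v b := fun v hv hGv => by
    have h1 := congrFun (congrArg Subtype.val (Module.End.mem_eigenspace_iff.mp hφ.1)) ⟨v, hv, hGv⟩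
    exact h1
  refine ⟨c, fun v hv hGv => ?_⟩
  obtain ⟨a', b', hb', hab'⟩ := hloc v hv hGv
  have hdvd : G ∣ (a' - C c * b') * b := by
    refine hG.dvd_of_vanishing fun y hy => ?_
    rcases eq_or_ne y 0 with rfl | hy0
    · rw [map_mul, eval_zero_of_isHomogeneous hb (Nat.succ_ne_zero n), mul_zero]
    · rw [map_mul, map_sub, map_mul, eval_C, ← hab' y hy0 hy]
      linear_combination (eval y b') * hub y hy0 hy
  have h2 := hG.vanishing_iff_dvd.mpr ((hG.prime.dvd_or_dvd hdvd).resolve_right hb0) v hGv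
  rw [map_sub, map_mul, eval_C, ← hab' v hv hGv, ← sub_mul] at h2
  exact sub_eq_zero.mp ((mul_eq_zero.mp h2).resolve_right hb')

/-- A regular map from a smooth cubic to itself whose image avoids a line is constant. -/
theorem regularMap_const {G : MvPolynomial (Fin 3) k} (hG : IsSmoothCubic G)
    {f : curvePoints G → curvePoints G} (hf : IsRegularMap f) (ℓ : (Fin 3 → k) →ₗ[k] k)
    (hℓ : ∀ x, ℓ (f x).1.rep ≠ 0) (x y : curvePoints G) : f x = f y := by
  classical
  let pt : ∀ v : Fin 3 → k, v ≠ 0 → eval v G = 0 → curvePoints G := fun v hv h =>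
    ⟨Projectivization.mk k v hv, (mk_mem_curvePoints hG.1 v hv).mpr h⟩
  let u : Fin 3 → (Fin 3 → k) → k := fun j v =>
    if h : v ≠ 0 ∧ eval v G = 0 then
      (f (pt v h.1 h.2)).1.rep j / ℓ (f (pt v h.1 h.2)).1.rep else 0
  have hu : ∀ j v (hv : v ≠ 0) (h : eval v G = 0),
      u j v = (f (pt v hv h)).1.rep j / ℓ (f (pt v hv h)).1.rep := fun j v hv h => dif_pos ⟨hv, h⟩
  have hconst : ∀ j, ∃ c : k, ∀ v, v ≠ 0 → eval v G = 0 → u j v = c := by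
    intro j
    refine regularFunction_const hG (u j) (fun t v ht hv h => ?_) fun v hv h => ?_
    · have h' : eval (t • v) G = 0 := by rw [isHomogeneous_eval_smul hG.1, h, mul_zero]
      have hp : pt (t • v) (smul_ne_zero ht hv) h' = pt v hv h :=
        Subtype.ext (mk_eq_mk_of_smul rfl _ _)
      rw [hu j _ (smul_ne_zero ht hv) h', hu j v hv h, hp]
    · obtain ⟨d, g, hg, hx, hfg⟩ := hf (pt v hv h)
      have hgs : ∀ (t : k) y, (fun l => eval (t • y) (g l)) = t ^ d • fun l => eval y (g l) :=
        fun t y => _root_.funext fun l => isHomogeneous_eval_smul (hg l) t y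
      have key : ∀ y (hy : y ≠ 0) (hGy : eval y G = 0), (fun l => eval y (g l)) ≠ 0 →
          ∃ c : k, c ≠ 0 ∧ (f (pt y hy hGy)).1.rep = c • fun l => eval y (g l) := by
        intro y hy hGy hne
        obtain ⟨a, ha, ha'⟩ := exists_rep_eq_smul (P := (pt y hy hGy).1) hy rfl
        have h1 : (fun l => eval (pt y hy hGy).1.rep (g l)) ≠ 0 := by
          rw [ha', hgs]
          exact smul_ne_zero (pow_ne_zero _ ha) hne
        obtain ⟨b, hb, hb'⟩ := exists_rep_eq_smul h1 (hfg _ h1)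
        refine ⟨b * a ^ d, mul_ne_zero hb (pow_ne_zero _ ha), ?_⟩
        rw [hb', ha', hgs, smul_smul]
      let b : MvPolynomial (Fin 3) k := ∑ l, C (ℓ (Pi.single l 1)) * g l
      have hb : ∀ y, eval y b = ℓ fun l => eval y (g l) := by
        intro y
        have h1 : (fun l => eval y (g l)) = ∑ l, eval y (g l) • (Pi.single l 1 : Fin 3 → k) := by
          ext l
          simp [Finset.sum_apply, Pi.single_apply]
        rw [h1, map_sum]
        simp [mul_comm]
      have hgv : (fun l => eval v (g l)) ≠ 0 := by
        intro h0
        obtain ⟨a, -, ha'⟩ := exists_rep_eq_smul (P := (pt v hv h).1) hv rfl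
        rw [ha', hgs, h0, smul_zero] at hx
        exact hx rfl
      refine ⟨g j, b, ?_, fun y hy hGy => ?_⟩
      · obtain ⟨c, hc, hc'⟩ := key v hv h hgv
        rw [hb]
        intro h0
        apply hℓ (pt v hv h)
        rw [hc', map_smul, h0, smul_zero]
      · rw [hb, hu j y hy hGy]
        by_cases h0 : (fun l => eval y (g l)) = 0
        · rw [h0, map_zero, mul_zero]
          exact (congrFun h0 j).symm
        · obtain ⟨c, hc, hc'⟩ := key y hy hGy h0
          have h2 := hℓ (pt y hy hGy)
          rw [hc', map_smul, smul_eq_mul] at h2 ⊢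
          have h3 := right_ne_zero_of_mul h2
          rw [Pi.smul_apply, smul_eq_mul]
          field_simp
  choose c hc using hconst
  have hrep : ∀ x : curvePoints G, (f x).1.rep = ℓ (f x).1.rep • c := by
    intro x
    have hx : pt x.1.rep x.1.rep_nonzero x.2 = x := Subtype.ext x.1.mk_rep
    ext j
    have h1 := hc j x.1.rep x.1.rep_nonzero x.2
    rw [hu j _ x.1.rep_nonzero x.2, hx, div_eq_iff (hℓ x)] at h1
    rw [h1, Pi.smul_apply, smul_eq_mul, mul_comm]
  refine Subtype.ext ?_
  rw [← (f x).1.mk_rep, ← (f y).1.mk_rep]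
  refine mk_eq_mk_of_smul (c := ℓ (f x).1.rep / ℓ (f y).1.rep) ?_ _ _
  have h2 : (ℓ (f x).1.rep / ℓ (f y).1.rep) • (f y).1.rep =
      (ℓ (f x).1.rep / ℓ (f y).1.rep) • ℓ (f y).1.rep • c := congrArg _ (hrep y)
  rw [h2, smul_smul, div_mul_cancel₀ _ (hℓ y)]
  exact hrep x

end Constant

section NormalForm

variable {k : Type*} [Field k]

/-- The symmetric trilinear form attached to a cubic form. -/
noncomputable def trilinear (F : MvPolynomial (Fin 3) k) (x y z : Fin 3 → k) : k :=
  x ⬝ᵥ hessMatrix F y *ᵥ z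

variable {F : MvPolynomial (Fin 3) k}

theorem trilinear_swap_right (hF : F.IsHomogeneous 3) (x y z : Fin 3 → k) :
    trilinear F x y z = trilinear F x z y := by
  rw [trilinear, trilinear, hessMatrix_mulVec_comm hF]

theorem trilinear_swap_outer (x y z : Fin 3 → k) : trilinear F x y z = trilinear F z y x := by
  rw [trilinear, trilinear, Matrix.dotProduct_mulVec, ← Matrix.mulVec_transpose,
    hessMatrix_isSymm, dotProduct_comm]

theorem trilinear_swap_left (hF : F.IsHomogeneous 3) (x y z : Fin 3 → k) :
    trilinear F x y z = trilinear F y x z := by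
  rw [trilinear_swap_outer, trilinear_swap_right hF, trilinear_swap_outer]

theorem trilinear_add_smul (a b c : k) (x y z u v : Fin 3 → k) :
    trilinear F (a • x + b • y + c • z) u v =
      a * trilinear F x u v + b * trilinear F y u v + c * trilinear F z u v := by
  simp only [trilinear, add_dotProduct, smul_dotProduct, smul_eq_mul]

theorem trilinear_add_smul_right (a b c : k) (x y z u v : Fin 3 → k) :
    trilinear F u v (a • x + b • y + c • z) =
      a * trilinear F u v x + b * trilinear F u v y + c * trilinear F u v z := by
  rw [trilinear_swap_outer, trilinear_add_smul]
  simp only [trilinear_swap_outer _ v u]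

theorem trilinear_add_smul_mid (hF : F.IsHomogeneous 3) (a b c : k) (x y z u v : Fin 3 → k) :
    trilinear F u (a • x + b • y + c • z) v =
      a * trilinear F u x v + b * trilinear F u y v + c * trilinear F u z v := by
  rw [trilinear_swap_left hF, trilinear_add_smul]
  simp only [trilinear_swap_left hF u]

theorem six_mul_eval (hF : F.IsHomogeneous 3) (x : Fin 3 → k) : 6 * eval x F = trilinear F x x x := by
  have h := three_mul_eval_cubic hF x
  have h2 : trilinear F x x x = ∑ j, x j * (2 * eval x (pderiv j F)) := by
    simp only [trilinear, dotProduct, two_mul_eval_pderiv hF]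
  rw [h2]
  simp only [mul_left_comm _ (2 : k), ← Finset.mul_sum, ← h]
  ring

theorem trilinear_self_eq (hF : F.IsHomogeneous 3) (x y : Fin 3 → k) :
    trilinear F y x x = 2 * ∑ j, y j * eval x (pderiv j F) := by
  simp only [trilinear, dotProduct, ← two_mul_eval_pderiv hF, mul_left_comm _ (2 : k),
    ← Finset.mul_sum]

theorem trilinear_expand (hF : F.IsHomogeneous 3) {w p f : Fin 3 → k}
    (h1 : trilinear F p p p = 0)
    (h2 : ∀ v, trilinear F v p w = 0) (x y z : k) :
    6 * eval (x • w + y • p + z • f) F = trilinear F w w w * x ^ 3 +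
      3 * trilinear F w w f * x ^ 2 * z + 3 * trilinear F w f f * x * z ^ 2 +
      trilinear F f f f * z ^ 3 + 3 * trilinear F p p f * y ^ 2 * z +
      3 * trilinear F p f f * y * z ^ 2 := by
  rw [six_mul_eval hF]
  simp only [trilinear_add_smul, trilinear_add_smul_right, trilinear_add_smul_mid hF]
  have h3 : ∀ v, trilinear F v w p = 0 := fun v => by rw [trilinear_swap_right hF, h2]
  have h4 : ∀ v, trilinear F w v p = 0 := fun v => by rw [trilinear_swap_left hF, h3]
  have h5 : ∀ v, trilinear F p v w = 0 := fun v => by rw [trilinear_swap_left hF, h2]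
  have h6 : ∀ v, trilinear F p w v = 0 := fun v => by rw [trilinear_swap_right hF, h5]
  have h7 : ∀ v, trilinear F w p v = 0 := fun v => by rw [trilinear_swap_right hF, h4]
  have e1 : trilinear F f w w = trilinear F w w f := trilinear_swap_outer _ _ _
  have e2 : trilinear F w f w = trilinear F w w f := trilinear_swap_right hF _ _ _
  have e3 : trilinear F f f w = trilinear F w f f := trilinear_swap_outer _ _ _
  have e4 : trilinear F f w f = trilinear F w f f := trilinear_swap_left hF _ _ _
  have e5 : trilinear F f p p = trilinear F p p f := trilinear_swap_outer _ _ _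
  have e6 : trilinear F p f p = trilinear F p p f := trilinear_swap_right hF _ _ _
  have e7 : trilinear F f f p = trilinear F p f f := trilinear_swap_outer _ _ _
  have e8 : trilinear F f p f = trilinear F p f f := trilinear_swap_left hF _ _ _
  rw [e1, e2, e3, e4, e5, e6, e7, e8]
  simp only [h1, h2, h3, h4, h5, h6, h7]
  ring

/-- A cubic curve in Legendre form, with affine equation `y² = (x - a) (x - b) (x - c)`. -/
noncomputable def normalCubic (a b c : k) : MvPolynomial (Fin 3) k :=
  X 1 ^ 2 * X 2 - (X 0 - C a * X 2) * (X 0 - C b * X 2) * (X 0 - C c * X 2)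

theorem eval_normalCubic (a b c : k) (v : Fin 3 → k) : eval v (normalCubic a b c) =
    v 1 ^ 2 * v 2 - (v 0 - a * v 2) * (v 0 - b * v 2) * (v 0 - c * v 2) := by
  simp [normalCubic]

theorem exists_cubic_roots [IsAlgClosed k] (a b c : k) : ∃ e₁ e₂ e₃ : k,
    a = -(e₁ + e₂ + e₃) ∧ b = e₁ * e₂ + e₁ * e₃ + e₂ * e₃ ∧ c = -(e₁ * e₂ * e₃) := by
  obtain ⟨e₁, h₁⟩ := IsAlgClosed.exists_root
    (Polynomial.C 1 * Polynomial.X ^ 3 + Polynomial.C a * Polynomial.X ^ 2 +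
      Polynomial.C b * Polynomial.X + Polynomial.C c)
    (by rw [Polynomial.degree_cubic one_ne_zero]; decide)
  have h₁' : e₁ ^ 3 + a * e₁ ^ 2 + b * e₁ + c = 0 := by simpa using h₁
  obtain ⟨e₂, h₂⟩ := exists_quadratic_root (one_ne_zero (α := k)) (a + e₁) (b + e₁ * (a + e₁))
  refine ⟨e₁, e₂, -a - e₁ - e₂, by ring, by linear_combination h₂, ?_⟩
  linear_combination h₁' - e₁ * h₂

/-- A smooth cubic has a Legendre equation in suitable coordinates. -/
theorem exists_pullback_eq_normalCubic [IsAlgClosed k] [CharZero k] {G : MvPolynomial (Fin 3) k}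
    (hG : IsSmoothCubic G) : ∃ (g : (Fin 3 → k) ≃ₗ[k] (Fin 3 → k)) (a b c r : k), r ≠ 0 ∧
      pullback g G = r • normalCubic a b c := by
  have hF := hG.1
  obtain ⟨p, hp, hpG, hpH⟩ := exists_common_zero G (hessian G)
    (eval_zero_of_isHomogeneous hF (by norm_num))
    (eval_zero_of_isHomogeneous (isHomogeneous_hessian hF) (by norm_num))
  rw [eval_hessian] at hpH
  obtain ⟨w, hw, hpw⟩ := Matrix.exists_mulVec_eq_zero_iff.mpr hpH
  have h2 : ∀ v, trilinear G v p w = 0 := fun v => by rw [trilinear, hpw, dotProduct_zero]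
  have h1 : trilinear G p p p = 0 := by rw [← six_mul_eval hF, hpG, mul_zero]
  have hwpp : trilinear G w p p = 0 := by rw [trilinear_swap_outer, h2]
  obtain ⟨j, hj⟩ := hG.2 p hp hpG
  set f : Fin 3 → k := Pi.single j 1
  have hf : trilinear G p p f ≠ 0 := by
    rw [trilinear_swap_outer, trilinear_self_eq hF]
    simpa [f, Pi.single_apply] using hj
  have hfpp : trilinear G f p p ≠ 0 := by rwa [trilinear_swap_outer]
  have hind : ∀ x y z : k, x • w + y • p + z • f = 0 → x = 0 ∧ y = 0 ∧ z = 0 := by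
    intro x y z h
    have hz := trilinear_add_smul (F := G) x y z w p f p p
    rw [h, hwpp, h1, mul_zero, mul_zero, zero_add, zero_add, trilinear, zero_dotProduct] at hz
    have hz0 : z = 0 := (mul_eq_zero.mp hz.symm).resolve_right hfpp
    have hy := trilinear_add_smul (F := G) x y z w p f p f
    have hwpf : trilinear G w p f = 0 := by rw [trilinear_swap_outer, h2]
    rw [h, hwpf, mul_zero, zero_add, hz0, zero_mul, add_zero, trilinear, zero_dotProduct] at hy
    have hy0 : y = 0 := (mul_eq_zero.mp hy.symm).resolve_right hf
    rw [hz0, hy0, zero_smul, zero_smul, add_zero, add_zero] at h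
    exact ⟨(smul_eq_zero.mp h).resolve_right hw, hy0, hz0⟩
  have exp := trilinear_expand hF (f := f) h1 h2
  have hwww : trilinear G w w w ≠ 0 := by
    intro h0
    obtain ⟨s, hs⟩ := exists_quadratic_root hf 0 (trilinear G w w f)
    have hv : w + s • p ≠ 0 := by
      intro h
      have := hind 1 s 0 (by rw [one_smul, zero_smul, add_zero, h])
      exact one_ne_zero this.1
    have hv' : w + s • p = (1 : k) • w + s • p + (0 : k) • f := by
      rw [one_smul, zero_smul, add_zero]
    have hGv : eval (w + s • p) G = 0 := by
      have := exp 1 s 0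
      rw [← hv', h0] at this
      simpa using this
    have hpair : ∀ u, trilinear G u (w + s • p) (w + s • p) =
        trilinear G u w w + s ^ 2 * trilinear G u p p := by
      intro u
      rw [hv', trilinear_add_smul_right, trilinear_add_smul_mid hF, trilinear_add_smul_mid hF,
        trilinear_swap_right hF u w p, h2]
      ring
    have hwpw : trilinear G p w w = 0 := by rw [trilinear_swap_left hF, h2]
    have hall : ∀ u, trilinear G u (w + s • p) (w + s • p) = 0 := by
      let e : (Fin 3 → k) →ₗ[k] (Fin 3 → k) := Fintype.linearCombination k ![w, p, f]
      have he : ∀ x, e x = x 0 • w + x 1 • p + x 2 • f := fun x => by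
        simp [e, Fintype.linearCombination_apply, Fin.sum_univ_three]
      have hinj : Function.Injective e := by
        rw [injective_iff_map_eq_zero]
        intro x hx
        rw [he] at hx
        obtain ⟨a, b, c⟩ := hind _ _ _ hx
        ext i
        fin_cases i <;> assumption
      intro u
      obtain ⟨x, rfl⟩ := LinearMap.surjective_of_injective hinj u
      rw [he, trilinear_add_smul, hpair, hpair, hpair, h0, hwpp, hwpw, h1,
        trilinear_swap_outer f w w, trilinear_swap_outer f p p]
      linear_combination x 2 * hs
    obtain ⟨m, hm⟩ := hG.2 _ hv hGv
    apply hm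
    have := hall (Pi.single m 1)
    rw [trilinear_self_eq hF] at this
    simpa [Pi.single_apply] using this
  set t := trilinear G w w w
  set q := trilinear G p p f
  set δ := -t / (3 * q)
  have hδ : δ ≠ 0 := div_ne_zero (neg_ne_zero.mpr hwww) (mul_ne_zero three_ne_zero hf)
  set γ := -(trilinear G p f f * δ) / (2 * q)
  have hδq : 3 * q * δ = -t := by
    simp only [δ]; field_simp
  have hγq : 2 * q * γ = -(trilinear G p f f * δ) := by
    simp only [γ]; field_simp
  obtain ⟨a, b, c, ha, hb, hc⟩ := exists_cubic_roots (3 * trilinear G w w f * δ / t)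
    (3 * trilinear G w f f * δ ^ 2 / t)
    ((trilinear G f f f * δ ^ 3 + 3 * q * δ * γ ^ 2 + 3 * trilinear G p f f * δ ^ 2 * γ) / t)
  rw [div_eq_iff hwww] at ha hb hc
  let e : (Fin 3 → k) →ₗ[k] (Fin 3 → k) := Fintype.linearCombination k ![w, p, γ • p + δ • f]
  have he : ∀ x, e x = x 0 • w + (x 1 + γ * x 2) • p + (δ * x 2) • f := fun x => by
    simp [e, Fintype.linearCombination_apply, Fin.sum_univ_three]
    module
  have hinj : Function.Injective e := by
    rw [injective_iff_map_eq_zero]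
    intro x hx
    rw [he] at hx
    obtain ⟨h0, h1', h2'⟩ := hind _ _ _ hx
    have hx2 : x 2 = 0 := (mul_eq_zero.mp h2').resolve_left hδ
    rw [hx2, mul_zero, add_zero] at h1'
    ext i
    fin_cases i <;> assumption
  refine ⟨LinearEquiv.ofInjectiveEndo e hinj, a, b, c, -t / 6,
    div_ne_zero (neg_ne_zero.mpr hwww) (by norm_num), ?_⟩
  refine MvPolynomial.funext fun v => ?_
  rw [eval_pullback, LinearEquiv.coe_ofInjectiveEndo, smul_eval, eval_normalCubic]
  have hv := exp (v 0) (v 1 + γ * v 2) (δ * v 2)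
  rw [← he] at hv
  refine mul_left_cancel₀ (a := (6 : k)) (by norm_num) ?_
  rw [hv]
  linear_combination (v 0 ^ 2 * v 2) * ha + (v 0 * v 2 ^ 2) * hb + v 2 ^ 3 * hc +
    (v 1 ^ 2 * v 2) * hδq + 3 * δ * v 1 * v 2 ^ 2 * hγq

theorem normalCubic_ne {a b c : k} (h : IsSmoothCubic (normalCubic a b c)) :
    a ≠ b ∧ a ≠ c ∧ b ≠ c := by
  have key : ∀ e, (a = e ∧ b = e) ∨ (a = e ∧ c = e) ∨ (b = e ∧ c = e) → False := by
    intro e he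
    have hv : (![e, 0, 1] : Fin 3 → k) ≠ 0 := fun h0 => by
      have := congrFun h0 2
      simp at this
    obtain ⟨j, hj⟩ := h.2 ![e, 0, 1] hv (by
      rw [eval_normalCubic]
      rcases he with ⟨rfl, rfl⟩ | ⟨rfl, rfl⟩ | ⟨rfl, rfl⟩ <;> simp)
    apply hj
    rcases he with ⟨rfl, rfl⟩ | ⟨rfl, rfl⟩ | ⟨rfl, rfl⟩ <;> fin_cases j <;>
      simp [normalCubic, Derivation.leibniz, Derivation.leibniz_pow, pderiv_X]
  refine ⟨fun h => key b (Or.inl ⟨h, rfl⟩), fun h => key c (Or.inr (Or.inl ⟨h, rfl⟩)),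
    fun h => key c (Or.inr (Or.inr ⟨h, rfl⟩))⟩

end NormalForm

section GroupLaw

variable {k : Type*} [Field k]

/-- The Weierstrass curve `y² = (x - a) (x - b) (x - c)`. -/
def legendreCurve (a b c : k) : WeierstrassCurve k where
  a₁ := 0
  a₂ := -(a + b + c)
  a₃ := 0
  a₄ := a * b + a * c + b * c
  a₆ := -(a * b * c)

/-- The projective Weierstrass curve `y² = (x - a) (x - b) (x - c)`. -/
abbrev legendreProj (a b c : k) : WeierstrassCurve.Projective k := (legendreCurve a b c).toProjective

theorem polynomial_legendreProj [Infinite k] (a b c : k) :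
    (legendreProj a b c).polynomial = normalCubic a b c :=
  MvPolynomial.funext fun v => by
    rw [WeierstrassCurve.Projective.eval_polynomial, eval_normalCubic]
    simp [legendreCurve]
    ring

theorem ne_zero_of_nonsingular {a b c : k} {v : Fin 3 → k}
    (hv : (legendreProj a b c).Nonsingular v) :
    v ≠ 0 := by
  rintro rfl
  rw [WeierstrassCurve.Projective.nonsingular_iff] at hv
  simp at hv

open WeierstrassCurve.Projective in
/-- The polynomials of the chord construction. -/
noncomputable def chordForms (a b c : k) : Fin 3 → MvPolynomial (Fin 3 ⊕ Fin 3) k :=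
  ((legendreCurve a b c).map C).toProjective.addXYZ (fun i => X (Sum.inl i))
    (fun i => X (Sum.inr i))

open WeierstrassCurve.Projective in
theorem eval_chordForms {a b c : k} (u v : Fin 3 → k) :
    (fun j => eval (Sum.elim u v) (chordForms a b c j)) = (legendreProj a b c).addXYZ u v := by
  ext j
  fin_cases j <;>
    simp [chordForms, addXYZ, addX, addY, negAddY, addZ, negY, legendreCurve]

open WeierstrassCurve.Projective in
theorem eq_of_equiv {p q : Plane k} (h : p.rep ≈ q.rep) : p = q := by
  obtain ⟨r, hr⟩ := h
  rw [← p.mk_rep, ← q.mk_rep]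
  exact mk_eq_mk_of_smul (c := (r : k)) hr.symm _ _

variable [Infinite k] {a b c : k}

theorem nonsingular_legendreProj (h : IsSmoothCubic (normalCubic a b c)) {v : Fin 3 → k}
    (hv : v ≠ 0) (hN : eval v (normalCubic a b c) = 0) : (legendreProj a b c).Nonsingular v := by
  refine ⟨by rw [WeierstrassCurve.Projective.Equation, polynomial_legendreProj, hN], ?_⟩
  obtain ⟨j, hj⟩ := h.2 v hv hN
  rw [WeierstrassCurve.Projective.polynomialX, WeierstrassCurve.Projective.polynomialY,
    WeierstrassCurve.Projective.polynomialZ, polynomial_legendreProj]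
  fin_cases j
  · exact Or.inl hj
  · exact Or.inr (Or.inl hj)
  · exact Or.inr (Or.inr hj)

theorem eval_normalCubic_of_nonsingular {v : Fin 3 → k} (hv : (legendreProj a b c).Nonsingular v) :
    eval v (normalCubic a b c) = 0 := by
  rw [← polynomial_legendreProj]
  exact hv.1

theorem isHomogeneous_normalCubic (a b c : k) : (normalCubic a b c).IsHomogeneous 3 :=
  isHomogeneous_of_eval fun t v => by
    simp only [eval_normalCubic, Pi.smul_apply, smul_eq_mul]
    ring

/-- The affine point of the Weierstrass curve attached to a point of the plane cubic. -/
noncomputable def toAffinePoint (a b c : k) (p : curvePoints (normalCubic a b c)) :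
    (legendreProj a b c).toAffine.Point :=
  WeierstrassCurve.Projective.Point.toAffine (legendreProj a b c) p.1.rep

theorem nonsingular_rep (h : IsSmoothCubic (normalCubic a b c))
    (p : curvePoints (normalCubic a b c)) : (legendreProj a b c).Nonsingular p.1.rep :=
  nonsingular_legendreProj h p.1.rep_nonzero p.2

/-- The point of the plane cubic with given coordinates. -/
noncomputable def pointOf {v : Fin 3 → k} (hv : (legendreProj a b c).Nonsingular v) :
    curvePoints (normalCubic a b c) :=
  ⟨Projectivization.mk k v (ne_zero_of_nonsingular hv),
    (mk_mem_curvePoints (isHomogeneous_normalCubic a b c) v _).mpr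
      (eval_normalCubic_of_nonsingular hv)⟩

theorem toAffinePoint_pointOf {v : Fin 3 → k} (hv : (legendreProj a b c).Nonsingular v) :
    toAffinePoint a b c (pointOf hv) =
      WeierstrassCurve.Projective.Point.toAffine (legendreProj a b c) v := by
  obtain ⟨r, hr⟩ := Projectivization.exists_smul_eq_mk_rep k v (ne_zero_of_nonsingular hv)
  have h1 : (pointOf hv).1.rep = (r : k) • v := hr.symm
  rw [toAffinePoint, h1, WeierstrassCurve.Projective.Point.toAffine_smul _ r.isUnit]

open WeierstrassCurve.Projective in
theorem toAffinePoint_bijective (h : IsSmoothCubic (normalCubic a b c)) :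
    Function.Bijective (toAffinePoint a b c) := by
  constructor
  · intro p q hpq
    have hp := nonsingular_rep h p
    have hq := nonsingular_rep h q
    refine Subtype.ext (eq_of_equiv ?_)
    rw [toAffinePoint, toAffinePoint] at hpq
    by_cases hpz : p.1.rep 2 = 0 <;> by_cases hqz : q.1.rep 2 = 0
    · exact equiv_of_Z_eq_zero hp hq hpz hqz
    · rw [Point.toAffine_of_Z_eq_zero hpz, Point.toAffine_of_Z_ne_zero hq hqz] at hpq
      cases hpq
    · rw [Point.toAffine_of_Z_eq_zero hqz, Point.toAffine_of_Z_ne_zero hp hpz] at hpq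
      cases hpq
    · rw [Point.toAffine_of_Z_ne_zero hp hpz, Point.toAffine_of_Z_ne_zero hq hqz] at hpq
      injection hpq with h1 h2
      exact equiv_of_X_eq_of_Y_eq hpz hqz ((div_eq_div_iff hpz hqz).mp h1)
        ((div_eq_div_iff hpz hqz).mp h2)
  · rintro (_ | ⟨x, y, hxy⟩)
    · exact ⟨pointOf nonsingular_zero, by
        rw [toAffinePoint_pointOf, Point.toAffine_zero]; rfl⟩
    · exact ⟨pointOf ((nonsingular_some x y).mpr hxy), by
        rw [toAffinePoint_pointOf, Point.toAffine_some ((nonsingular_some x y).mpr hxy)]⟩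

/-- The bijection between the plane cubic and the Weierstrass curve. -/
noncomputable def affineEquiv (h : IsSmoothCubic (normalCubic a b c)) :
    curvePoints (normalCubic a b c) ≃ (legendreProj a b c).toAffine.Point :=
  Equiv.ofBijective _ (toAffinePoint_bijective h)

open Classical in
/-- The group law on a cubic in Legendre form, with origin the flex at infinity. -/
@[reducible]
noncomputable def legendreGroup (h : IsSmoothCubic (normalCubic a b c)) :
    AddCommGroup (curvePoints (normalCubic a b c)) :=
  (affineEquiv h).addCommGroup

open WeierstrassCurve.Projective in
theorem pointOf_addXYZ (h : IsSmoothCubic (normalCubic a b c))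
    {p q : curvePoints (normalCubic a b c)} (hpq : ¬ p.1.rep ≈ q.1.rep) :
    ∃ hv : (legendreProj a b c).Nonsingular ((legendreProj a b c).addXYZ p.1.rep q.1.rep),
      letI := legendreGroup h
      p + q = pointOf hv := by
  classical
  have hp := nonsingular_rep h p
  have hq := nonsingular_rep h q
  have hadd := add_of_not_equiv (W' := legendreProj a b c) hpq
  have hns := nonsingular_add hp hq
  have hsum := Point.toAffine_add hp hq
  rw [hadd] at hns hsum
  refine ⟨hns, ?_⟩
  let _ := legendreGroup h
  apply (affineEquiv h).injective
  have e1 : affineEquiv h (p + q) = affineEquiv h p + affineEquiv h q := by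
    rw [Equiv.add_def, Equiv.apply_symm_apply]
  rw [e1]
  refine Eq.trans ?_ ((toAffinePoint_pointOf hns).trans hsum).symm
  rfl

open WeierstrassCurve.Projective in
theorem regularAt₂_add_of_ne (h : IsSmoothCubic (normalCubic a b c))
    (x : curvePoints (normalCubic a b c) × curvePoints (normalCubic a b c)) (hx : x.1 ≠ x.2) :
    letI := legendreGroup h
    RegularAt₂ (fun y : curvePoints (normalCubic a b c) × curvePoints (normalCubic a b c) =>
      y.1 + y.2) x := by
  let _ := legendreGroup h
  have hne : ¬ x.1.1.rep ≈ x.2.1.rep := fun he => hx (Subtype.ext (eq_of_equiv he))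
  refine ⟨fun _ => 2, chordForms a b c, fun j i => ?_, ?_, fun y hy => ?_⟩
  · refine isWeightedHomogeneous_of_eval fun t v => ?_
    obtain ⟨u, v, rfl⟩ : ∃ u u', v = Sum.elim u u' :=
      ⟨v ∘ Sum.inl, v ∘ Sum.inr, (Sum.elim_comp_inl_inr v).symm⟩
    have h1 : (fun i' => t ^ weight₂ i i' * (Sum.elim u v : Fin 3 ⊕ Fin 3 → k) i') =
        Sum.elim ((if i then t else 1) • u) ((if i then 1 else t) • v) := by
      ext i'
      rcases i' with i' | i' <;> cases i <;> simp [weight₂]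
    have h2 : ∀ u v : Fin 3 → k, eval (Sum.elim u v) (chordForms a b c j) =
        (legendreProj a b c).addXYZ u v j := fun u v => congrFun (eval_chordForms u v) j
    rw [h1, h2, h2, addXYZ_smul, Pi.smul_apply, smul_eq_mul]
    cases i <;> simp
  · obtain ⟨hv, -⟩ := pointOf_addXYZ h hne
    exact fun h0 => ne_zero_of_nonsingular hv ((eval_chordForms _ _).symm.trans h0)
  · have hy' : (legendreProj a b c).addXYZ y.1.1.rep y.2.1.rep ≠ 0 :=
      fun h0 => hy ((eval_chordForms _ _).trans h0)
    have hne' : ¬ y.1.1.rep ≈ y.2.1.rep := by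
      rintro ⟨r, hr⟩
      apply hy'
      have h4 : y.1.1.rep = (r : k) • y.2.1.rep := hr.symm
      have h5 := addXYZ_smul (W' := legendreProj a b c) y.2.1.rep y.2.1.rep (r : k) 1
      rw [one_smul, ← h4, addXYZ_self] at h5
      rw [h5]
      ext j
      fin_cases j <;> simp
    obtain ⟨hv, hsum⟩ := pointOf_addXYZ h hne'
    refine (congrArg Subtype.val hsum).trans ?_
    refine mk_eq_mk_of_smul (c := 1) ?_ _ _
    rw [one_smul]
    exact (eval_chordForms _ _).symm

open WeierstrassCurve.Projective in
theorem affineEquiv_neg (h : IsSmoothCubic (normalCubic a b c))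
    (p : curvePoints (normalCubic a b c)) :
    letI := legendreGroup h
    affineEquiv h (-p) = -affineEquiv h p := by
  let _ := legendreGroup h
  rw [Equiv.neg_def, Equiv.apply_symm_apply]

open WeierstrassCurve.Projective in
theorem regularAt_neg (h : IsSmoothCubic (normalCubic a b c))
    (x : curvePoints (normalCubic a b c)) :
    letI := legendreGroup h
    RegularAt (fun y : curvePoints (normalCubic a b c) => -y) x := by
  let _ := legendreGroup h
  have hev : ∀ v : Fin 3 → k, (fun j => eval v (![X 0, -X 1, X 2] j : MvPolynomial (Fin 3) k)) =
      (legendreProj a b c).neg v := by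
    intro v
    ext j
    fin_cases j <;> simp [neg, negY, legendreCurve]
  have hns : ∀ p : curvePoints (normalCubic a b c),
      (legendreProj a b c).Nonsingular ((legendreProj a b c).neg p.1.rep) :=
    fun p => nonsingular_neg (nonsingular_rep h p)
  refine ⟨fun _ => 1, ![X 0, -X 1, X 2], fun j i => ?_, ?_, fun y hy => ?_⟩
  · fin_cases j
    · exact isHomogeneous_X k 0
    · exact (isHomogeneous_X k 1).neg
    · exact isHomogeneous_X k 2
  · exact fun h0 => ne_zero_of_nonsingular (hns x) ((hev _).symm.trans h0)
  · have e : -y = pointOf (hns y) := by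
      apply (affineEquiv h).injective
      rw [affineEquiv_neg]
      exact ((toAffinePoint_pointOf (hns y)).trans
        (Point.toAffine_neg (nonsingular_rep h y))).symm
    refine (congrArg Subtype.val e).trans ?_
    refine mk_eq_mk_of_smul (c := 1) ?_ _ _
    rw [one_smul]
    exact (hev _).symm

open WeierstrassCurve.Projective in
theorem rep_two_eq_zero_iff (h : IsSmoothCubic (normalCubic a b c))
    (p : curvePoints (normalCubic a b c)) :
    letI := legendreGroup h
    p.1.rep 2 = 0 ↔ p = 0 := by
  let _ := legendreGroup h
  have e0 : affineEquiv h 0 = 0 := by rw [Equiv.zero_def, Equiv.apply_symm_apply]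
  rw [← (affineEquiv h).apply_eq_iff_eq, e0]
  constructor
  · exact fun hz => Point.toAffine_of_Z_eq_zero hz
  · intro hp
    by_contra hz
    have h1 : Point.toAffine (legendreProj a b c) p.1.rep = 0 := hp
    rw [Point.toAffine_of_Z_ne_zero (nonsingular_rep h p) hz] at h1
    cases h1

open WeierstrassCurve.Projective in
theorem add_self_eq_zero_iff (h : IsSmoothCubic (normalCubic a b c)) [CharZero k]
    (p : curvePoints (normalCubic a b c)) :
    letI := legendreGroup h
    p ≠ 0 → (p + p = 0 ↔ p.1.rep 1 = 0) := by
  let _ := legendreGroup h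
  intro hp0
  have hz := (rep_two_eq_zero_iff h p).not.mpr hp0
  rw [add_eq_zero_iff_eq_neg, ← (affineEquiv h).apply_eq_iff_eq, affineEquiv_neg]
  have h1 : affineEquiv h p = _ := Point.toAffine_of_Z_ne_zero (nonsingular_rep h p) hz
  rw [h1, WeierstrassCurve.Affine.Point.neg_some, WeierstrassCurve.Affine.Point.some.injEq]
  simp only [WeierstrassCurve.Affine.negY, legendreCurve, true_and, zero_mul, sub_zero]
  constructor
  · intro h2
    have h3 : 2 * (p.1.rep 1 / p.1.rep 2) = 0 := by linear_combination h2
    simpa [hz] using h3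
  · intro h2
    simp [h2]

/-- The points of order two of the group law are the three points on the axis `y = 0`. -/
theorem ncard_two_torsion (h : IsSmoothCubic (normalCubic a b c)) [CharZero k] :
    letI := legendreGroup h
    {t : curvePoints (normalCubic a b c) | t ≠ 0 ∧ t + t = 0}.ncard = 3 := by
  let _ := legendreGroup h
  obtain ⟨hab, hac, hbc⟩ := normalCubic_ne h
  have hv0 : ∀ e : k, (![e, 0, 1] : Fin 3 → k) ≠ 0 := fun e h0 => by
    have := congrFun h0 2
    simp at this
  have hmem : ∀ e : k, e = a ∨ e = b ∨ e = c →
      Projectivization.mk k _ (hv0 e) ∈ curvePoints (normalCubic a b c) := by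
    intro e he
    rw [mk_mem_curvePoints (isHomogeneous_normalCubic a b c), eval_normalCubic]
    rcases he with rfl | rfl | rfl <;> simp
  have hinj : ∀ e e' : k, Projectivization.mk k _ (hv0 e) = Projectivization.mk k _ (hv0 e') →
      e = e' := by
    intro e e' hee
    obtain ⟨r, hr⟩ := (Projectivization.mk_eq_mk_iff' k _ _ _ _).mp hee
    have h2 := congrFun hr 2
    have h0 := congrFun hr 0
    simp at h2 h0
    rw [← h0, h2, one_mul]
  let pt : ∀ e : k, (e = a ∨ e = b ∨ e = c) → curvePoints (normalCubic a b c) :=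
    fun e he => ⟨_, hmem e he⟩
  have hset : {t : curvePoints (normalCubic a b c) | t ≠ 0 ∧ t + t = 0} =
      {pt a (Or.inl rfl), pt b (Or.inr (Or.inl rfl)), pt c (Or.inr (Or.inr rfl))} := by
    ext p
    simp only [Set.mem_ofPred_eq, Set.mem_insert_iff, Set.mem_singleton_iff]
    constructor
    · rintro ⟨hp, hpp⟩
      have hz := (rep_two_eq_zero_iff h p).not.mpr hp
      have hy := (add_self_eq_zero_iff h p hp).mp hpp
      have hN := p.2
      rw [mem_curvePoints_iff, eval_normalCubic, hy] at hN
      have hp' : ∀ e, p.1.rep 0 - e * p.1.rep 2 = 0 → p.1 = Projectivization.mk k _ (hv0 e) := by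
        intro e he
        rw [← p.1.mk_rep]
        refine mk_eq_mk_of_smul (c := p.1.rep 2) ?_ _ _
        ext i
        fin_cases i
        · simpa [mul_comm] using sub_eq_zero.mp he
        · simpa using hy
        · simp
      have hN' : (p.1.rep 0 - a * p.1.rep 2) * (p.1.rep 0 - b * p.1.rep 2) *
          (p.1.rep 0 - c * p.1.rep 2) = 0 := by linear_combination -hN
      rcases mul_eq_zero.mp hN' with hN' | hN'
      · rcases mul_eq_zero.mp hN' with hN' | hN'
        · exact Or.inl (Subtype.ext (hp' a hN'))
        · exact Or.inr (Or.inl (Subtype.ext (hp' b hN')))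
      · exact Or.inr (Or.inr (Subtype.ext (hp' c hN')))
    · have hpt : ∀ e he, pt e he ≠ 0 ∧ pt e he + pt e he = 0 := by
        intro e he
        obtain ⟨r, hr, hr'⟩ := exists_rep_eq_smul (P := (pt e he).1) (hv0 e) rfl
        have hp : pt e he ≠ 0 := by
          rw [Ne, ← rep_two_eq_zero_iff h, hr']
          simpa using hr
        refine ⟨hp, (add_self_eq_zero_iff h _ hp).mpr ?_⟩
        rw [hr']
        simp
      rintro (rfl | rfl | rfl)
      exacts [hpt a (Or.inl rfl), hpt b (Or.inr (Or.inl rfl)), hpt c (Or.inr (Or.inr rfl))]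
  rw [hset, Set.ncard_eq_three]
  exact ⟨_, _, _, fun h0 => hab (hinj _ _ (congrArg Subtype.val h0)),
    fun h0 => hac (hinj _ _ (congrArg Subtype.val h0)),
    fun h0 => hbc (hinj _ _ (congrArg Subtype.val h0)), rfl⟩

theorem exists_add_self_ne_zero [IsAlgClosed k] [CharZero k]
    (h : IsSmoothCubic (normalCubic a b c)) :
    letI := legendreGroup h
    ∃ t : curvePoints (normalCubic a b c), t + t ≠ 0 := by
  let _ := legendreGroup h
  classical
  obtain ⟨x, hx⟩ := Infinite.exists_notMem_finset ({a, b, c} : Finset k)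
  simp only [Finset.mem_insert, Finset.mem_singleton, not_or] at hx
  obtain ⟨y, hy⟩ := IsAlgClosed.exists_pow_nat_eq ((x - a) * (x - b) * (x - c)) two_pos
  have hy0 : y ≠ 0 := by
    rintro rfl
    have := mul_ne_zero (mul_ne_zero (sub_ne_zero.mpr hx.1) (sub_ne_zero.mpr hx.2.1))
      (sub_ne_zero.mpr hx.2.2)
    exact this (by rw [← hy]; ring)
  have hv0 : (![x, y, 1] : Fin 3 → k) ≠ 0 := fun h0 => by
    have := congrFun h0 2
    simp at this
  let p : curvePoints (normalCubic a b c) := ⟨Projectivization.mk k _ hv0, by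
    rw [mk_mem_curvePoints (isHomogeneous_normalCubic a b c), eval_normalCubic]
    simp [hy]⟩
  obtain ⟨r, hr, hr'⟩ := exists_rep_eq_smul (P := p.1) hv0 rfl
  have hp : p ≠ 0 := by
    rw [Ne, ← rep_two_eq_zero_iff h, hr']
    simpa using hr
  refine ⟨p, ?_⟩
  rw [Ne, add_self_eq_zero_iff h p hp, hr']
  simpa using ⟨hr, hy0⟩

/-- The addition is regular everywhere. -/
theorem regularAt₂_add [IsAlgClosed k] [CharZero k] (h : IsSmoothCubic (normalCubic a b c))
    (x : curvePoints (normalCubic a b c) × curvePoints (normalCubic a b c)) :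
    letI := legendreGroup h
    RegularAt₂ (fun y : curvePoints (normalCubic a b c) × curvePoints (normalCubic a b c) =>
      y.1 + y.2) x := by
  let _ := legendreGroup h
  by_cases hx : x.1 = x.2
  swap
  · exact regularAt₂_add_of_ne h x hx
  obtain ⟨t, ht0, htx, htt⟩ : ∃ t : curvePoints (normalCubic a b c),
      t ≠ 0 ∧ t ≠ x.1 ∧ t + t + (x.1 + x.1) ≠ 0 := by
    by_cases h2 : x.1 + x.1 = 0
    · obtain ⟨t, ht⟩ := exists_add_self_ne_zero h
      refine ⟨t, ?_, ?_, ?_⟩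
      · rintro rfl
        exact ht (add_zero 0)
      · rintro rfl
        exact ht h2
      · rwa [h2, add_zero]
    · have hc := ncard_two_torsion h
      obtain ⟨t, ht0, htt⟩ := Set.nonempty_of_ncard_ne_zero (by rw [hc]; decide)
      refine ⟨t, ht0, ?_, ?_⟩
      · rintro rfl
        exact h2 htt
      · rwa [htt, zero_add]
  have h1 : RegularAt₂ (fun y : curvePoints (normalCubic a b c) × curvePoints (normalCubic a b c) =>
      y.1 + t) x :=
    (regularAt₂_fst x).comp₂ (h := fun y => y.1 + y.2) (regularAlong_const t x)
      (regularAt₂_add_of_ne h (x.1, t) htx.symm)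
  have h2 : RegularAt₂ (fun y : curvePoints (normalCubic a b c) × curvePoints (normalCubic a b c) =>
      y.1 + t + y.2) x :=
    h1.comp₂ (h := fun y => y.1 + y.2) (regularAt₂_snd x)
      (regularAt₂_add_of_ne h (x.1 + t, x.2) (by simpa [← hx] using ht0))
  have h3 := h2.comp₂ (h := fun y => y.1 + y.2) (regularAlong_const (-t) x)
    (regularAt₂_add_of_ne h (x.1 + t + x.2, -t) (fun h0 => htt (by
      have h4 : x.1 + t + x.2 = -t := h0
      rw [eq_neg_iff_add_eq_zero, ← hx] at h4
      rw [← h4]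
      abel)))
  have e : (fun y : curvePoints (normalCubic a b c) × curvePoints (normalCubic a b c) =>
      y.1 + y.2) = fun y => y.1 + t + y.2 + -t := by
    ext1 y
    abel
  rw [e]
  exact h3

end GroupLaw

section Transport

variable {k : Type*} [Field k]

theorem smul_eq_mk (g : (Fin 3 → k) ≃ₗ[k] (Fin 3 → k)) (p : Plane k) :
    g • p = Projectivization.mk k (g p.rep) (g.map_ne_zero_iff.mpr p.rep_nonzero) := by
  conv_lhs => rw [← p.mk_rep]
  exact Projectivization.smul_mk g p.rep_nonzero

theorem smul_mem_curvePoints_iff {G : MvPolynomial (Fin 3) k} {n : ℕ} (hG : G.IsHomogeneous n)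
    (g : (Fin 3 → k) ≃ₗ[k] (Fin 3 → k)) (p : Plane k) :
    g • p ∈ curvePoints G ↔ p ∈ curvePoints (pullback g G) := by
  rw [smul_eq_mk, mk_mem_curvePoints hG, mem_curvePoints_iff, eval_pullback]

theorem curvePoints_smul {G : MvPolynomial (Fin 3) k} {c : k} (hc : c ≠ 0) :
    curvePoints (c • G) = curvePoints G := by
  ext p
  rw [mem_curvePoints_iff, mem_curvePoints_iff, smul_eval, mul_eq_zero, or_iff_right hc]

/-- The restriction of a projective transformation to a curve is regular. -/
theorem isRegularMap_of_eq_smul [Infinite k] {S T : Set (Plane k)} (g : (Fin 3 → k) ≃ₗ[k] (Fin 3 → k))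
    {f : S → T} (hf : ∀ x, (f x : Plane k) = g • (x : Plane k)) : IsRegularMap f := by
  have he : ∀ v, (fun j => eval v (pullback g (X j))) = g v := fun v => by
    ext j
    rw [eval_pullback, eval_X]
  refine fun x => ⟨1, fun j => pullback g (X j), fun j => IsHomogeneous.pullback g (isHomogeneous_X k j), ?_,
    fun y hy => ?_⟩
  · rw [he]
    exact g.map_ne_zero_iff.mpr x.1.rep_nonzero
  · rw [hf, smul_eq_mk]
    congr 1
    exact (he _).symm

theorem isRegularMap_add_left [Infinite k] {S : Set (Plane k)} [AddGroup S]
    (hA : IsAlgebraicGroup S) (t : S) : IsRegularMap fun x : S => t + x := by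
  have h := isRegularMap₂_iff.mp hA.regular_add
  exact isRegularMap_iff.mpr fun x =>
    (regularAlong_const t x).comp₂ (h := fun y => y.1 + y.2) (regularAt_id x) (h _)

theorem isRegularMap_add_right [Infinite k] {S : Set (Plane k)} [AddGroup S]
    (hA : IsAlgebraicGroup S) (t : S) : IsRegularMap fun x : S => x + t := by
  have h := isRegularMap₂_iff.mp hA.regular_add
  exact isRegularMap_iff.mpr fun x =>
    (regularAt_id x).comp₂ (h := fun y => y.1 + y.2) (regularAlong_const t x) (h _)

theorem isAlgebraicGroup_subRight [Infinite k] {S : Set (Plane k)} [AddCommGroup S]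
    (hA : IsAlgebraicGroup S) (O : S) : @IsAlgebraicGroup k _ S (Equiv.subRight O).addGroup := by
  have hs := isRegularMap_iff.mp (isRegularMap_add_right hA (-O))
  have ht := isRegularMap_iff.mp (isRegularMap_add_right hA O)
  have h2 := isRegularMap₂_iff.mp hA.regular_add
  have h3 := isRegularMap_iff.mp hA.regular_neg
  refine @IsAlgebraicGroup.mk k _ S (Equiv.subRight O).addGroup ?_ ?_
  · rw [isRegularMap₂_iff]
    intro x
    have h1 := (((regularAt₂_fst x).comp (hs _)).comp₂ (h := fun y => y.1 + y.2)
      ((regularAt₂_snd x).comp (hs _)) (h2 _)).comp (ht _)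
    refine (congrArg (RegularAt₂ · x) (_root_.funext fun y => ?_)).mp h1
    change _ = (y.1 - O) + (y.2 - O) + O
    simp only [sub_eq_add_neg, Function.comp_apply]
  · rw [isRegularMap_iff]
    intro x
    refine (congrArg (RegularAt · x) (_root_.funext fun y => ?_)).mp
      (((hs x).comp (h3 _)).comp (ht _))
    change _ = -(y - O) + O
    simp only [sub_eq_add_neg, Function.comp_apply]

/-- A binary operation with a neutral element, cancellation of the second operand, and regular
translations. -/
structure IsRegularLoop {S : Set (Plane k)} (m : S → S → S) (O : S) : Prop where
  regular : ∀ x, IsRegularMap (m x)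
  neutral_left : ∀ y, m O y = y
  neutral_right : ∀ x, m x O = x
  eq_neutral : ∀ x y, m x y = y → x = O

theorem IsAlgebraicGroup.isRegularLoop [Infinite k] {S : Set (Plane k)} [AddGroup S]
    (hA : IsAlgebraicGroup S) : IsRegularLoop (fun x y : S => x + y) 0 :=
  ⟨isRegularMap_add_left hA, zero_add, add_zero, fun _ _ h => add_eq_right.mp h⟩

/-- A smooth cubic has a commutative algebraic group structure whose origin is an inflexion
point. -/
theorem exists_addCommGroup [IsAlgClosed k] [CharZero k] {G : MvPolynomial (Fin 3) k}
    (hG : IsSmoothCubic G) :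
    ∃ (_ : AddCommGroup (curvePoints G)) (ℓ : (Fin 3 → k) →ₗ[k] k),
      IsAlgebraicGroup (curvePoints G) ∧ (∀ x : curvePoints G, ℓ x.1.rep = 0 ↔ x = 0) ∧
      {t : curvePoints G | t ≠ 0 ∧ t + t = 0}.ncard = 3 := by
  have : Infinite k := IsAlgClosed.instInfinite
  obtain ⟨g, a, b, c, r, hr, hg⟩ := exists_pullback_eq_normalCubic hG
  have hN : IsSmoothCubic (normalCubic a b c) := by
    have h1 := (hG.pullback g).smul (inv_ne_zero hr)
    rwa [hg, smul_smul, inv_mul_cancel₀ hr, one_smul] at h1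
  have hmem : ∀ p : Plane k, p ∈ curvePoints (normalCubic a b c) ↔ g • p ∈ curvePoints G :=
    fun p => by rw [smul_mem_curvePoints_iff hG.1, hg, curvePoints_smul hr]
  let e : curvePoints (normalCubic a b c) ≃ curvePoints G :=
    (MulAction.toPerm g).subtypeEquiv hmem
  have he : IsRegularMap e := isRegularMap_of_eq_smul g fun x => rfl
  have he' : IsRegularMap e.symm := isRegularMap_of_eq_smul g⁻¹ fun x => rfl
  rw [isRegularMap_iff] at he he'
  let _ := legendreGroup hN
  refine ⟨e.symm.addCommGroup, LinearMap.proj 2 ∘ₗ g.symm.toLinearMap,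
    @IsAlgebraicGroup.mk _ _ _ e.symm.addGroup ?_ ?_, fun x => ?_, ?_⟩
  · rw [isRegularMap₂_iff]
    intro x
    have h1 := ((regularAt₂_fst x).comp (he' _)).comp₂ (h := fun y => y.1 + y.2)
      ((regularAt₂_snd x).comp (he' _)) (regularAt₂_add hN _)
    exact h1.comp (he _)
  · rw [isRegularMap_iff]
    intro x
    exact ((he' x).comp (regularAt_neg hN _)).comp (he _)
  · obtain ⟨p, rfl⟩ := e.surjective x
    obtain ⟨s, hs, hs'⟩ := exists_rep_eq_smul (P := (e p).1) _ (smul_eq_mk g p.1)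
    have h0 : e p = (letI := e.symm.addCommGroup; 0) ↔ p = 0 := e.apply_eq_iff_eq (y := 0)
    rw [h0, ← rep_two_eq_zero_iff hN, hs']
    simp [hs]
  · rw [← ncard_two_torsion hN]
    refine Set.ncard_congr (fun t _ => e.symm t) (fun t ht => ⟨?_, ?_⟩) (fun s t _ _ h =>
      e.symm.injective h) fun t ht => ⟨e t, ⟨?_, ?_⟩, e.symm_apply_apply t⟩
    · exact fun h => ht.1 ((e.symm_apply_eq).mp h)
    · exact e.injective ht.2
    · exact fun h => ht.1 (e.injective h)
    · change e (e.symm (e t) + e.symm (e t)) = e 0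
      rw [e.symm_apply_apply, ht.2]

end Transport

section Translations

variable {k : Type*} [Field k] [IsAlgClosed k] {G : MvPolynomial (Fin 3) k}

theorem exists_eq_add_of_ne_self [AddCommGroup (curvePoints G)] (hG : IsSmoothCubic G)
    (hA : IsAlgebraicGroup (curvePoints G)) {ℓ : (Fin 3 → k) →ₗ[k] k}
    (hℓ : ∀ x : curvePoints G, ℓ x.1.rep = 0 ↔ x = 0) {f : curvePoints G → curvePoints G}
    (hf : IsRegularMap f) (hne : ∀ x, f x ≠ x) : ∃ t, ∀ x, f x = x + t := by
  have : Infinite k := IsAlgClosed.instInfinite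
  have h1 : IsRegularMap fun x => f x + -x := by
    have h2 := isRegularMap₂_iff.mp hA.regular_add
    have h3 := isRegularMap_iff.mp hA.regular_neg
    rw [isRegularMap_iff] at hf ⊢
    exact fun x => (hf x).comp₂ (h := fun y => y.1 + y.2) (h3 x) (h2 _)
  refine ⟨f 0 + -0, fun x => ?_⟩
  rw [← regularMap_const hG h1 ℓ (fun x => ?_) x 0]
  · abel
  · rw [Ne, hℓ, ← sub_eq_add_neg, sub_eq_zero]
    exact hne x

/-- Two algebraic group structures on a smooth cubic differ by a translation. -/
theorem binop_eq_add_sub [AddCommGroup (curvePoints G)] (hG : IsSmoothCubic G)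
    (hA : IsAlgebraicGroup (curvePoints G)) {ℓ : (Fin 3 → k) →ₗ[k] k}
    (hℓ : ∀ x : curvePoints G, ℓ x.1.rep = 0 ↔ x = 0)
    {m : curvePoints G → curvePoints G → curvePoints G} {O : curvePoints G}
    (hm : IsRegularLoop m O) (x y : curvePoints G) : m x y = x + y - O := by
  by_cases hx : x = O
  · rw [hx, hm.neutral_left]
    abel
  · obtain ⟨t, ht⟩ := exists_eq_add_of_ne_self hG hA hℓ (hm.regular x) fun y hy => hx (hm.eq_neutral x y hy)
    have h1 := ht O
    rw [hm.neutral_right] at h1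
    rw [ht y, h1]
    abel

variable [CharZero k]

theorem IsRegularLoop.exists_eq {m : curvePoints G → curvePoints G → curvePoints G}
    {O : curvePoints G} (hm : IsRegularLoop m O) (hG : IsSmoothCubic G)
    {f : curvePoints G → curvePoints G} (hf : IsRegularMap f) (hne : ∀ x, f x ≠ x) :
    ∃ t, ∀ x, f x = m x t := by
  obtain ⟨A, ℓ, hA, hℓ, -⟩ := exists_addCommGroup hG
  obtain ⟨s, hs⟩ := exists_eq_add_of_ne_self hG hA hℓ hf hne
  exact ⟨s + O, fun x => by rw [hs, binop_eq_add_sub hG hA hℓ hm]; abel⟩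

theorem addOrderOf_eq_two_iff {A : Type*} [AddGroup A] {t : A} :
    addOrderOf t = 2 ↔ t ≠ 0 ∧ t + t = 0 := by
  rw [addOrderOf_eq_prime_iff, two_nsmul, and_comm]

theorem setOf_isFreeRegularInvolution [AddGroup (curvePoints G)] (hG : IsSmoothCubic G)
    (hB : IsAlgebraicGroup (curvePoints G)) :
    {i : curvePoints G → curvePoints G | IsFreeRegularInvolution i} =
      (fun t x => x + t) '' {t : curvePoints G | addOrderOf t = 2} := by
  have : Infinite k := IsAlgClosed.instInfinite
  ext i
  simp only [Set.mem_ofPred_eq, Set.mem_image, addOrderOf_eq_two_iff]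
  constructor
  · intro hi
    obtain ⟨t, ht⟩ := hB.isRegularLoop.exists_eq hG hi.regular hi.ne_self
    refine ⟨t, ⟨?_, ?_⟩, (_root_.funext ht).symm⟩
    · rintro rfl
      exact hi.ne_self 0 (by rw [ht, add_zero])
    · have h1 := hi.involutive 0
      rwa [ht, ht, zero_add] at h1
  · rintro ⟨t, ⟨ht, htt⟩, rfl⟩
    exact ⟨isRegularMap_add_right hB t, fun x => by simp only [add_assoc, htt, add_zero],
      fun x hx => ht (add_eq_left.mp hx)⟩

theorem injective_translation {A : Type*} [AddGroup A] :
    Function.Injective fun t x : A => x + t := fun s t h => by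
  simpa using congrFun h 0

theorem ncard_isFreeRegularInvolution (hG : IsSmoothCubic G) :
    {i : curvePoints G → curvePoints G | IsFreeRegularInvolution i}.ncard = 3 := by
  obtain ⟨A, ℓ, hA, -, h3⟩ := exists_addCommGroup hG
  rw [setOf_isFreeRegularInvolution hG hA, Set.ncard_image_of_injective _ injective_translation]
  simpa only [addOrderOf_eq_two_iff] using h3

theorem ncard_addOrderOf_eq_two [AddGroup (curvePoints G)] (hG : IsSmoothCubic G)
    (hB : IsAlgebraicGroup (curvePoints G)) :
    {t : curvePoints G | addOrderOf t = 2}.ncard = 3 := by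
  rw [← ncard_isFreeRegularInvolution hG, setOf_isFreeRegularInvolution hG hB,
    Set.ncard_image_of_injective _ injective_translation]

theorem existsUnique_algebraicGroup (hG : IsSmoothCubic G) (O : curvePoints G) :
    ∃! _ : AddGroup (curvePoints G),
      (0 : curvePoints G) = O ∧ IsAlgebraicGroup (curvePoints G) := by
  have : Infinite k := IsAlgClosed.instInfinite
  have key (_ : AddGroup (curvePoints G)) (hB0 : (0 : curvePoints G) = O)
      (hB : IsAlgebraicGroup (curvePoints G)) :
      IsRegularLoop (fun x y : curvePoints G => x + y) O := hB0 ▸ hB.isRegularLoop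
  obtain ⟨_, ℓ, hA, hℓ, -⟩ := exists_addCommGroup hG
  refine existsUnique_of_exists_of_unique
    ⟨(Equiv.subRight O).addGroup, zero_add O, isAlgebraicGroup_subRight hA O⟩ ?_
  rintro B B' ⟨hB0, hB⟩ ⟨hB0', hB'⟩
  refine AddGroup.ext ?_
  ext1 x
  ext1 y
  exact (binop_eq_add_sub hG hA hℓ (key B hB0 hB) x y).trans
    (binop_eq_add_sub hG hA hℓ (key B' hB0' hB') x y).symm

end Translations

section Antihessians

variable {k : Type*} [Field k]

/-- A cubic whose Hessian is proportional to `normalCubic e m n`. -/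
noncomputable def antihessian (e m n : k) : MvPolynomial (Fin 3) k :=
  C 3 * (X 0 - C e * X 2) * X 1 ^ 2 +
    C (3 * ((e - m) * (e - n))) * (X 0 - C e * X 2) ^ 2 * X 2 +
    C (2 * e - m - n) * (X 0 - C e * X 2) ^ 3 - C (((e - m) * (e - n)) ^ 2) * X 2 ^ 3

theorem eval_antihessian (e m n : k) (v : Fin 3 → k) : eval v (antihessian e m n) =
    3 * (v 0 - e * v 2) * v 1 ^ 2 + 3 * ((e - m) * (e - n)) * (v 0 - e * v 2) ^ 2 * v 2 +
      (2 * e - m - n) * (v 0 - e * v 2) ^ 3 - ((e - m) * (e - n)) ^ 2 * v 2 ^ 3 := by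
  simp [antihessian]

theorem isHomogeneous_antihessian [Infinite k] (e m n : k) : (antihessian e m n).IsHomogeneous 3 :=
  isHomogeneous_of_eval fun t v => by
    simp only [eval_antihessian, Pi.smul_apply, smul_eq_mul]
    ring

theorem hessian_antihessian [Infinite k] (e m n : k) : hessian (antihessian e m n) =
    (216 * ((e - m) * (e - n)) ^ 2) • normalCubic e m n := by
  refine MvPolynomial.funext fun v => ?_
  rw [smul_eval, eval_normalCubic, eval_hessian, Matrix.det_fin_three]
  obtain ⟨U, hU⟩ : ∃ U : MvPolynomial (Fin 3) k, U = X 0 - C e * X 2 := ⟨_, rfl⟩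
  obtain ⟨b, hb⟩ : ∃ b, b = (e - m) * (e - n) := ⟨_, rfl⟩
  obtain ⟨a, ha⟩ : ∃ a, a = 2 * e - m - n := ⟨_, rfl⟩
  have u0 : pderiv 0 U = 1 := by simp [hU, pderiv_X]
  have u1 : pderiv 1 U = 0 := by simp [hU, pderiv_X]
  have u2 : pderiv 2 U = -C e := by simp [hU, pderiv_X]
  have y0 : pderiv 0 (X 1 : MvPolynomial (Fin 3) k) = 0 := pderiv_X_of_ne (by decide)
  have y2 : pderiv 2 (X 1 : MvPolynomial (Fin 3) k) = 0 := pderiv_X_of_ne (by decide)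
  have z0 : pderiv 0 (X 2 : MvPolynomial (Fin 3) k) = 0 := pderiv_X_of_ne (by decide)
  have z1 : pderiv 1 (X 2 : MvPolynomial (Fin 3) k) = 0 := pderiv_X_of_ne (by decide)
  have p3 : ∀ j, pderiv j (3 : MvPolynomial (Fin 3) k) = 0 := fun j => by
    rw [← map_ofNat C 3, pderiv_C]
  have p6 : ∀ j, pderiv j (6 : MvPolynomial (Fin 3) k) = 0 := fun j => by
    rw [← map_ofNat C 6, pderiv_C]
  have hD : ∀ j, pderiv j (antihessian e m n) =
      pderiv j U * (C 3 * X 1 ^ 2 + C (6 * b) * U * X 2 + C (3 * a) * U ^ 2) +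
        pderiv j (X 1) * (C 6 * U * X 1) +
        pderiv j (X 2) * (C (3 * b) * U ^ 2 - C (3 * b ^ 2) * X 2 ^ 2) := by
    intro j
    rw [antihessian, ← hU, ← hb, ← ha]
    simp only [map_add, map_sub, Derivation.leibniz, Derivation.leibniz_pow, pderiv_C, smul_eq_mul,
      nsmul_eq_mul, C_mul, C_pow, map_ofNat, p3]
    push_cast
    ring
  have hU' : eval v U = v 0 - e * v 2 := by simp [hU]
  simp only [hessMatrix, Matrix.of_apply, hD, map_add, map_sub, Derivation.leibniz,
    Derivation.leibniz_pow, pderiv_C, u0, u1, u2, y0, y2, z0, z1, pderiv_X_self, smul_eq_mul,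
    nsmul_eq_mul, map_mul, map_neg, map_pow, eval_C, eval_X, map_zero, map_one, hU', map_natCast,
    map_ofNat, p3, p6, pderiv_one, mul_zero, zero_mul, add_zero, zero_add]
  rw [← hb]
  obtain ⟨u, hu⟩ : ∃ u, u = v 0 - e * v 2 := ⟨_, rfl⟩
  have h1 : (v 0 - e * v 2) * (v 0 - m * v 2) * (v 0 - n * v 2) =
      u ^ 3 + a * u ^ 2 * v 2 + b * u * v 2 ^ 2 := by
    rw [hu, ha, hb]
    ring
  rw [h1, ← hu]
  push_cast
  ring

theorem normalCubic_swap (a b c : k) : normalCubic b a c = normalCubic a b c := by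
  rw [normalCubic, normalCubic]
  ring

theorem normalCubic_rotate (a b c : k) : normalCubic c a b = normalCubic a b c := by
  rw [normalCubic, normalCubic]
  ring

theorem eq_of_antihessian_eq_smul [CharZero k] {e m n e' m' n' c : k}
    (h : antihessian e' m' n' = c • antihessian e m n) : e' = e := by
  have h1 : ∀ v : Fin 3 → k, _ := fun v => congrArg (eval v) h
  simp only [smul_eval, eval_antihessian] at h1
  have a1 := h1 ![1, 1, 0]
  have a2 := h1 ![1, 0, 0]
  have b1 := h1 ![0, 1, 1]
  have b2 := h1 ![0, 0, 1]
  simp at a1 a2 b1 b2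
  have h3 : (3 : k) ≠ 0 := by norm_num
  have hc : c = 1 := mul_left_cancel₀ h3 (by linear_combination a2 - a1)
  subst hc
  exact mul_left_cancel₀ h3 (by linear_combination b2 - b1)

/-- A smooth cubic is the Hessian of three pairwise nonproportional cubics. -/
theorem exists_three_antihessians [IsAlgClosed k] [CharZero k] {G : MvPolynomial (Fin 3) k}
    (hG : IsSmoothCubic G) : ∃ F : Fin 3 → MvPolynomial (Fin 3) k,
      (∀ j, (F j).IsHomogeneous 3) ∧ (∀ j, ∃ c : k, c ≠ 0 ∧ hessian (F j) = c • G) ∧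
      ∀ i j (c : k), F i = c • F j → i = j := by
  have : Infinite k := IsAlgClosed.instInfinite
  obtain ⟨g, a, b, c, r, hr, hg⟩ := exists_pullback_eq_normalCubic hG
  have hN : IsSmoothCubic (normalCubic a b c) := by
    have h1 := (hG.pullback g).smul (inv_ne_zero hr)
    rwa [hg, smul_smul, inv_mul_cancel₀ hr, one_smul] at h1
  obtain ⟨hab, hac, hbc⟩ := normalCubic_ne hN
  have hGN : pullback g.symm (normalCubic a b c) = r⁻¹ • G := by
    rw [← pullback_symm_pullback g G, hg]
    refine MvPolynomial.funext fun v => ?_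
    simp [eval_pullback, hr]
  have key : ∀ e m n : k, e ≠ m → e ≠ n → normalCubic e m n = normalCubic a b c →
      ∃ s : k, s ≠ 0 ∧ hessian (pullback g.symm (antihessian e m n)) = s • G := by
    intro e m n hm hn h
    refine ⟨(LinearMap.toMatrix' g.symm.toLinearMap).det ^ 2 * (216 * ((e - m) * (e - n)) ^ 2) * r⁻¹,
      ?_, ?_⟩
    · exact mul_ne_zero (mul_ne_zero (pow_ne_zero 2 (toMatrix'_det_ne_zero g.symm))
        (mul_ne_zero (by norm_num) (pow_ne_zero 2
          (mul_ne_zero (sub_ne_zero.mpr hm) (sub_ne_zero.mpr hn))))) (inv_ne_zero hr)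
    · rw [hessian_pullback, hessian_antihessian, h, pullback, map_smul, ← pullback, hGN, smul_smul,
        smul_smul]
  refine ⟨fun j => pullback g.symm (![antihessian a b c, antihessian b a c, antihessian c a b] j),
    fun j => IsHomogeneous.pullback _ ?_, fun j => ?_, fun i j s h => ?_⟩
  · fin_cases j <;> exact isHomogeneous_antihessian _ _ _
  · fin_cases j
    · exact key _ _ _ hab hac rfl
    · exact key _ _ _ hab.symm hbc (normalCubic_swap a b c)
    · exact key _ _ _ hac.symm hbc.symm (normalCubic_rotate a b c)
  · have h : pullback g.symm (![antihessian a b c, antihessian b a c, antihessian c a b] i) =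
        s • pullback g.symm (![antihessian a b c, antihessian b a c, antihessian c a b] j) := h
    have h1 : ![antihessian a b c, antihessian b a c, antihessian c a b] i =
        s • ![antihessian a b c, antihessian b a c, antihessian c a b] j := by
      rw [← pullback_pullback_symm g (![antihessian a b c, antihessian b a c, antihessian c a b] i), h,
        pullback, map_smul, ← pullback, pullback_pullback_symm]
    fin_cases i <;> fin_cases j <;> first | rfl | exact absurd (eq_of_antihessian_eq_smul h1) ‹_› |
      exact absurd (eq_of_antihessian_eq_smul h1).symm ‹_›

variable [IsAlgClosed k] [CharZero k]

theorem exists_conjugateInvolution_of_hessian {F G : MvPolynomial (Fin 3) k}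
    (hF : F.IsHomogeneous 3) (hG : IsSmoothCubic G) {c : k} (hc : c ≠ 0)
    (h : hessian F = c • G) :
    ∃ i : curvePoints G → curvePoints G,
      (∀ x : curvePoints G, CommonConjugate (jacobianNet F) x (i x)) ∧
        IsFreeRegularInvolution i ∧ conicsConjugate i = jacobianNet F := by
  have hH : IsSmoothCubic (hessian F) := h ▸ hG.smul hc
  have hS : curvePoints (hessian F) = curvePoints G := by rw [h, curvePoints_smul hc]
  have key : ∃ i : curvePoints (hessian F) → curvePoints (hessian F),
      (∀ x : curvePoints (hessian F), CommonConjugate (jacobianNet F) x (i x)) ∧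
        IsFreeRegularInvolution i ∧ conicsConjugate i = jacobianNet F := by
    obtain ⟨i, hi, hi'⟩ := exists_conjugateInvolution hF hH
    exact ⟨i, hi, hi', conicsConjugate_eq_jacobianNet hF hH i hi⟩
  rwa [hS] at key

/-- Every regular involution without fixed point of a smooth cubic is the conjugation with respect
to the net of polars of a cubic of which the curve is the Hessian. -/
theorem IsFreeRegularInvolution.exists_cubic {G : MvPolynomial (Fin 3) k} (hG : IsSmoothCubic G)
    {i : curvePoints G → curvePoints G} (hi : IsFreeRegularInvolution i) :
    ∃ F : MvPolynomial (Fin 3) k, F.IsHomogeneous 3 ∧ (∃ c : k, c ≠ 0 ∧ hessian F = c • G) ∧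
      conicsConjugate i = jacobianNet F := by
  have : Infinite k := IsAlgClosed.instInfinite
  obtain ⟨F, hF, hc, hinj⟩ := exists_three_antihessians hG
  choose c hc0 hc using hc
  choose I hI hfree hconics using fun j =>
    exists_conjugateInvolution_of_hessian (hF j) hG (hc0 j) (hc j)
  have hIinj : Function.Injective I := by
    intro j l hjl
    have hV := isNetWithSmoothDiscriminant_jacobianNet (hF l) (hc l ▸ hG.smul (hc0 l))
    have hJ : jacobianNet (F j) = jacobianNet (F l) := by rw [← hconics, ← hconics, hjl]
    obtain ⟨s, -, hs⟩ := eq_smul_of_jacobianNet_eq hV.isRegularNet (hF l) (hF j) rfl hJ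
      (ne_zero_of_jacobianNet_eq hV.1 rfl) (ne_zero_of_jacobianNet_eq hV.1 hJ)
    exact hinj j l s hs
  have h3 := ncard_isFreeRegularInvolution hG
  have hrange : Set.range I = {i : curvePoints G → curvePoints G | IsFreeRegularInvolution i} := by
    refine Set.eq_of_subset_of_ncard_le (Set.range_subset_iff.mpr hfree) ?_
      (Set.finite_of_ncard_ne_zero (by rw [h3]; decide))
    rw [h3, ← Set.image_univ, Set.ncard_image_of_injective _ hIinj, Set.ncard_univ, Nat.card_fin]
  obtain ⟨j, rfl⟩ := hrange.symm.subset hi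
  exact ⟨F j, hF j, ⟨c j, hc0 j, hc j⟩, hconics j⟩

end Antihessians

section Equivariance

variable {k : Type*} [Field k]

theorem conjugate_mk_iff {q : MvPolynomial (Fin 3) k} (hq : q.IsHomogeneous 2) {u v : Fin 3 → k}
    (hu : u ≠ 0) (hv : v ≠ 0) :
    Conjugate q (Projectivization.mk k u hu) (Projectivization.mk k v hv) ↔
      ∑ j, v j * eval u (pderiv j q) = 0 := by
  obtain ⟨a, ha, ha'⟩ := exists_rep_eq_smul hu rfl
  obtain ⟨b, hb, hb'⟩ := exists_rep_eq_smul hv rfl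
  rw [Conjugate_iff hq, ha', hb', Matrix.mulVec_smul, dotProduct_smul, smul_dotProduct]
  simp [ha, hb, eval_pderiv_quadric hq, dotProduct]

theorem conjugate_smul_iff {q : MvPolynomial (Fin 3) k} (hq : q.IsHomogeneous 2)
    (g : (Fin 3 → k) ≃ₗ[k] (Fin 3 → k)) (x y : Plane k) :
    Conjugate q (g • x) (g • y) ↔ Conjugate (pullback g q) x y := by
  rw [smul_eq_mk, smul_eq_mk, conjugate_mk_iff hq, Conjugate]
  simp only [eval_pderiv_pullback, Finset.mul_sum]
  rw [Finset.sum_comm]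
  refine iff_of_eq (congrArg (· = 0) (Finset.sum_congr rfl fun i _ => ?_))
  have h : y.rep = ∑ j, y.rep j • (Pi.single j 1 : Fin 3 → k) := by
    ext l
    simp [Finset.sum_apply, Pi.single_apply]
  have h2 : g y.rep i = ∑ j, y.rep j * g (Pi.single j 1) i := by
    conv_lhs => rw [h, map_sum, Finset.sum_apply]
    simp
  rw [h2, Finset.sum_mul]
  simp only [mul_assoc]

theorem isHomogeneous_pullback_iff [Infinite k] (g : (Fin 3 → k) ≃ₗ[k] (Fin 3 → k))
    {q : MvPolynomial (Fin 3) k} {d : ℕ} :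
    (pullback g q).IsHomogeneous d ↔ q.IsHomogeneous d :=
  ⟨fun h => by simpa only [pullback_symm_pullback] using IsHomogeneous.pullback g.symm h,
    IsHomogeneous.pullback g⟩

theorem CarriesCurve.carriesNet [Infinite k] {g : (Fin 3 → k) ≃ₗ[k] (Fin 3 → k)}
    {G G' : MvPolynomial (Fin 3) k} {i : curvePoints G → curvePoints G}
    {i' : curvePoints G' → curvePoints G'} {n : ℕ} (hG' : G'.IsHomogeneous n)
    (h : CarriesCurve g G i G' i') : CarriesNet g (conicsConjugate i) (conicsConjugate i') := by
  obtain ⟨⟨c, hc, hcG⟩, h⟩ := h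
  have hmem : ∀ p : Plane k, g • p ∈ curvePoints G' ↔ p ∈ curvePoints G := fun p => by
    rw [smul_mem_curvePoints_iff hG', hcG, curvePoints_smul hc]
  refine fun q => ⟨fun hq => ⟨IsHomogeneous.pullback g hq.1, fun x => ?_⟩, fun hq => ?_⟩
  · rw [← conjugate_smul_iff hq.1]
    have h1 := hq.2 ⟨g • (x : Plane k), (hmem x).mpr x.2⟩
    rwa [h x _ rfl] at h1
  · have hq2 := (isHomogeneous_pullback_iff g).mp hq.1
    refine ⟨hq2, fun x' => ?_⟩
    have hx : g • (g⁻¹ • (x' : Plane k)) = x' := smul_inv_smul g _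
    have h1 := hq.2 ⟨g⁻¹ • (x' : Plane k), (hmem _).mp (by rw [hx]; exact x'.2)⟩
    rwa [← conjugate_smul_iff hq2, ← h _ x' hx.symm, hx] at h1

theorem CarriesNet.commonConjugate_smul_iff [Infinite k] {g : (Fin 3 → k) ≃ₗ[k] (Fin 3 → k)}
    {V V' : Submodule k (MvPolynomial (Fin 3) k)} (h : CarriesNet g V V')
    (hV' : V' ≤ homogeneousSubmodule (Fin 3) k 2) (x y : Plane k) :
    CommonConjugate V' (g • x) (g • y) ↔ CommonConjugate V x y := by
  constructor
  · intro hxy p hp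
    rw [← pullback_pullback_symm g p] at hp ⊢
    have hp' := (h _).mpr hp
    exact (conjugate_smul_iff (hV' hp') g x y).mp (hxy _ hp')
  · intro hxy q hq
    exact (conjugate_smul_iff (hV' hq) g x y).mpr (hxy _ ((h q).mp hq))

variable [IsAlgClosed k] [CharZero k]

theorem CarriesNet.carriesCurve {g : (Fin 3 → k) ≃ₗ[k] (Fin 3 → k)}
    {G G' : MvPolynomial (Fin 3) k} {i : curvePoints G → curvePoints G}
    {i' : curvePoints G' → curvePoints G'} (hG : IsSmoothCubic G) (hi : IsFreeRegularInvolution i)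
    (hG' : IsSmoothCubic G') (hi' : IsFreeRegularInvolution i')
    (h : CarriesNet g (conicsConjugate i) (conicsConjugate i')) : CarriesCurve g G i G' i' := by
  have : Infinite k := IsAlgClosed.instInfinite
  obtain ⟨F, hF, ⟨c, hc, hcF⟩, hV⟩ := hi.exists_cubic hG
  obtain ⟨F', hF', ⟨c', hc', hcF'⟩, hV'⟩ := hi'.exists_cubic hG'
  have hconj := h.commonConjugate_smul_iff fun q hq => hq.1
  have hmem : ∀ p : Plane k, p ∈ curvePoints G → g • p ∈ curvePoints G' := by
    intro p hp
    rw [← curvePoints_smul hc, ← hcF, ← exists_commonConjugate_iff hF, ← hV] at hp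
    rw [← curvePoints_smul hc', ← hcF', ← exists_commonConjugate_iff hF', ← hV']
    obtain ⟨y, hy⟩ := hp
    exact ⟨g • y, (hconj p y).mpr hy⟩
  refine ⟨?_, fun x x' hx => ?_⟩
  · have hpG := hG'.pullback g
    obtain ⟨s, hs⟩ := hG.eq_smul_of_vanishing hpG.1 fun v hv hGv => by
      have h1 := hmem _ ((mk_mem_curvePoints hG.1 v hv).mpr hGv)
      rwa [smul_mem_curvePoints_iff hG'.1, mk_mem_curvePoints hpG.1] at h1
    refine ⟨s, ?_, hs⟩
    rintro rfl
    exact hpG.ne_zero (by rw [hs, zero_smul])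
  · have h1 : CommonConjugate (conicsConjugate i') x' (i' x') := fun q hq => hq.2 x'
    have h2 : CommonConjugate (conicsConjugate i') (g • (x : Plane k)) (g • (i x : Plane k)) :=
      (hconj _ _).mpr fun q hq => hq.2 x
    rw [← hx, hV'] at h2
    rw [hV'] at h1
    exact CommonConjugate.unique hF' (hcF' ▸ hG'.smul hc') h2 h1

end Equivariance

end NetsOfConics

theorem proposition4p4 (k : Type*) [Field k] [IsAlgClosed k] [CharZero k] :
    -- (a)
    (∀ V : Submodule k (MvPolynomial (Fin 3) k), IsNetWithSmoothDiscriminant V →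
      -- the cubic `φ` with `V = J_φ` exists and is unique, and it is smooth
      (∃ F : MvPolynomial (Fin 3) k, IsSmoothCubic F ∧ jacobianNet F = V ∧
        ∀ F' : MvPolynomial (Fin 3) k, F'.IsHomogeneous 3 → jacobianNet F' = V →
          ∃ c : k, c ≠ 0 ∧ F' = c • F) ∧
      ∀ F : MvPolynomial (Fin 3) k, F.IsHomogeneous 3 → jacobianNet F = V →
        IsSmoothCubic (hessian F) ∧
        (∀ x : Plane k, (∃ y, CommonConjugate V x y) ↔ x ∈ curvePoints (hessian F)) ∧
        (∀ x y : Plane k, CommonConjugate V x y →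
          (∀ y', CommonConjugate V x y' → y' = y) ∧ y ≠ x ∧ y ∈ curvePoints (hessian F)) ∧
        ∃ i : curvePoints (hessian F) → curvePoints (hessian F),
          (∀ x : curvePoints (hessian F), CommonConjugate V x (i x)) ∧ IsFreeRegularInvolution i ∧
          V = conicsConjugate i) ∧
    -- (b)
    (∀ (G : MvPolynomial (Fin 3) k) (i : curvePoints G → curvePoints G),
      IsSmoothCubic G → IsFreeRegularInvolution i →
        IsNetWithSmoothDiscriminant (conicsConjugate i) ∧
        ∀ F : MvPolynomial (Fin 3) k, F.IsHomogeneous 3 → jacobianNet F = conicsConjugate i →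
          (∃ c : k, c ≠ 0 ∧ hessian F = c • G) ∧
          ∀ x : curvePoints G, CommonConjugate (conicsConjugate i) x (i x)) ∧
    -- (c)
    ((∀ V : Submodule k (MvPolynomial (Fin 3) k), IsNetWithSmoothDiscriminant V →
        ∃ (G : MvPolynomial (Fin 3) k) (i : curvePoints G → curvePoints G),
          IsSmoothCubic G ∧ IsFreeRegularInvolution i ∧ conicsConjugate i = V) ∧
      ∀ (G : MvPolynomial (Fin 3) k) (i : curvePoints G → curvePoints G)
        (G' : MvPolynomial (Fin 3) k) (i' : curvePoints G' → curvePoints G'),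
        IsSmoothCubic G → IsFreeRegularInvolution i →
        IsSmoothCubic G' → IsFreeRegularInvolution i' →
        ∀ g : (Fin 3 → k) ≃ₗ[k] (Fin 3 → k),
          CarriesCurve g G i G' i' ↔ CarriesNet g (conicsConjugate i) (conicsConjugate i')) ∧
    -- (d)
    (∀ G : MvPolynomial (Fin 3) k, IsSmoothCubic G →
      {i : curvePoints G → curvePoints G | IsFreeRegularInvolution i}.ncard = 3 ∧
      (∀ O : curvePoints G, ∃! A : AddGroup (curvePoints G),
        (0 : curvePoints G) = O ∧ IsAlgebraicGroup (curvePoints G)) ∧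
      ∀ [AddGroup (curvePoints G)], IsAlgebraicGroup (curvePoints G) →
        {t : curvePoints G | addOrderOf t = 2}.ncard = 3 ∧
        {i : curvePoints G → curvePoints G | IsFreeRegularInvolution i} =
          (fun t x => x + t) '' {t : curvePoints G | addOrderOf t = 2}) := by
  refine ⟨fun V hV => ⟨exists_unique_cubic hV, ?_⟩, ?_, ⟨fun V hV => ?_, ?_⟩, fun G hG =>
    ⟨ncard_isFreeRegularInvolution hG, existsUnique_algebraicGroup hG, fun hB =>
      ⟨ncard_addOrderOf_eq_two hG hB, setOf_isFreeRegularInvolution hG hB⟩⟩⟩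
  · have : Infinite k := IsAlgClosed.instInfinite
    rintro F hF rfl
    have hH := isSmoothCubic_hessian hF hV
    refine ⟨hH, exists_commonConjugate_iff hF, fun x y h =>
      ⟨fun y' h' => CommonConjugate.unique hF hH h h', h.ne hF hH, h.mem_curvePoints hF⟩, ?_⟩
    obtain ⟨i, hi, hfree⟩ := exists_conjugateInvolution hF hH
    exact ⟨i, hi, hfree, (conicsConjugate_eq_jacobianNet hF hH i hi).symm⟩
  · have : Infinite k := IsAlgClosed.instInfinite
    intro G i hG hi
    obtain ⟨F, hF, ⟨c, hc, hcF⟩, hV⟩ := hi.exists_cubic hG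
    have hnet := isNetWithSmoothDiscriminant_jacobianNet hF (hcF ▸ hG.smul hc)
    refine ⟨hV ▸ hnet, fun F' hF' hV' => ⟨?_, fun x q hq => hq.2 x⟩⟩
    rw [hV] at hV'
    obtain ⟨s, hs, rfl⟩ := eq_smul_of_jacobianNet_eq hnet.isRegularNet hF hF' rfl hV'
      (ne_zero_of_jacobianNet_eq hnet.1 rfl) (ne_zero_of_jacobianNet_eq hnet.1 hV')
    exact ⟨s ^ 3 * c, mul_ne_zero (pow_ne_zero 3 hs) hc, by rw [hessian_smul, hcF, smul_smul]⟩
  · obtain ⟨F, hF, rfl, -⟩ := exists_unique_cubic hV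
    have hH := isSmoothCubic_hessian hF.1 hV
    obtain ⟨i, hi, hfree⟩ := exists_conjugateInvolution hF.1 hH
    exact ⟨hessian F, i, hH, hfree, conicsConjugate_eq_jacobianNet hF.1 hH i hi⟩
  · have : Infinite k := IsAlgClosed.instInfinite
    exact fun G i G' i' hG hi hG' hi' g =>
      ⟨fun h => h.carriesNet hG'.1, fun h => h.carriesCurve hG hi hG' hi'⟩
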